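/- Let $m\ge 2$ and let $P$ be a compact convex polygon in the hyperbolic plane (curvature $-1$) with $2m$ sides $s_1,\dots,s_{2m}$ and interior angles $\gamma_1,\dots,\gamma_{2m}\in(0,\pi)$, both in cyclic order. Suppose that $P$ is centrally symmetric, i.e. there is a point $o$ such that $P$ is invariant under the reflection across $o$ (the rotation by $\pi$ about $o$), and that $P$ satisfies the cycle condition, i.e. there is an integer $k\ge 1$ such that $$\sum_{i=1}^m\gamma_{2i}=\sum_{i=1}^m\gamma_{2i-1}=\frac{2\pi}{k}.$$ For $1\le i\le 2m$ let $g_i$ be the hyperbolic translation (orientation-preserving isometry of hyperbolic type) that maps the side $s_i$ onto the opposite side $s_{i+m}$, with indices modulo $2m$. Then $$\sum_{i=1}^{2m}\frac{1}{1+e^{\ell(g_i)}}<1,$$ where $\ell(g)=\inf_{z} d(z,gz)$ is the translation length of $g$ in the hyperbolic metric $d$. -/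

import Mathlib

namespace HyperbolicPlane

open UpperHalfPlane

/-- The hyperbolic plane is the upper half-plane `ℍ` with its metric of curvature `-1`.
`discChart a` is the orientation-preserving isometry from `ℍ` onto the Poincaré disc
that sends `a` to the centre `0`. In this conformal chart the geodesics through `a` are the
diameters of the disc. -/
noncomputable def discChart (a z : ℍ) : ℂ :=
  ((z : ℂ) - (a : ℂ)) / ((z : ℂ) - (starRingEnd ℂ) (a : ℂ))

/-- The geodesic segment with endpoints `x` and `y`. -/
def segment (x y : ℍ) : Set ℍ := {z | dist x z + dist z y = dist x y}

/-- Geodesic convexity. -/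
def GeodConvex (s : Set ℍ) : Prop := ∀ x ∈ s, ∀ y ∈ s, segment x y ⊆ s

/-- The geodesic convex hull. -/
def convHull (s : Set ℍ) : Set ℍ := ⋂₀ {t | s ⊆ t ∧ GeodConvex t}

/-- `c` lies strictly to the left of the geodesic line through `a` and `b`, oriented from `a`
to `b`: in the disc chart at `a` the line is the diameter through the image of `b`. -/
def StrictlyLeft (a b c : ℍ) : Prop :=
  0 < ((starRingEnd ℂ) (discChart a b) * discChart a c).im

/-- The angle at `a` between the geodesic rays from `a` to `b` and from `a` to `c`. -/
noncomputable def angleAt (a b c : ℍ) : ℝ :=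
  InnerProductGeometry.angle (discChart a b) (discChart a c)

/-- A compact convex hyperbolic polygon with `n` sides, given by its vertices in
counterclockwise cyclic order: all the other vertices lie strictly to the left of each side. -/
structure ConvexPolygon (n : ℕ) where
  three_le : 3 ≤ n
  vertex : ZMod n → ℍ
  left_of_side : ∀ i j : ZMod n, j ≠ i → j ≠ i + 1 →
    StrictlyLeft (vertex i) (vertex (i + 1)) (vertex j)

namespace ConvexPolygon

variable {n : ℕ}

/-- The polygon as a closed subset of the hyperbolic plane. -/
def region (P : ConvexPolygon n) : Set ℍ := convHull (Set.range P.vertex)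

/-- The `i`-th side. -/
def side (P : ConvexPolygon n) (i : ZMod n) : Set ℍ := segment (P.vertex i) (P.vertex (i + 1))

/-- The interior angle at the `i`-th vertex. -/
noncomputable def angle (P : ConvexPolygon n) (i : ZMod n) : ℝ :=
  angleAt (P.vertex i) (P.vertex (i - 1)) (P.vertex (i + 1))

/-- There is a point `o` such that the polygon is invariant under the reflection across `o`
(the half-turn about `o`), which is `ζ ↦ -ζ` in the disc chart at `o`. -/
def CentrallySymmetric (P : ConvexPolygon n) : Prop :=
  ∃ o : ℍ, ∀ z w : ℍ, discChart o w = -discChart o z → z ∈ P.region → w ∈ P.region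

/-- For a polygon with `2m` sides, the interior angles at alternating vertices have sum `2π/k`,
for both classes of alternating vertices and the same integer `k ≥ 1`. -/
def CycleCondition {m : ℕ} (P : ConvexPolygon (2 * m)) : Prop :=
  ∃ k : ℕ, 1 ≤ k ∧
    ∑ i ∈ Finset.range m, P.angle ((2 * i : ℕ) : ZMod (2 * m)) = 2 * Real.pi / k ∧
    ∑ i ∈ Finset.range m, P.angle ((2 * i + 1 : ℕ) : ZMod (2 * m)) = 2 * Real.pi / k

/-- `g`, acting on `ℍ` by a Möbius transformation, is a hyperbolic translation (a hyperbolic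
element) that maps the `i`-th side of the `2m`-gon onto the opposite side. -/
def IsOppositeSideTranslation {m : ℕ} (P : ConvexPolygon (2 * m)) (i : ZMod (2 * m))
    (g : Matrix.SpecialLinearGroup (Fin 2) ℝ) : Prop :=
  (g : Matrix (Fin 2) (Fin 2) ℝ).IsHyperbolic ∧
    (fun z : ℍ => g • z) '' P.side i = P.side (i + (m : ZMod (2 * m)))

end ConvexPolygon

/-- The translation length in the hyperbolic metric. -/
noncomputable def translationLength (g : Matrix.SpecialLinearGroup (Fin 2) ℝ) : ℝ :=
  ⨅ z : ℍ, dist z (g • z)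

end HyperbolicPlane

/-! Put o at the centre of the unit disc, so that the vertices satisfy p_{i+m} = -p_i. Followed by
the half-turn about o, g_i exchanges the ends of s_i, so it becomes the half-turn about the midpoint
of s_i. The latter sends 0 to the point K_i of `SideRel`, and |K_i| = tanh(ℓ(g_i)/2), so each
summand is (1 - |K_i|)/2. As K_{i+m} = -K_i, the claim is that the sum of 1 - |K_i| over i < m is
below 1 (`chain_bound`). The other input is area: `skew p q` is the signed area of the triangle 0,
p, q, and Gauss–Bonnet (`sum_angle_eq`) with the cycle condition gives half the polygon the area
(m-1)π - 2π/k.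

The core is `sum_one_sub_norm_add_lt_one`: for a chain of n ≥ 3 sides from w_0 to -w_0 with area at
least (n-2)π, the sum of 1 - |K_i| plus a further copy of its least term is below 1. So large an
area forces the chain to turn monotonically about 0 (`star_of_skew_sum`), with apex angles 2τ_i of
total π. A vertex at distance r from 0 is recorded by x = e^{-r}; for a side with end distances r,
s, `sideH` is tanh((r+s)/2) and `sideQ` is cosh((r-s)/2)/cosh((r+s)/2). By Napier's analogy
`sideBeta` is half the sum of the two base angles, and the area bound says that these sum to at most
π/2. Moreover 1 - |K_i| is at most the defect 1 - cos τ_i · H_i. If n ≥ 4, two adjacent sides have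
β-sum at most π/4; deleting their common vertex neither lowers the total defect nor raises the total
β (`sideDefect_merge`, `sideBeta_merge`). This leaves n = 3 (`three_sides`).

For m ≥ 3 and k ≥ 2 the core applies directly. For k = 1 the area is only (m-3)π. Apply the
successive half-turns to the midpoint of the side with least term instead of to p_0: the angle sum
2π makes this orbit end at its antipode, with the same area, while the chosen side shrinks to a
point. The core applies to the other m-1 sides, and its extra copy of the least term pays for the
lost side (`chain_bound_of_max`). Finally m = 2 forces k ≥ 3 and is computed directly
(`quadrilateral_bound`). -/

namespace HyperbolicPlane

/-! ### Triangles with apex at the centre; merging adjacent sides -/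

/-- In terms of half-side data `x`, `y`: the quantity `(x + y) / (1 + x y)`. -/
noncomputable def sideQ (x y : ℝ) : ℝ := (x + y) / (1 + x * y)

/-- In terms of half-side data `x`, `y`: the quantity `(1 - x y) / (1 + x y)`. -/
noncomputable def sideH (x y : ℝ) : ℝ := (1 - x * y) / (1 + x * y)

/-- The angular excess of a side with end data `x`, `y` seen under the angle `2τ`. -/
noncomputable def sideBeta (x y τ : ℝ) : ℝ := Real.arctan (sideQ x y * (Real.cos τ / Real.sin τ))

/-- The bound for the contribution of a side with end data `x`, `y` seen under the angle `2τ`. -/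
noncomputable def sideDefect (x y τ : ℝ) : ℝ := 1 - Real.cos τ * sideH x y

lemma sideQ_comm (x y : ℝ) : sideQ x y = sideQ y x := by
  unfold sideQ; rw [add_comm x y, mul_comm x y]

lemma sideH_comm (x y : ℝ) : sideH x y = sideH y x := by
  unfold sideH; rw [mul_comm x y]

lemma sideQ_pos {x y : ℝ} (hx : 0 < x) (hy : 0 < y) : 0 < sideQ x y := by
  unfold sideQ; positivity

lemma sideQ_le_add {x y : ℝ} (hx : 0 < x) (hy : 0 < y) : sideQ x y ≤ x + y := by
  unfold sideQ
  rw [div_le_iff₀ (by positivity)]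
  nlinarith [mul_pos hx hy]

lemma sideH_pos {x y : ℝ} (hx : 0 < x) (hy : 0 < y) (hx1 : x < 1) (hy1 : y < 1) :
    0 < sideH x y := by
  unfold sideH
  have : x * y < 1 := by nlinarith
  apply div_pos <;> nlinarith [mul_pos hx hy]

lemma sideH_lt_one {x y : ℝ} (hx : 0 < x) (hy : 0 < y) : sideH x y < 1 := by
  unfold sideH
  rw [div_lt_one (by positivity)]
  nlinarith [mul_pos hx hy]

/-- Over the common denominator this is 2x₀²x₁x₂ ≤ x₀² + x₁x₂, true since x₀² and x₁x₂ are below 1.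
-/
lemma one_sub_sideH_add_le {x₀ x₁ x₂ : ℝ} (h₀ : 0 < x₀) (h₁ : 0 < x₁) (h₂ : 0 < x₂)
    (h₀' : x₀ < 1) (h₁' : x₁ < 1) (h₂' : x₂ < 1) :
    (1 - sideH x₀ x₁) + (1 - sideH x₀ x₂) ≤ 2 * (sideQ x₀ x₁ * sideQ x₀ x₂) := by
  unfold sideH sideQ
  have e : (1 - (1 - x₀ * x₁) / (1 + x₀ * x₁)) + (1 - (1 - x₀ * x₂) / (1 + x₀ * x₂))
      = 2 * (x₀ * x₁ * (1 + x₀ * x₂) + x₀ * x₂ * (1 + x₀ * x₁)) /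
        ((1 + x₀ * x₁) * (1 + x₀ * x₂)) := by
    field_simp; ring
  rw [e, div_mul_div_comm, ← mul_div_assoc]
  have h12 : x₁ * x₂ < 1 := by nlinarith
  have h00 : x₀ ^ 2 < 1 := by nlinarith
  gcongr
  nlinarith [mul_pos h₁ h₂, mul_pos (mul_pos h₁ h₂) (sub_pos.2 h00),
    mul_pos (mul_pos h₀ h₀) (sub_pos.2 h12)]

lemma one_sub_sideH_le_sq {x y : ℝ} (hx : 0 < x) (hy : 0 < y) (hx1 : x < 1) (hy1 : y < 1) :
    1 - sideH x y ≤ sideQ x y ^ 2 := by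
  unfold sideH sideQ
  rw [div_pow, one_sub_div (by positivity), div_le_div_iff₀ (by positivity) (by positivity)]
  have : 0 < x * y := mul_pos hx hy
  have h1 : x * y < 1 := by nlinarith
  have h2 : 2 * (x * y) * (1 + x * y) ≤ (x + y) ^ 2 := by
    nlinarith [sq_nonneg (x - y)]
  have := mul_le_mul_of_nonneg_right h2 (by linarith : 0 ≤ 1 + x * y)
  linarith

/-- Inserting u ≤ (1-w)/(1+w) leaves (1-w)³ ≥ 0. -/
lemma sq_div_two_add_le {u w : ℝ} (hu0 : 0 < u) (hw0 : 0 < w) (huw : u + w + u * w ≤ 1) :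
    w ^ 2 / 2 + 2 * (u * w) ≤ 1 / 2 := by
  have h1 := mul_pos hu0 hw0
  have h2 : w < 1 := by linarith
  have h5 : u * (1 + w) ≤ 1 - w := by linarith
  have h6 : (w ^ 2 / 2 + 2 * (u * w)) * (1 + w) ≤ 1 / 2 * (1 + w) := by
    have h7 : 0 ≤ (1 - w) ^ 3 := by
      have : 0 < 1 - w := by linarith
      positivity
    linarith [mul_le_mul_of_nonneg_left h5 hw0.le]
  exact le_of_mul_le_mul_right h6 (by linarith)

/-- The constraint is (1+u)(1+w) ≤ 2, so uw is largest at u = w = √2 - 1, where 2uw = 6 - 4√2 ≈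
0.343; the hint 0.83 approximates u + w there. -/
lemma two_mul_mul_le_of_add {u w : ℝ} (hu0 : 0 < u) (hw0 : 0 < w) (huw : u + w + u * w ≤ 1) :
    2 * (u * w) ≤ 0.35 := by
  by_contra hcon
  push Not at hcon
  nlinarith [sq_nonneg (u - w), mul_pos hu0 hw0, sq_nonneg (u + w - 0.83)]

/-- `(q, h)` estimate behind the merging of two adjacent sides, in half angles. -/
lemma merge_core {A B x₀ x₁ x₂ : ℝ} (hB : 0 < B) (hBA : B ≤ A) (hAB : A + B ≤ Real.pi / 4)
    (h₀ : 0 < x₀) (h₁ : 0 < x₁) (h₂ : 0 < x₂) (h₀' : x₀ < 1) (h₁' : x₁ < 1) (h₂' : x₂ < 1)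
    {u w : ℝ} (hu : u * Real.sin (2 * A) = sideQ x₀ x₁ * Real.cos (2 * A))
    (hw : w * Real.sin (2 * B) = sideQ x₀ x₂ * Real.cos (2 * B))
    (hu0 : 0 < u) (hw0 : 0 < w) (huw : u + w + u * w ≤ 1) :
    Real.cos (2 * A) * (1 - sideH x₀ x₁) + Real.cos (2 * B) * (1 - sideH x₀ x₂) ≤
      4 * Real.cos (A + B) * Real.sin A * Real.sin B := by
  have hpi := Real.pi_pos
  have key := one_sub_sideH_add_le h₀ h₁ h₂ h₀' h₁' h₂'
  have hk2 := one_sub_sideH_le_sq h₀ h₂ h₀' h₂'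
  have hH1 := sideH_lt_one h₀ h₁
  have hH2 := sideH_lt_one h₀ h₂
  have hq1 := sideQ_pos h₀ h₁
  have hq2 := sideQ_pos h₀ h₂
  set q₁ := sideQ x₀ x₁
  set q₂ := sideQ x₀ x₂
  set H₁ := sideH x₀ x₁
  set H₂ := sideH x₀ x₂
  have hsA : 0 < Real.sin A := Real.sin_pos_of_pos_of_lt_pi (by linarith) (by linarith)
  have hsB : 0 < Real.sin B := Real.sin_pos_of_pos_of_lt_pi (by linarith) (by linarith)
  have hcA : 0 < Real.cos A := Real.cos_pos_of_mem_Ioo ⟨by linarith, by linarith⟩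
  have hcB : 0 < Real.cos B := Real.cos_pos_of_mem_Ioo ⟨by linarith, by linarith⟩
  have hcA1 := Real.cos_le_one A
  have hcB1 := Real.cos_le_one B
  have hs1 : Real.sin (2 * A) = 2 * Real.sin A * Real.cos A := Real.sin_two_mul A
  have hs2 : Real.sin (2 * B) = 2 * Real.sin B * Real.cos B := Real.sin_two_mul B
  have hc1 : 0 < Real.cos (2 * A) := Real.cos_pos_of_mem_Ioo ⟨by linarith, by linarith⟩
  have hc2 : 0 < Real.cos (2 * B) := Real.cos_pos_of_mem_Ioo ⟨by linarith, by linarith⟩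
  have hc12 : Real.cos (2 * A) ≤ Real.cos (2 * B) :=
    Real.cos_le_cos_of_nonneg_of_le_pi (by linarith) (by linarith) (by linarith)
  have hcs : (0.7 : ℝ) ≤ Real.cos (A + B) := by
    have h1 : Real.cos (Real.pi / 4) ≤ Real.cos (A + B) :=
      Real.cos_le_cos_of_nonneg_of_le_pi (by linarith) (by linarith) hAB
    rw [Real.cos_pi_div_four] at h1
    have : (1.4 : ℝ) ≤ √2 := Real.le_sqrt_of_sq_le (by norm_num)
    linarith
  have hP := two_mul_mul_le_of_add hu0 hw0 huw
  -- If cos 2A ≥ 1/2, both weights can be raised to cos 2B and the joint bound `key` suffices, as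
  -- 2uw ≤ 0.35 = 0.7 · 1/2. Otherwise sin A ≥ 1/2 and B is small, and the two terms are bounded
  -- separately by 2q₁q₂ and q₂².
  rcases le_total (1 / 2) (Real.cos (2 * A)) with hc | hc
  · have e1 : q₁ * q₂ * Real.cos (2 * A) * Real.cos (2 * B) =
        u * w * (4 * (Real.sin A * Real.cos A * Real.sin B * Real.cos B)) := by
      calc _ = (q₁ * Real.cos (2 * A)) * (q₂ * Real.cos (2 * B)) := by ring
        _ = _ := by rw [← hu, ← hw, hs1, hs2]; ring
    have h3 : Real.cos (2 * A) * (1 - H₁) + Real.cos (2 * B) * (1 - H₂) ≤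
        2 * (q₁ * q₂ * Real.cos (2 * B)) := by
      linarith [mul_nonneg (sub_nonneg.2 hc12) (sub_pos.2 hH1).le,
        mul_le_mul_of_nonneg_left key hc2.le]
    refine h3.trans (le_of_mul_le_mul_right ?_ hc1)
    have h4 : 0.35 * (Real.cos A * Real.cos B) ≤ Real.cos (A + B) * Real.cos (2 * A) := by
      have := mul_le_mul hcA1 hcB1 hcB.le zero_le_one
      have := mul_le_mul hcs hc (by norm_num) (by linarith)
      linarith
    have hss := mul_pos hsA hsB
    calc 2 * (q₁ * q₂ * Real.cos (2 * B)) * Real.cos (2 * A)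
        = 2 * (u * w) * (4 * (Real.sin A * Real.cos A * Real.sin B * Real.cos B)) := by
          linear_combination 2 * e1
      _ ≤ 0.35 * (4 * (Real.sin A * Real.cos A * Real.sin B * Real.cos B)) := by gcongr
      _ = (0.35 * (Real.cos A * Real.cos B)) * (4 * (Real.sin A * Real.sin B)) := by ring
      _ ≤ (Real.cos (A + B) * Real.cos (2 * A)) * (4 * (Real.sin A * Real.sin B)) := by gcongr
      _ = _ := by ring
  · have hsA2 : 1 / 2 ≤ Real.sin A := by
      rw [Real.cos_two_mul, Real.cos_sq'] at hc
      by_contra! hcon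
      have := mul_self_lt_mul_self hsA.le hcon
      linarith
    have hsin2 : Real.sin (2 * B) ≤ 1 / 2 := by
      have : Real.sin (2 * B) ≤ Real.sin (Real.pi / 2 - 2 * A) :=
        Real.sin_le_sin_of_le_of_le_pi_div_two (by linarith) (by linarith) (by linarith)
      rw [Real.sin_pi_div_two_sub] at this
      linarith
    have hsin2p : 0 < Real.sin (2 * B) := by rw [hs2]; positivity
    have hsin1 := Real.sin_le_one (2 * A)
    -- sin 2B ≤ 1/2 gives cos 2B ≥ √3/2 > 0.86; at the end 4 · 0.7 · (1/2) · 0.86 = 1.204 exceeds 1.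
    have hc2' : 0.86 ≤ Real.cos (2 * B) := by
      by_contra! hcon
      have h3 := mul_self_lt_mul_self hc2.le hcon
      have h4 := mul_self_le_mul_self hsin2p.le hsin2
      linarith [Real.sin_sq_add_cos_sq (2 * B)]
    have h1 : 1 - H₁ ≤ 2 * (q₁ * q₂) := by linarith
    have hww := sq_div_two_add_le hu0 hw0 huw
    refine le_of_mul_le_mul_right ?_ hc2
    have h2 : Real.cos (2 * A) * (1 - H₁) * Real.cos (2 * B) ≤ 2 * (u * w) * Real.sin (2 * B) := by
      calc Real.cos (2 * A) * (1 - H₁) * Real.cos (2 * B)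
          ≤ Real.cos (2 * A) * (2 * (q₁ * q₂)) * Real.cos (2 * B) := by gcongr
        _ = 2 * ((q₁ * Real.cos (2 * A)) * (q₂ * Real.cos (2 * B))) := by ring
        _ = 2 * (u * w) * Real.sin (2 * B) * Real.sin (2 * A) := by rw [← hu, ← hw]; ring
        _ ≤ 2 * (u * w) * Real.sin (2 * B) * 1 := by gcongr
        _ = _ := by ring
    have h3 : Real.cos (2 * B) * (1 - H₂) * Real.cos (2 * B) ≤ w ^ 2 / 2 * Real.sin (2 * B) := by
      calc Real.cos (2 * B) * (1 - H₂) * Real.cos (2 * B)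
          ≤ Real.cos (2 * B) * q₂ ^ 2 * Real.cos (2 * B) := by gcongr
        _ = (q₂ * Real.cos (2 * B)) ^ 2 := by ring
        _ = w ^ 2 * Real.sin (2 * B) * Real.sin (2 * B) := by rw [← hw]; ring
        _ ≤ w ^ 2 * Real.sin (2 * B) * (1 / 2) := by gcongr
        _ = _ := by ring
    calc (Real.cos (2 * A) * (1 - H₁) + Real.cos (2 * B) * (1 - H₂)) * Real.cos (2 * B)
        ≤ (w ^ 2 / 2 + 2 * (u * w)) * Real.sin (2 * B) := by linarith
      _ ≤ 1 / 2 * Real.sin (2 * B) := by gcongr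
      _ = Real.sin B * Real.cos B := by rw [hs2]; ring
      _ ≤ Real.sin B * 1 := by gcongr
      _ ≤ Real.sin B * (4 * 0.7 * (1 / 2) * 0.86) := by gcongr; norm_num
      _ ≤ Real.sin B * (4 * Real.cos (A + B) * Real.sin A * Real.cos (2 * B)) := by gcongr
      _ = _ := by ring

lemma sideBeta_pos {x y τ : ℝ} (hx : 0 < x) (hy : 0 < y) (h : 0 < τ) (h' : τ < Real.pi / 2) :
    0 < sideBeta x y τ := by
  have hpi := Real.pi_pos
  have := sideQ_pos hx hy
  have h1 : 0 < Real.sin τ := Real.sin_pos_of_pos_of_lt_pi h (by linarith)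
  have h2 : 0 < Real.cos τ := Real.cos_pos_of_mem_Ioo ⟨by linarith, h'⟩
  exact Real.arctan_pos.2 (by positivity)

lemma add_add_mul_le_of_arctan {u w : ℝ} (hu : 0 < u) (hw : 0 < w)
    (h : Real.arctan u + Real.arctan w ≤ Real.pi / 4) : u + w + u * w ≤ 1 := by
  have h0 := Real.arctan_pos.2 hu
  have h1 := Real.arctan_pos.2 hw
  have hw1 : w < 1 := by
    rw [← Real.arctan_one] at h
    exact Real.arctan_lt_arctan_iff.1 (by linarith)
  have huw : u < 1 := by
    rw [← Real.arctan_one] at h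
    exact Real.arctan_lt_arctan_iff.1 (by linarith)
  have hlt : u * w < 1 := by nlinarith
  rw [Real.arctan_add hlt, ← Real.arctan_one, Real.arctan_le_arctan_iff,
    div_le_one (by linarith)] at h
  linarith

/-- Since H(x₁, x₂) < 1, it is enough to compare with 1 - cos(τ₁ + τ₂), and a product formula for
cos τ₁ + cos τ₂ - 1 - cos(τ₁ + τ₂) turns this into `merge_core` at the half angles. -/
lemma merge_aux {τ₁ τ₂ x₀ x₁ x₂ : ℝ} (h21 : τ₂ ≤ τ₁) (ht2 : 0 < τ₂)
    (hσ : τ₁ + τ₂ < Real.pi / 2)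
    (h₀ : 0 < x₀) (h₁ : 0 < x₁) (h₂ : 0 < x₂) (h₀' : x₀ < 1) (h₁' : x₁ < 1) (h₂' : x₂ < 1)
    (hβ : sideBeta x₀ x₁ τ₁ + sideBeta x₀ x₂ τ₂ ≤ Real.pi / 4) :
    sideDefect x₀ x₁ τ₁ + sideDefect x₀ x₂ τ₂ ≤ sideDefect x₁ x₂ (τ₁ + τ₂) := by
  have hpi := Real.pi_pos
  have hs1 : 0 < Real.sin τ₁ := Real.sin_pos_of_pos_of_lt_pi (by linarith) (by linarith)
  have hs2 : 0 < Real.sin τ₂ := Real.sin_pos_of_pos_of_lt_pi (by linarith) (by linarith)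
  have hc1 : 0 < Real.cos τ₁ := Real.cos_pos_of_mem_Ioo ⟨by linarith, by linarith⟩
  have hc2 : 0 < Real.cos τ₂ := Real.cos_pos_of_mem_Ioo ⟨by linarith, by linarith⟩
  have hq1 := sideQ_pos h₀ h₁
  have hq2 := sideQ_pos h₀ h₂
  have hu : 0 < sideQ x₀ x₁ * (Real.cos τ₁ / Real.sin τ₁) := by positivity
  have hw : 0 < sideQ x₀ x₂ * (Real.cos τ₂ / Real.sin τ₂) := by positivity
  have h := merge_core (A := τ₁ / 2) (B := τ₂ / 2) (x₀ := x₀) (x₁ := x₁) (x₂ := x₂)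
    (by linarith) (by linarith) (by linarith) h₀ h₁ h₂ h₀' h₁' h₂'
    (u := sideQ x₀ x₁ * (Real.cos τ₁ / Real.sin τ₁))
    (w := sideQ x₀ x₂ * (Real.cos τ₂ / Real.sin τ₂))
    (by rw [mul_div_cancel₀ _ two_ne_zero]; field_simp)
    (by rw [mul_div_cancel₀ _ two_ne_zero]; field_simp) hu hw
    (add_add_mul_le_of_arctan hu hw hβ)
  rw [mul_div_cancel₀ _ two_ne_zero, mul_div_cancel₀ _ two_ne_zero] at h
  have e : 4 * Real.cos (τ₁ / 2 + τ₂ / 2) * Real.sin (τ₁ / 2) * Real.sin (τ₂ / 2) =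
      Real.cos τ₁ + Real.cos τ₂ - 1 - Real.cos (τ₁ + τ₂) := by
    have e1 : Real.cos (τ₁ + τ₂) = 2 * Real.cos (τ₁ / 2 + τ₂ / 2) ^ 2 - 1 := by
      rw [← Real.cos_two_mul]; ring_nf
    have e2 : Real.cos τ₁ = 1 - 2 * Real.sin (τ₁ / 2) ^ 2 := by
      have := Real.cos_two_mul (τ₁ / 2)
      rw [mul_div_cancel₀ _ two_ne_zero] at this
      rw [this, Real.cos_sq']; ring
    have e3 : Real.cos τ₂ = 1 - 2 * Real.sin (τ₂ / 2) ^ 2 := by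
      have := Real.cos_two_mul (τ₂ / 2)
      rw [mul_div_cancel₀ _ two_ne_zero] at this
      rw [this, Real.cos_sq']; ring
    rw [e1, e2, e3, Real.cos_add]
    have i1 := Real.sin_sq_add_cos_sq (τ₁ / 2)
    have i2 := Real.sin_sq_add_cos_sq (τ₂ / 2)
    set s := Real.sin (τ₁ / 2)
    set c := Real.cos (τ₁ / 2)
    set s' := Real.sin (τ₂ / 2)
    set c' := Real.cos (τ₂ / 2)
    have j1 : c ^ 2 = 1 - s ^ 2 := by linarith
    have j2 : c' ^ 2 = 1 - s' ^ 2 := by linarith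
    have : c ^ 2 * c' ^ 2 = (1 - s ^ 2) * (1 - s' ^ 2) := by rw [j1, j2]
    linear_combination (2 : ℝ) * this
  rw [e] at h
  have hσc : 0 < Real.cos (τ₁ + τ₂) := Real.cos_pos_of_mem_Ioo ⟨by linarith, by linarith⟩
  unfold sideDefect
  nlinarith [mul_pos hσc (sub_pos.2 (sideH_lt_one h₁ h₂))]

lemma sideDefect_merge {τ₁ τ₂ x₀ x₁ x₂ : ℝ} (ht1 : 0 < τ₁) (ht2 : 0 < τ₂)
    (hσ : τ₁ + τ₂ < Real.pi / 2)
    (h₀ : 0 < x₀) (h₁ : 0 < x₁) (h₂ : 0 < x₂) (h₀' : x₀ < 1) (h₁' : x₁ < 1) (h₂' : x₂ < 1)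
    (hβ : sideBeta x₁ x₀ τ₁ + sideBeta x₀ x₂ τ₂ ≤ Real.pi / 4) :
    sideDefect x₁ x₀ τ₁ + sideDefect x₀ x₂ τ₂ ≤ sideDefect x₁ x₂ (τ₁ + τ₂) := by
  have eβ : sideBeta x₁ x₀ τ₁ = sideBeta x₀ x₁ τ₁ := by unfold sideBeta; rw [sideQ_comm]
  have ed : sideDefect x₁ x₀ τ₁ = sideDefect x₀ x₁ τ₁ := by unfold sideDefect; rw [sideH_comm]
  rw [eβ] at hβ
  rw [ed]
  rcases le_total τ₂ τ₁ with h | h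
  · exact merge_aux h ht2 hσ h₀ h₁ h₂ h₀' h₁' h₂' hβ
  · have := merge_aux h ht1 (by linarith) h₀ h₂ h₁ h₀' h₂' h₁' (by linarith)
    have e2 : sideDefect x₂ x₁ (τ₂ + τ₁) = sideDefect x₁ x₂ (τ₁ + τ₂) := by
      unfold sideDefect; rw [sideH_comm, add_comm]
    linarith

/-- By the addition formula for arctan, Q(x₁, x₂) cot(τ₁ + τ₂) is to be compared with (u + w)/(1 -
uw). This follows from Q(x₁, x₂) ≤ x₁ + x₂ ≤ Q(x₁, x₀) + Q(x₀, x₂) and cos(τ₁ + τ₂)(1 - uw) ≤ cos τ₁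
cos τ₂. -/
lemma sideBeta_merge {τ₁ τ₂ x₀ x₁ x₂ : ℝ} (ht1 : 0 < τ₁) (ht2 : 0 < τ₂)
    (hσ : τ₁ + τ₂ < Real.pi / 2)
    (h₀ : 0 < x₀) (h₁ : 0 < x₁) (h₂ : 0 < x₂) (h₀' : x₀ < 1) (h₁' : x₁ < 1) (h₂' : x₂ < 1)
    (hβ : sideBeta x₁ x₀ τ₁ + sideBeta x₀ x₂ τ₂ ≤ Real.pi / 4) :
    sideBeta x₁ x₂ (τ₁ + τ₂) ≤ sideBeta x₁ x₀ τ₁ + sideBeta x₀ x₂ τ₂ := by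
  have hpi := Real.pi_pos
  have hs1 : 0 < Real.sin τ₁ := Real.sin_pos_of_pos_of_lt_pi (by linarith) (by linarith)
  have hs2 : 0 < Real.sin τ₂ := Real.sin_pos_of_pos_of_lt_pi (by linarith) (by linarith)
  have hc1 : 0 < Real.cos τ₁ := Real.cos_pos_of_mem_Ioo ⟨by linarith, by linarith⟩
  have hc2 : 0 < Real.cos τ₂ := Real.cos_pos_of_mem_Ioo ⟨by linarith, by linarith⟩
  have hsσ : 0 < Real.sin (τ₁ + τ₂) := Real.sin_pos_of_pos_of_lt_pi (by linarith) (by linarith)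
  have hcσ : 0 < Real.cos (τ₁ + τ₂) := Real.cos_pos_of_mem_Ioo ⟨by linarith, by linarith⟩
  have hq1 := sideQ_pos h₁ h₀
  have hq2 := sideQ_pos h₀ h₂
  have hq := sideQ_pos h₁ h₂
  have hqle := sideQ_le_add h₁ h₂
  have hu : 0 < sideQ x₁ x₀ * (Real.cos τ₁ / Real.sin τ₁) := by positivity
  have hw : 0 < sideQ x₀ x₂ * (Real.cos τ₂ / Real.sin τ₂) := by positivity
  have huw := add_add_mul_le_of_arctan hu hw hβ
  have hx1q : x₁ ≤ sideQ x₁ x₀ := by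
    unfold sideQ
    rw [le_div_iff₀ (by positivity)]
    nlinarith [mul_pos h₁ h₀, mul_pos h₀ (mul_pos h₁ h₁)]
  have hx2q : x₂ ≤ sideQ x₀ x₂ := by
    unfold sideQ
    rw [le_div_iff₀ (by positivity)]
    nlinarith [mul_pos h₂ h₀, mul_pos h₀ (mul_pos h₂ h₂)]
  unfold sideBeta
  have huw1 : sideQ x₁ x₀ * (Real.cos τ₁ / Real.sin τ₁) *
    (sideQ x₀ x₂ * (Real.cos τ₂ / Real.sin τ₂)) < 1 := by linarith
  rw [Real.arctan_add huw1, Real.arctan_le_arctan_iff]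
  have e1 : sideQ x₁ x₀ * (Real.cos τ₁ / Real.sin τ₁) * Real.sin τ₁ = sideQ x₁ x₀ * Real.cos τ₁ := by
    field_simp
  have e2 : sideQ x₀ x₂ * (Real.cos τ₂ / Real.sin τ₂) * Real.sin τ₂ = sideQ x₀ x₂ * Real.cos τ₂ := by
    field_simp
  set u := sideQ x₁ x₀ * (Real.cos τ₁ / Real.sin τ₁)
  set w := sideQ x₀ x₂ * (Real.cos τ₂ / Real.sin τ₂)
  have hs : Real.sin (τ₁ + τ₂) = Real.sin τ₁ * Real.cos τ₂ + Real.cos τ₁ * Real.sin τ₂ :=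
    Real.sin_add _ _
  have hc : Real.cos (τ₁ + τ₂) = Real.cos τ₁ * Real.cos τ₂ - Real.sin τ₁ * Real.sin τ₂ :=
    Real.cos_add _ _
  rw [mul_div_assoc', div_le_div_iff₀ hsσ (by linarith)]
  have f1 : sideQ x₁ x₂ * Real.cos (τ₁ + τ₂) * (1 - u * w) ≤
      (x₁ + x₂) * (Real.cos τ₁ * Real.cos τ₂) := by
    have : Real.cos (τ₁ + τ₂) * (1 - u * w) ≤ Real.cos τ₁ * Real.cos τ₂ := by
      nlinarith [mul_pos hs1 hs2, mul_pos hcσ (mul_pos hu hw)]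
    calc sideQ x₁ x₂ * Real.cos (τ₁ + τ₂) * (1 - u * w)
        = sideQ x₁ x₂ * (Real.cos (τ₁ + τ₂) * (1 - u * w)) := by ring
      _ ≤ sideQ x₁ x₂ * (Real.cos τ₁ * Real.cos τ₂) := by gcongr
      _ ≤ _ := by gcongr
  refine f1.trans ?_
  have f2 : (u + w) * Real.sin (τ₁ + τ₂) = (sideQ x₁ x₀ + sideQ x₀ x₂) * (Real.cos τ₁ * Real.cos τ₂)
      + (u * Real.cos τ₁ * Real.sin τ₂ + w * Real.sin τ₁ * Real.cos τ₂) := by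
    rw [hs]; linear_combination Real.cos τ₂ * e1 + Real.cos τ₁ * e2
  rw [f2]
  have : 0 < u * Real.cos τ₁ * Real.sin τ₂ + w * Real.sin τ₁ * Real.cos τ₂ := by positivity
  nlinarith [mul_pos hc1 hc2, mul_le_mul_of_nonneg_right (add_le_add hx1q hx2q)
    (mul_pos hc1 hc2).le]

end HyperbolicPlane

/-! ### The three-sided case and the induction on the number of sides -/

namespace HyperbolicPlane

/-- Let rᵢ² = lᵢ(2 - lᵢ). Then g ≤ r₁r₂ ≤ 1/4, a range on which g(1 - 2g) increases, so the negated
claim yields (r₁ - r₂)² + 4(r₁r₂)² ≤ (2l₁ + l₂)². This is impossible because lᵢ < (4/7)rᵢ². -/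
lemma small_defects_aux {l₁ l₂ g : ℝ} (h1 : 0 < l₁) (h12 : l₁ ≤ l₂) (hd : l₁ + l₂ < 1 / 4)
    (hgg : g ^ 2 ≤ l₁ * (2 - l₁) * (l₂ * (2 - l₂))) :
    2 * (g * (1 - 2 * g)) < l₁ * (2 - l₁) + l₂ * (2 - l₂) - (2 * l₁ + l₂) ^ 2 := by
  obtain ⟨S₁, hS1⟩ : ∃ S, S = l₁ * (2 - l₁) := ⟨_, rfl⟩
  obtain ⟨S₂, hS2⟩ : ∃ S, S = l₂ * (2 - l₂) := ⟨_, rfl⟩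
  have hS1p : 7 / 4 * l₁ < S₁ := by nlinarith
  have hS2p : 7 / 4 * l₂ < S₂ := by nlinarith
  have hS12 : S₁ ≤ S₂ := by nlinarith
  have hS2half : S₂ ≤ 1 / 2 := by nlinarith
  have hSS : S₁ * S₂ ≤ (2 * l₁) * (2 * l₂) := by
    apply mul_le_mul <;> nlinarith
  rw [← hS1, ← hS2] at hgg ⊢
  clear hS1 hS2
  obtain ⟨r₁, hr1p, hr1⟩ : ∃ r, 0 < r ∧ r ^ 2 = S₁ :=
    ⟨√S₁, Real.sqrt_pos.2 (by linarith), Real.sq_sqrt (by linarith)⟩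
  obtain ⟨r₂, hr2p, hr2⟩ : ∃ r, 0 < r ∧ r ^ 2 = S₂ :=
    ⟨√S₂, Real.sqrt_pos.2 (by linarith), Real.sq_sqrt (by linarith)⟩
  have hr12 : r₁ ≤ r₂ := le_of_sq_le_sq (by rw [hr1, hr2]; exact hS12) hr2p.le
  have hrr : 0 < r₁ * r₂ := mul_pos hr1p hr2p
  have hgr : g ≤ r₁ * r₂ := by
    apply le_of_sq_le_sq _ hrr.le
    rw [mul_pow r₁, hr1, hr2]; exact hgg
  have hrq : r₁ * r₂ ≤ 1 / 4 := by
    apply le_of_sq_le_sq _ (by norm_num)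
    rw [mul_pow, hr1, hr2]
    have : (l₁ + l₂) ^ 2 ≤ (1 / 4) ^ 2 := pow_le_pow_left₀ (by linarith) hd.le 2
    linarith [sq_nonneg (l₁ - l₂)]
  by_contra! hcon
  have hfin : (r₁ - r₂) ^ 2 + 4 * (r₁ * r₂) ^ 2 ≤ (2 * l₁ + l₂) ^ 2 := by
    linarith [mul_nonneg (sub_nonneg.2 hgr) (by linarith : 0 ≤ 1 - 2 * g - 2 * (r₁ * r₂))]
  have hL : (2 * l₁ + l₂) ^ 2 < (4 / 7 * (2 * r₁ ^ 2 + r₂ ^ 2)) ^ 2 := by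
    apply pow_lt_pow_left₀ _ (by linarith) two_ne_zero
    rw [hr1, hr2]; linarith
  have hL' := hfin.trans_lt hL
  have hr2h : r₂ ^ 2 ≤ 1 / 2 := hr2 ▸ hS2half
  clear hfin hL hcon hgg hS1p hS2p hS12 hSS hd h12 h1 hgr hS2half hr1 hr2
  -- For r₁ ≥ (2/5)r₂ the term 4(r₁r₂)² alone is too large; otherwise (r₂ - r₁)² ≥ (9/25)r₂² is. The
  -- constant is 1.32 = 1 + 2(2/5)².
  rcases le_total (2 / 5 * r₂) r₁ with he | he
  · have e1 : 4 / 7 * (2 * r₁ ^ 2 + r₂ ^ 2) ≤ 2 * (r₁ * r₂) := by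
      nlinarith [mul_nonneg (sub_nonneg.2 he) (sub_nonneg.2 hr12)]
    have e2 := pow_le_pow_left₀ (by positivity) e1 2
    linarith [sq_nonneg (r₁ - r₂)]
  · have e0 : r₁ ^ 2 ≤ (2 / 5 * r₂) ^ 2 := pow_le_pow_left₀ hr1p.le he 2
    have e1 : 4 / 7 * (2 * r₁ ^ 2 + r₂ ^ 2) ≤ 4 / 7 * (1.32 * r₂ ^ 2) := by linarith
    have e2 := pow_le_pow_left₀ (by positivity) e1 2
    have e3 : (3 / 5 * r₂) ^ 2 ≤ (r₂ - r₁) ^ 2 := by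
      apply pow_le_pow_left₀ <;> linarith
    have e4 : r₂ ^ 2 * r₂ ^ 2 ≤ 1 / 2 * r₂ ^ 2 := by gcongr
    have e5 : 0 ≤ (r₁ * r₂) ^ 2 := by positivity
    have e6 : 0 < r₂ ^ 2 := by positivity
    linarith

/-- The sorted form of the three-side estimate, in terms of the defects `lᵢ`. -/
lemma three_defects_core {l₁ l₂ l₃ s₁ s₂ s₃ μ : ℝ} (h1 : 0 < l₁) (h12 : l₁ ≤ l₂) (h23 : l₂ ≤ l₃)
    (h3 : l₃ < 1) (hs1 : 0 < s₁) (hs2 : 0 < s₂) (b1 : s₁ ^ 2 ≤ l₁ * (2 - l₁))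
    (b2 : s₂ ^ 2 ≤ l₂ * (2 - l₂)) (hs : s₃ ≤ 1 - 2 * (s₁ * s₂))
    (hS : l₁ * (2 - l₁) + l₂ * (2 - l₂) + l₃ * (2 - l₃) ≤ 1 + 2 * (s₁ * s₂ * s₃)) (hμ : μ ≤ l₁) :
    l₁ + l₂ + l₃ + μ < 1 := by
  by_contra! hcon
  have hg : 0 < s₁ * s₂ := mul_pos hs1 hs2
  have hg2 : s₁ * s₂ * s₃ ≤ s₁ * s₂ * (1 - 2 * (s₁ * s₂)) := mul_le_mul_of_nonneg_left hs hg.le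
  have hgg : (s₁ * s₂) ^ 2 ≤ l₁ * (2 - l₁) * (l₂ * (2 - l₂)) := by
    rw [mul_pow]
    exact mul_le_mul b1 b2 (by positivity) (by nlinarith)
  set g := s₁ * s₂
  -- The maximum of g(1 - 2g) is 1/8, at g = 1/4.
  have hquarter : 2 * (g * s₃) ≤ 1 / 4 := by nlinarith [sq_nonneg (g - 1 / 4)]
  -- For 2l₁ + 2l₂ ≥ 1 the ordering and the bound 1/4 suffice. Otherwise l₃ is eliminated by
  -- squaring 1 - l₃ ≤ 2l₁ + l₂; the bound 1/4 still works if l₁ + l₂ ≥ 1/4, and below that the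
  -- smallness of g is needed.
  rcases le_or_gt 1 (2 * l₁ + 2 * l₂) with hc | hc
  · nlinarith [mul_nonneg (sub_nonneg.2 h12) (sub_nonneg.2 h12), mul_nonneg (sub_nonneg.2 h23)
      (by linarith : 0 ≤ 2 - l₂ - l₃), mul_nonneg (by linarith : 0 ≤ 1 - l₁)
      (by linarith : 0 ≤ 2 * l₁ + 2 * l₂ - 1), mul_nonneg (by linarith : 0 ≤ 1 - l₂)
      (by linarith : 0 ≤ 2 * l₁ + 2 * l₂ - 1)]
  · have h3' : (1 - l₃) ^ 2 ≤ (2 * l₁ + l₂) ^ 2 := by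
      apply pow_le_pow_left₀ <;> linarith
    have hmain : l₁ * (2 - l₁) + l₂ * (2 - l₂) - (2 * l₁ + l₂) ^ 2 ≤ 2 * (g * s₃) := by
      linarith
    rcases le_or_gt (1 / 4) (l₁ + l₂) with hd | hd
    · nlinarith [mul_nonneg (sub_nonneg.2 h12) (sub_nonneg.2 h12),
        mul_nonneg (by linarith : 0 ≤ l₁ + l₂ - 1 / 4) (by linarith : 0 ≤ 1 - (2 * l₁ + 2 * l₂)),
        mul_nonneg (by linarith : 0 ≤ l₂ - l₁) (by linarith : 0 ≤ 1 - (2 * l₁ + 2 * l₂)),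
        mul_nonneg h1.le (sub_nonneg.2 h12)]
    · exact not_le_of_gt (small_defects_aux h1 h12 hd hgg) (by linarith)

/-- With lᵢ = 1 - aᵢ one has lᵢ(2 - lᵢ) = 1 - aᵢ², and sin τ₃ = cos(τ₁ + τ₂) = cos(τ₁ - τ₂) - 2 sin
τ₁ sin τ₂; what remains is to sort the defects. -/
lemma three_defects {a₁ a₂ a₃ τ₁ τ₂ τ₃ μ : ℝ} (t1 : 0 < τ₁) (t2 : 0 < τ₂) (t3 : 0 < τ₃)
    (ht : τ₁ + τ₂ + τ₃ = Real.pi / 2) (ha1 : 0 < a₁) (ha2 : 0 < a₂) (ha3 : 0 < a₃)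
    (ha1' : a₁ < Real.cos τ₁) (ha2' : a₂ < Real.cos τ₂) (ha3' : a₃ < Real.cos τ₃)
    (hsum : 2 - 2 * (Real.sin τ₁ * Real.sin τ₂ * Real.sin τ₃) ≤ a₁ ^ 2 + a₂ ^ 2 + a₃ ^ 2)
    (m1 : μ ≤ 1 - a₁) (m2 : μ ≤ 1 - a₂) (m3 : μ ≤ 1 - a₃) :
    (1 - a₁) + (1 - a₂) + (1 - a₃) + μ < 1 := by
  have hpi := Real.pi_pos
  have pos : ∀ τ, 0 < τ → τ < Real.pi / 2 → 0 < Real.sin τ := fun τ h h' =>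
    Real.sin_pos_of_pos_of_lt_pi h (by linarith)
  have s1 := pos τ₁ t1 (by linarith)
  have s2 := pos τ₂ t2 (by linarith)
  have s3 := pos τ₃ t3 (by linarith)
  have bound : ∀ a τ, 0 < a → a < Real.cos τ → Real.sin τ ^ 2 ≤ (1 - a) * (2 - (1 - a)) := by
    intro a τ h h'
    nlinarith [Real.sin_sq_add_cos_sq τ]
  have b1 := bound _ _ ha1 ha1'
  have b2 := bound _ _ ha2 ha2'
  have b3 := bound _ _ ha3 ha3'
  have third : ∀ τ τ' τ'', τ + τ' + τ'' = Real.pi / 2 →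
      Real.sin τ'' ≤ 1 - 2 * (Real.sin τ * Real.sin τ') := by
    intro τ τ' τ'' h
    rw [show τ'' = Real.pi / 2 - (τ + τ') by linarith, Real.sin_pi_div_two_sub, Real.cos_add]
    have := Real.cos_le_one (τ - τ')
    rw [Real.cos_sub] at this
    linarith
  have c1 := Real.cos_le_one τ₁
  have c2 := Real.cos_le_one τ₂
  have c3 := Real.cos_le_one τ₃
  rcases le_total a₁ a₂ with h12 | h12 <;> rcases le_total a₂ a₃ with h23 | h23 <;>
    rcases le_total a₁ a₃ with h13 | h13
  · linarith [three_defects_core (μ := μ) (by linarith) (by linarith : 1 - a₃ ≤ 1 - a₂)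
      (by linarith : 1 - a₂ ≤ 1 - a₁) (by linarith) s3 s2 b3 b2 (third τ₃ τ₂ τ₁ (by linarith))
      (by linarith) (by linarith)]
  · linarith [three_defects_core (μ := μ) (by linarith) (by linarith : 1 - a₃ ≤ 1 - a₂)
      (by linarith : 1 - a₂ ≤ 1 - a₁) (by linarith) s3 s2 b3 b2 (third τ₃ τ₂ τ₁ (by linarith))
      (by linarith) (by linarith)]
  · linarith [three_defects_core (μ := μ) (by linarith) (by linarith : 1 - a₂ ≤ 1 - a₃)
      (by linarith : 1 - a₃ ≤ 1 - a₁) (by linarith) s2 s3 b2 b3 (third τ₂ τ₃ τ₁ (by linarith))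
      (by linarith) (by linarith)]
  · linarith [three_defects_core (μ := μ) (by linarith) (by linarith : 1 - a₂ ≤ 1 - a₁)
      (by linarith : 1 - a₁ ≤ 1 - a₃) (by linarith) s2 s1 b2 b1 (third τ₂ τ₁ τ₃ (by linarith))
      (by linarith) (by linarith)]
  · linarith [three_defects_core (μ := μ) (by linarith) (by linarith : 1 - a₃ ≤ 1 - a₁)
      (by linarith : 1 - a₁ ≤ 1 - a₂) (by linarith) s3 s1 b3 b1 (third τ₃ τ₁ τ₂ (by linarith))
      (by linarith) (by linarith)]
  · linarith [three_defects_core (μ := μ) (by linarith) (by linarith : 1 - a₁ ≤ 1 - a₃)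
      (by linarith : 1 - a₃ ≤ 1 - a₂) (by linarith) s1 s3 b1 b3 (third τ₁ τ₃ τ₂ (by linarith))
      (by linarith) (by linarith)]
  · linarith [three_defects_core (μ := μ) (by linarith) (by linarith : 1 - a₁ ≤ 1 - a₂)
      (by linarith : 1 - a₂ ≤ 1 - a₃) (by linarith) s1 s2 b1 b2 (third τ₁ τ₂ τ₃ (by linarith))
      (by linarith) (by linarith)]
  · linarith [three_defects_core (μ := μ) (by linarith) (by linarith : 1 - a₁ ≤ 1 - a₂)
      (by linarith : 1 - a₂ ≤ 1 - a₃) (by linarith) s1 s2 b1 b2 (third τ₁ τ₂ τ₃ (by linarith))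
      (by linarith) (by linarith)]

/-- Over the common denominator the left numerator is 2(ax + xb), a part of 2(a + x)(x + b). -/
lemma one_sub_sideH_mul_le {x a b : ℝ} (hx : 0 < x) (ha : 0 < a) (hb : 0 < b) :
    1 - sideH a x * sideH x b ≤ 2 * (sideQ a x * sideQ x b) := by
  unfold sideH sideQ
  rw [div_mul_div_comm, div_mul_div_comm, one_sub_div (by positivity), ← mul_div_assoc]
  gcongr
  nlinarith [mul_pos hx ha, mul_pos hx hb, mul_pos ha hb]

lemma mul_add_mul_add_mul_le_of_arctan {u v w : ℝ} (hu : 0 < u) (hv : 0 < v) (hw : 0 < w)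
    (h : Real.arctan u + Real.arctan v + Real.arctan w ≤ Real.pi / 2) :
    u * v + v * w + u * w ≤ 1 := by
  have h1 := Real.arctan_pos.2 hu
  have h2 := Real.arctan_pos.2 hv
  have h3 := Real.arctan_pos.2 hw
  have h4 : Real.arctan u + Real.arctan v ≤ Real.arctan w⁻¹ := by
    rw [Real.arctan_inv_of_pos hw]; linarith
  have huv : u * v < 1 := by
    by_contra! hc
    have : Real.arctan u⁻¹ ≤ Real.arctan v := by
      rw [Real.arctan_le_arctan_iff, inv_le_iff_one_le_mul₀ hu]; linarith
    rw [Real.arctan_inv_of_pos hu] at this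
    linarith
  rw [Real.arctan_add huv, Real.arctan_le_arctan_iff, ← one_div,
    div_le_div_iff₀ (by linarith) hw] at h4
  linarith

/-- Multiplied by s₁s₂s₃, the angle condition reads ∑ QᵢQⱼ cᵢcⱼsₖ ≤ s₁s₂s₃. With 1 - HᵢHⱼ ≤ 2QᵢQⱼ
and ∑ cᵢcⱼsₖ = 1 + s₁s₂s₃ this gives ∑ HᵢHⱼ cᵢcⱼsₖ ≥ 1 - s₁s₂s₃. The numbers aᵢ = cᵢHᵢ satisfy ∑ aᵢ²
≥ 2 ∑ aᵢaⱼsₖ, the classical inequality for a Euclidean triangle with angles π/2 - τᵢ, proved here as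
a sum of two squares. -/
lemma three_sides {x₁ x₂ x₃ τ₁ τ₂ τ₃ μ : ℝ} (t1 : 0 < τ₁) (t2 : 0 < τ₂) (t3 : 0 < τ₃)
    (ht : τ₁ + τ₂ + τ₃ = Real.pi / 2) (h1 : 0 < x₁) (h2 : 0 < x₂) (h3 : 0 < x₃)
    (h1' : x₁ < 1) (h2' : x₂ < 1) (h3' : x₃ < 1)
    (hβ : sideBeta x₁ x₂ τ₁ + sideBeta x₂ x₃ τ₂ + sideBeta x₃ x₁ τ₃ ≤ Real.pi / 2)
    (m1 : μ ≤ sideDefect x₁ x₂ τ₁) (m2 : μ ≤ sideDefect x₂ x₃ τ₂)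
    (m3 : μ ≤ sideDefect x₃ x₁ τ₃) :
    sideDefect x₁ x₂ τ₁ + sideDefect x₂ x₃ τ₂ + sideDefect x₃ x₁ τ₃ + μ < 1 := by
  have hpi := Real.pi_pos
  have s1 : 0 < Real.sin τ₁ := Real.sin_pos_of_pos_of_lt_pi t1 (by linarith)
  have s2 : 0 < Real.sin τ₂ := Real.sin_pos_of_pos_of_lt_pi t2 (by linarith)
  have s3 : 0 < Real.sin τ₃ := Real.sin_pos_of_pos_of_lt_pi t3 (by linarith)
  have c1 : 0 < Real.cos τ₁ := Real.cos_pos_of_mem_Ioo ⟨by linarith, by linarith⟩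
  have c2 : 0 < Real.cos τ₂ := Real.cos_pos_of_mem_Ioo ⟨by linarith, by linarith⟩
  have c3 : 0 < Real.cos τ₃ := Real.cos_pos_of_mem_Ioo ⟨by linarith, by linarith⟩
  have q1 := sideQ_pos h1 h2
  have q2 := sideQ_pos h2 h3
  have q3 := sideQ_pos h3 h1
  have hu := mul_add_mul_add_mul_le_of_arctan (mul_pos q1 (div_pos c1 s1))
    (mul_pos q2 (div_pos c2 s2)) (mul_pos q3 (div_pos c3 s3)) hβ
  have k12 := one_sub_sideH_mul_le h2 h1 h3
  have k23 := one_sub_sideH_mul_le h3 h2 h1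
  have k31 := one_sub_sideH_mul_le h1 h3 h2
  have H1 := sideH_pos h1 h2 h1' h2'
  have H2 := sideH_pos h2 h3 h2' h3'
  have H3 := sideH_pos h3 h1 h3' h1'
  have L1 := sideH_lt_one h1 h2
  have L2 := sideH_lt_one h2 h3
  have L3 := sideH_lt_one h3 h1
  have es1 : Real.sin τ₁ = Real.cos τ₂ * Real.cos τ₃ - Real.sin τ₂ * Real.sin τ₃ := by
    rw [← Real.cos_add, ← Real.sin_pi_div_two_sub]; congr 1; linarith
  have es3 : Real.sin τ₃ = Real.cos τ₁ * Real.cos τ₂ - Real.sin τ₁ * Real.sin τ₂ := by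
    rw [← Real.cos_add, ← Real.sin_pi_div_two_sub]; congr 1; linarith
  have ec3 : Real.cos τ₃ = Real.sin τ₁ * Real.cos τ₂ + Real.cos τ₁ * Real.sin τ₂ := by
    rw [← Real.sin_add, ← Real.cos_pi_div_two_sub]; congr 1; linarith
  unfold sideDefect at *
  set s₁ := Real.sin τ₁
  set s₂ := Real.sin τ₂
  set s₃ := Real.sin τ₃
  set c₁ := Real.cos τ₁
  set c₂ := Real.cos τ₂
  set c₃ := Real.cos τ₃
  set Q₁ := sideQ x₁ x₂
  set Q₂ := sideQ x₂ x₃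
  set Q₃ := sideQ x₃ x₁
  set H₁ := sideH x₁ x₂
  set H₂ := sideH x₂ x₃
  set H₃ := sideH x₃ x₁
  have i1 : s₁ ^ 2 + c₁ ^ 2 = 1 := Real.sin_sq_add_cos_sq τ₁
  have i2 : s₂ ^ 2 + c₂ ^ 2 = 1 := Real.sin_sq_add_cos_sq τ₂
  have i3 : s₃ ^ 2 + c₃ ^ 2 = 1 := Real.sin_sq_add_cos_sq τ₃
  have hu' : Q₁ * Q₂ * (c₁ * c₂ * s₃) + Q₂ * Q₃ * (c₂ * c₃ * s₁) + Q₃ * Q₁ * (c₃ * c₁ * s₂) ≤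
      s₁ * s₂ * s₃ := by
    have := mul_le_mul_of_nonneg_right hu (mul_pos (mul_pos s1 s2) s3).le
    field_simp at this
    linarith
  have htrig : c₁ * c₂ * s₃ + c₂ * c₃ * s₁ + c₃ * c₁ * s₂ = 1 + s₁ * s₂ * s₃ := by
    rw [ec3, es3]
    linear_combination (c₂ ^ 2 + s₂ ^ 2) * i1 + i2
  have hC : 1 - s₁ * s₂ * s₃ ≤ H₁ * H₂ * (c₁ * c₂ * s₃) + H₂ * H₃ * (c₂ * c₃ * s₁) +
      H₃ * H₁ * (c₃ * c₁ * s₂) := by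
    have p1 : 0 < c₁ * c₂ * s₃ := by positivity
    have p2 : 0 < c₂ * c₃ * s₁ := by positivity
    have p3 : 0 < c₃ * c₁ * s₂ := by positivity
    linarith [mul_le_mul_of_nonneg_right k12 p1.le, mul_le_mul_of_nonneg_right k23 p2.le,
      mul_le_mul_of_nonneg_right k31 p3.le]
  refine three_defects t1 t2 t3 ht (mul_pos c1 H1) (mul_pos c2 H2) (mul_pos c3 H3)
    (mul_lt_of_lt_one_right c1 L1) (mul_lt_of_lt_one_right c2 L2) (mul_lt_of_lt_one_right c3 L3)
    ?_ m1 m2 m3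
  have hsq : 0 ≤ (c₁ * H₁ - c₂ * H₂ * s₃ - c₃ * H₃ * s₂) ^ 2 +
      (c₂ * H₂ * c₃ - c₃ * H₃ * c₂) ^ 2 := by positivity
  have hid : (c₁ * H₁ - c₂ * H₂ * s₃ - c₃ * H₃ * s₂) ^ 2 + (c₂ * H₂ * c₃ - c₃ * H₃ * c₂) ^ 2 =
      (c₁ * H₁) ^ 2 + (c₂ * H₂) ^ 2 + (c₃ * H₃) ^ 2 - 2 * (H₁ * H₂ * (c₁ * c₂ * s₃) +
      H₂ * H₃ * (c₂ * c₃ * s₁) + H₃ * H₁ * (c₃ * c₁ * s₂)) := by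
    linear_combination (c₂ * H₂) ^ 2 * i3 + (c₃ * H₃) ^ 2 * i2 +
      2 * (c₂ * H₂) * (c₃ * H₃) * es1
  change 2 - 2 * (s₁ * s₂ * s₃) ≤ _
  linarith

lemma sum_range_merge (f : ℕ → ℝ) {j n : ℕ} (h : j < n) :
    ∑ i ∈ Finset.range n, (if i < j then f i else if i = j then f j + f (j + 1) else f (i + 1)) =
      ∑ i ∈ Finset.range (n + 1), f i := by
  induction n, h using Nat.le_induction with
  | base =>
    rw [Finset.sum_range_succ, Finset.sum_range_succ, Finset.sum_range_succ]
    have : ∑ i ∈ Finset.range j, (if i < j then f i else if i = j then f j + f (j + 1)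
        else f (i + 1)) = ∑ i ∈ Finset.range j, f i :=
      Finset.sum_congr rfl fun i hi => by rw [if_pos (Finset.mem_range.1 hi)]
    rw [this]; simp [add_assoc]
  | succ n hn ih =>
    rw [Finset.sum_range_succ, ih, Finset.sum_range_succ _ (n + 1)]
    rw [if_neg (by omega), if_neg (by omega)]

lemma sideDefect_pos {x y τ : ℝ} (hx : 0 < x) (hy : 0 < y) (hx1 : x < 1) (hy1 : y < 1) :
    0 < sideDefect x y τ := by
  unfold sideDefect
  nlinarith [Real.cos_le_one τ, sideH_lt_one hx hy, sideH_pos hx hy hx1 hy1]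

/-- The sum of the defects of a closed chain of sides. -/
theorem sum_sideDefect_add_lt_one {n : ℕ} (hn : 3 ≤ n) {x τ : ℕ → ℝ} {μ : ℝ}
    (hx : ∀ i, 0 < x i) (hx1 : ∀ i, x i < 1) (hxn : x n = x 0) (hτ : ∀ i, i < n → 0 < τ i)
    (hτs : ∑ i ∈ Finset.range n, τ i = Real.pi / 2)
    (hβ : ∑ i ∈ Finset.range n, sideBeta (x i) (x (i + 1)) (τ i) ≤ Real.pi / 2)
    (hμ : ∀ i, i < n → μ ≤ sideDefect (x i) (x (i + 1)) (τ i)) :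
    ∑ i ∈ Finset.range n, sideDefect (x i) (x (i + 1)) (τ i) + μ < 1 := by
  induction n, hn using Nat.le_induction generalizing x τ with
  | base =>
    simp only [Finset.sum_range_succ, Finset.sum_range_zero, zero_add] at *
    have h2 := hμ 2 (by norm_num)
    rw [show 2 + 1 = 3 from rfl, hxn] at hβ h2
    rw [show 2 + 1 = 3 from rfl, hxn]
    refine three_sides (hτ 0 (by norm_num)) (hτ 1 (by norm_num)) (hτ 2 (by norm_num)) hτs (hx _)
      (hx _) (hx _) (hx1 _) (hx1 _) (hx1 _) hβ (hμ 0 (by norm_num)) (hμ 1 (by norm_num)) h2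
  | succ n hn ih =>
    have hpi := Real.pi_pos
    -- There are at least four positive τ's of total π/2, so two of them never exhaust it.
    have hlt : ∀ i j, i ≠ j → i < n + 1 → j < n + 1 → τ i + τ j < Real.pi / 2 := by
      intro i j hij hi hj
      obtain ⟨k, hk, hki, hkj⟩ : ∃ k, k < n + 1 ∧ k ≠ i ∧ k ≠ j := by
        rcases eq_or_ne 0 i with rfl | h0
        · rcases eq_or_ne 1 j with rfl | h1
          · exact ⟨2, by omega, by omega, by omega⟩
          · exact ⟨1, by omega, by omega, by omega⟩
        · rcases eq_or_ne 0 j with rfl | h1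
          · rcases eq_or_ne 1 i with rfl | h2
            · exact ⟨2, by omega, by omega, by omega⟩
            · exact ⟨1, by omega, by omega, by omega⟩
          · exact ⟨0, by omega, by omega, by omega⟩
      have hsub : ({i, j, k} : Finset ℕ) ⊆ Finset.range (n + 1) := by
        intro t ht
        simp only [Finset.mem_insert, Finset.mem_singleton] at ht
        rw [Finset.mem_range]; omega
      have := Finset.sum_le_sum_of_subset_of_nonneg hsub
        (fun t ht _ => (hτ t (Finset.mem_range.1 ht)).le)
      rw [hτs, Finset.sum_insert (by simp [hij, hki.symm]), Finset.sum_insert (by simp [hkj.symm]),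
        Finset.sum_singleton] at this
      linarith [hτ k hk]
    -- The pairs of sides (0, 1) and (2, 3) are disjoint, so their β-sums cannot both exceed π/4.
    obtain ⟨j, hj, hjβ⟩ : ∃ j, j < n ∧ sideBeta (x j) (x (j + 1)) (τ j) +
        sideBeta (x (j + 1)) (x (j + 1 + 1)) (τ (j + 1)) ≤ Real.pi / 4 := by
      by_contra! hcon
      have h0 := hcon 0 (by omega)
      have h2 := hcon 2 (by omega)
      have hsub : Finset.range 4 ⊆ Finset.range (n + 1) := Finset.range_subset_range.2 (by omega)
      have := Finset.sum_le_sum_of_subset_of_nonneg hsub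
        (f := fun i => sideBeta (x i) (x (i + 1)) (τ i)) (fun t ht _ => by
          obtain ⟨k, hk, hkt⟩ : ∃ k, k < n + 1 ∧ t ≠ k := by
            rcases eq_or_ne t 0 with rfl | h
            · exact ⟨1, by omega, by omega⟩
            · exact ⟨0, by omega, h⟩
          have h1 := hlt t k hkt (Finset.mem_range.1 ht) hk
          exact (sideBeta_pos (hx _) (hx _) (hτ t (Finset.mem_range.1 ht))
            (by linarith [hτ k hk])).le)
      simp only [Finset.sum_range_succ _ 3, Finset.sum_range_succ _ 2, Finset.sum_range_succ _ 1,
        Finset.sum_range_succ _ 0, Finset.sum_range_zero] at this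
      linarith
    have hj1 := hτ j (by omega)
    have hj2 := hτ (j + 1) (by omega)
    have hj12 := hlt j (j + 1) (by omega) (by omega) (by omega)
    -- The shortened chain omits the vertex j + 1 and adds the two angles beside it.
    set x' : ℕ → ℝ := fun i => if i ≤ j then x i else x (i + 1) with hx'
    set τ' : ℕ → ℝ := fun i => if i < j then τ i else if i = j then τ j + τ (j + 1) else τ (i + 1)
      with hτ'
    have hmd := sideDefect_merge hj1 hj2 hj12 (hx (j + 1)) (hx j) (hx (j + 1 + 1)) (hx1 _) (hx1 _)
      (hx1 _) hjβ
    have hmb := sideBeta_merge hj1 hj2 hj12 (hx (j + 1)) (hx j) (hx (j + 1 + 1)) (hx1 _) (hx1 _)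
      (hx1 _) hjβ
    have hdd : ∀ i, i < n → (if i < j then sideDefect (x i) (x (i + 1)) (τ i) else if i = j then
        sideDefect (x j) (x (j + 1)) (τ j) + sideDefect (x (j + 1)) (x (j + 1 + 1)) (τ (j + 1)) else
        sideDefect (x (i + 1)) (x (i + 1 + 1)) (τ (i + 1))) ≤
        sideDefect (x' i) (x' (i + 1)) (τ' i) := by
      intro i _
      rcases lt_trichotomy i j with h | h | h
      · simp only [hx', hτ', if_pos h, if_pos h.le, if_pos (show i + 1 ≤ j from h)]; exact le_rfl
      · subst h
        simpa [hx', hτ'] using hmd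
      · simp only [hx', hτ', if_neg h.not_gt, if_neg h.ne', if_neg h.not_ge,
          if_neg (show ¬ i + 1 ≤ j by omega)]; exact le_rfl
    have hbb : ∀ i, i < n → sideBeta (x' i) (x' (i + 1)) (τ' i) ≤
        (if i < j then sideBeta (x i) (x (i + 1)) (τ i) else if i = j then
        sideBeta (x j) (x (j + 1)) (τ j) + sideBeta (x (j + 1)) (x (j + 1 + 1)) (τ (j + 1)) else
        sideBeta (x (i + 1)) (x (i + 1 + 1)) (τ (i + 1))) := by
      intro i _
      rcases lt_trichotomy i j with h | h | h
      · simp only [hx', hτ', if_pos h, if_pos h.le, if_pos (show i + 1 ≤ j from h)]; exact le_rfl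
      · subst h
        simpa [hx', hτ'] using hmb
      · simp only [hx', hτ', if_neg h.not_gt, if_neg h.ne', if_neg h.not_ge,
          if_neg (show ¬ i + 1 ≤ j by omega)]; exact le_rfl
    have key := ih (x := x') (τ := τ') (fun i => by simp only [hx']; split_ifs <;> apply hx)
      (fun i => by simp only [hx']; split_ifs <;> apply hx1)
      (by simp only [hx', if_neg hj.not_ge, if_pos (Nat.zero_le j), hxn])
      (fun i hi => by
        simp only [hτ']
        split_ifs with h1 h2
        · exact hτ i (by omega)
        · linarith
        · exact hτ (i + 1) (by omega))
      (by rw [← hτs]; exact sum_range_merge τ hj)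
      (by
        refine le_trans (Finset.sum_le_sum fun i hi => hbb i (Finset.mem_range.1 hi)) ?_
        rw [sum_range_merge (fun i => sideBeta (x i) (x (i + 1)) (τ i)) hj]
        exact hβ)
      (fun i hi => by
        refine le_trans ?_ (hdd i hi)
        split_ifs with h1 h2
        · exact hμ i (by omega)
        · have := hμ j (by omega)
          have := sideDefect_pos (τ := τ (j + 1)) (hx (j + 1)) (hx (j + 1 + 1)) (hx1 _) (hx1 _)
          linarith
        · exact hμ (i + 1) (by omega))
    have hfin := Finset.sum_le_sum fun i (hi : i ∈ Finset.range n) => hdd i (Finset.mem_range.1 hi)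
    rw [sum_range_merge (fun i => sideDefect (x i) (x (i + 1)) (τ i)) hj] at hfin
    linarith

end HyperbolicPlane

/-! ### Signed areas and midpoint data in the unit disc -/

namespace HyperbolicPlane

open ComplexConjugate

/-- The relation between the endpoints `p`, `q` of a side and its midpoint datum `K`: the disc
translation `z ↦ (K - z) / (1 - conj K * z)` exchanges `p` and `q`. -/
def SideRel (K p q : ℂ) : Prop := K + p * q * conj K = p + q

/-- The area-type angle of the pair `p`, `q` in the unit disc. -/
noncomputable def skew (p q : ℂ) : ℝ := -2 * (1 - conj p * q).arg

lemma norm_conj_mul_lt_one {p q : ℂ} (hp : ‖p‖ < 1) (hq : ‖q‖ < 1) : ‖conj p * q‖ < 1 := by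
  rw [norm_mul, Complex.norm_conj]
  nlinarith [norm_nonneg p, norm_nonneg q]

lemma re_one_sub_pos {z : ℂ} (hz : ‖z‖ < 1) : 0 < (1 - z).re := by
  have := (Complex.abs_re_le_norm z).trans_lt hz
  rw [Complex.sub_re, Complex.one_re]
  linarith [(abs_lt.1 this).2]

lemma abs_arg_one_sub_lt {z : ℂ} (hz : ‖z‖ < 1) : |(1 - z).arg| < Real.pi / 2 :=
  Complex.abs_arg_lt_pi_div_two_iff.2 (Or.inl (re_one_sub_pos hz))

lemma abs_skew_lt_pi {p q : ℂ} (hp : ‖p‖ < 1) (hq : ‖q‖ < 1) : |skew p q| < Real.pi := by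
  have := abs_arg_one_sub_lt (norm_conj_mul_lt_one hp hq)
  unfold skew
  rw [abs_lt] at *
  constructor <;> linarith

lemma skew_nonpos_of_arg_nonpos {p q : ℂ} (h : (conj p * q).arg ≤ 0) : skew p q ≤ 0 := by
  have h1 : (conj p * q).im ≤ 0 := by
    rcases h.lt_or_eq with h | h
    · exact (Complex.arg_neg_iff.1 h).le
    · exact ((Complex.arg_eq_zero_iff).1 h).2.le
  have : 0 ≤ (1 - conj p * q).arg := by
    rw [Complex.arg_nonneg_iff, Complex.sub_im, Complex.one_im]
    linarith
  unfold skew; linarith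

/-- The half-side datum attached to a point of the unit disc. -/
noncomputable def radial (p : ℂ) : ℝ := (1 - ‖p‖) / (1 + ‖p‖)

lemma radial_pos {p : ℂ} (hp : ‖p‖ < 1) : 0 < radial p := by
  have := norm_nonneg p
  unfold radial
  apply div_pos <;> linarith

lemma radial_lt_one {p : ℂ} (hp : p ≠ 0) : radial p < 1 := by
  have := norm_pos_iff.2 hp
  unfold radial
  rw [div_lt_one (by linarith)]; linarith

lemma sideQ_radial {p q : ℂ} : sideQ (radial p) (radial q) =
    (1 - ‖p‖ * ‖q‖) / (1 + ‖p‖ * ‖q‖) := by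
  have hp := norm_nonneg p
  have hq := norm_nonneg q
  unfold sideQ radial
  have h1 : (1 + ‖p‖) ≠ 0 := by positivity
  have h2 : (1 + ‖q‖) ≠ 0 := by positivity
  have h3 : (1 + ‖p‖ * ‖q‖) ≠ 0 := by positivity
  have h4 : 1 + (1 - ‖p‖) / (1 + ‖p‖) * ((1 - ‖q‖) / (1 + ‖q‖)) =
      2 * (1 + ‖p‖ * ‖q‖) / ((1 + ‖p‖) * (1 + ‖q‖)) := by
    field_simp; ring
  rw [h4]; field_simp; ring

lemma sideH_radial {p q : ℂ} : sideH (radial p) (radial q) =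
    (‖p‖ + ‖q‖) / (1 + ‖p‖ * ‖q‖) := by
  have hp := norm_nonneg p
  have hq := norm_nonneg q
  unfold sideH radial
  have h1 : (1 + ‖p‖) ≠ 0 := by positivity
  have h2 : (1 + ‖q‖) ≠ 0 := by positivity
  have h3 : (1 + ‖p‖ * ‖q‖) ≠ 0 := by positivity
  have h4 : 1 + (1 - ‖p‖) / (1 + ‖p‖) * ((1 - ‖q‖) / (1 + ‖q‖)) =
      2 * (1 + ‖p‖ * ‖q‖) / ((1 + ‖p‖) * (1 + ‖q‖)) := by
    field_simp; ring
  rw [h4]; field_simp; ring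

lemma arg_eq_arctan {z : ℂ} (hz : 0 < z.re) : z.arg = Real.arctan (z.im / z.re) := by
  have h := Complex.abs_arg_lt_pi_div_two_iff.2 (Or.inl hz)
  rw [abs_lt] at h
  rw [← Complex.tan_arg, Real.arctan_tan h.1 h.2]

/-- Area as π minus the angle sum. For s = |p||q| one has 1 - s·e^{2iτ} = e^{i(τ - π/2)} W with W =
(1+s) sin τ + i(1-s) cos τ, and the argument of W is β. -/
lemma skew_eq {p q : ℂ} (hp : ‖p‖ < 1) (hq : ‖q‖ < 1) (h0 : 0 < (conj p * q).arg)
    (h1 : (conj p * q).arg < Real.pi) :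
    skew p q = Real.pi - (conj p * q).arg -
      2 * sideBeta (radial p) (radial q) ((conj p * q).arg / 2) := by
  have hpi := Real.pi_pos
  set τ := (conj p * q).arg / 2 with hτ
  have hτ2 : (conj p * q).arg = 2 * τ := by rw [hτ]; ring
  have hs : 0 < Real.sin τ := Real.sin_pos_of_pos_of_lt_pi (by linarith) (by linarith)
  have hc : 0 < Real.cos τ := Real.cos_pos_of_mem_Ioo ⟨by linarith, by linarith⟩
  have hz1 := norm_conj_mul_lt_one hp hq
  set s := ‖conj p * q‖ with hsdef
  have hs0 : 0 ≤ s := norm_nonneg _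
  have hspq : s = ‖p‖ * ‖q‖ := by rw [hsdef, norm_mul, Complex.norm_conj]
  have hzeq : conj p * q = s * (Complex.exp (τ * Complex.I) * Complex.exp (τ * Complex.I)) := by
    rw [← Complex.exp_add, ← Complex.norm_mul_exp_arg_mul_I (conj p * q), ← hsdef, hτ2]
    push_cast; ring_nf
  set W : ℂ := ⟨(1 + s) * Real.sin τ, (1 - s) * Real.cos τ⟩ with hW
  have hWre : 0 < W.re := by change 0 < (1 + s) * Real.sin τ; positivity
  have hWarg : W.arg = sideBeta (radial p) (radial q) τ := by
    rw [arg_eq_arctan hWre, sideBeta, sideQ_radial, ← hspq, hW]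
    congr 1
    field_simp
  have hβ0 : 0 < W.arg := by
    rw [hWarg]
    exact Real.arctan_pos.2 (mul_pos (sideQ_pos (radial_pos hp) (radial_pos hq)) (div_pos hc hs))
  have hβ1 : W.arg < Real.pi / 2 := by
    rw [hWarg]; exact Real.arctan_lt_pi_div_two _
  have hfac : 1 - conj p * q = Complex.exp ((τ - Real.pi / 2 : ℝ) * Complex.I) * W := by
    rw [hzeq, Complex.exp_mul_I, Complex.exp_mul_I, ← Complex.ofReal_cos, ← Complex.ofReal_sin,
      ← Complex.ofReal_cos, ← Complex.ofReal_sin, Real.cos_sub_pi_div_two, Real.sin_sub_pi_div_two]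
    have := Real.sin_sq_add_cos_sq τ
    apply Complex.ext <;> simp [hW, -Complex.ofReal_cos, -Complex.ofReal_sin]
    · linear_combination (-1 : ℝ) * this
    · ring
  have he : (Complex.exp ((τ - Real.pi / 2 : ℝ) * Complex.I)).arg = τ - Real.pi / 2 := by
    rw [Complex.arg_exp_mul_I, toIocMod_eq_self]
    constructor <;> linarith
  have hW0 : W ≠ 0 := by intro h; rw [h] at hWre; simp at hWre
  have harg : (1 - conj p * q).arg = τ - Real.pi / 2 + W.arg := by
    rw [hfac, Complex.arg_mul (Complex.exp_ne_zero _) hW0, he]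
    rw [he]; constructor <;> linarith
  unfold skew
  rw [harg, ← hWarg, hτ2]; ring

lemma skew_lt_of_arg_pos {p q : ℂ} (hp : ‖p‖ < 1) (hq : ‖q‖ < 1) (h0 : 0 < (conj p * q).arg)
    (h1 : (conj p * q).arg < Real.pi) : skew p q < Real.pi - (conj p * q).arg := by
  rw [skew_eq hp hq h0 h1]
  linarith [sideBeta_pos (τ := (conj p * q).arg / 2) (radial_pos hp) (radial_pos hq)
    (by linarith) (by linarith)]

lemma skew_le_of_arg_pos {p q : ℂ} (hp : ‖p‖ < 1) (hq : ‖q‖ < 1) (h0 : 0 < (conj p * q).arg) :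
    skew p q ≤ Real.pi - (conj p * q).arg := by
  rcases (Complex.arg_le_pi (conj p * q)).lt_or_eq with h | h
  · exact (skew_lt_of_arg_pos hp hq h0 h).le
  · have him := (Complex.arg_eq_pi_iff.1 h).2
    have : 0 ≤ (1 - conj p * q).arg := by
      rw [Complex.arg_nonneg_iff, Complex.sub_im, Complex.one_im, him]; simp
    unfold skew; linarith

/-- Identities between arguments come out modulo 2π; a priori bounds lift them to equalities of
reals. -/
lemma eq_of_angle_eq {x y : ℝ} (h : (x : Real.Angle) = y) (h1 : x - y < 2 * Real.pi)
    (h2 : -(2 * Real.pi) < x - y) : x = y := by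
  obtain ⟨k, hk⟩ := Real.Angle.angle_eq_iff_two_pi_dvd_sub.1 h
  have hpi := Real.pi_pos
  have hk1 : (k : ℝ) < 1 := by
    by_contra! hc; nlinarith
  have hk2 : (-1 : ℝ) < k := by
    by_contra! hc; nlinarith
  have : k = 0 := by
    have a : k < 1 := by exact_mod_cast hk1
    have b : -1 < k := by exact_mod_cast hk2
    omega
  rw [this] at hk
  simp at hk; linarith

lemma arg_prod_coe_angle (f : ℕ → ℂ) (n : ℕ) (hf : ∀ i, i < n → f i ≠ 0) :
    ((∏ i ∈ Finset.range n, f i).arg : Real.Angle) =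
      ((∑ i ∈ Finset.range n, (f i).arg : ℝ) : Real.Angle) := by
  induction n with
  | zero => simp
  | succ n ih =>
    rw [Finset.prod_range_succ, Finset.sum_range_succ, Complex.arg_mul_coe_angle, ih]
    · simp
    · exact fun i hi => hf i (by omega)
    · exact Finset.prod_ne_zero_iff.2 fun i hi => hf i (by have := Finset.mem_range.1 hi; omega)
    · exact hf n (by omega)

/-- A closed centrally antisymmetric chain of large total skew winds monotonically around `0`. -/
lemma star_of_skew_sum {n : ℕ} (hn : 3 ≤ n) {w : ℕ → ℂ} (hw : ∀ i, ‖w i‖ < 1)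
    (hwn : w n = -w 0)
    (hA : ((n : ℝ) - 2) * Real.pi ≤ ∑ i ∈ Finset.range n, skew (w i) (w (i + 1))) :
    (∀ i, i < n → 0 < (conj (w i) * w (i + 1)).arg) ∧
    (∀ i, i < n → (conj (w i) * w (i + 1)).arg < Real.pi) ∧ (∀ i, i ≤ n → w i ≠ 0) ∧
    ∑ i ∈ Finset.range n, (conj (w i) * w (i + 1)).arg = Real.pi := by
  have hpi := Real.pi_pos
  set θ : ℕ → ℝ := fun i => (conj (w i) * w (i + 1)).arg with hθ
  set A : ℕ → ℝ := fun i => skew (w i) (w (i + 1)) with hAdef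
  change ((n : ℝ) - 2) * Real.pi ≤ ∑ i ∈ Finset.range n, A i at hA
  have hAlt : ∀ i, A i < Real.pi := fun i => (abs_lt.1 (abs_skew_lt_pi (hw _) (hw _))).2
  have hA0 : ∀ i, θ i ≤ 0 → A i ≤ 0 := fun i h => skew_nonpos_of_arg_nonpos h
  have hA1 : ∀ i, 0 < θ i → A i ≤ Real.pi - θ i := fun i h => skew_le_of_arg_pos (hw _) (hw _) h
  have hA2 : ∀ i, 0 < θ i → θ i < Real.pi → A i < Real.pi - θ i := fun i h h' =>
    skew_lt_of_arg_pos (hw _) (hw _) h h'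
  have hcard : ∀ j, j < n → ((Finset.range n).erase j).card = n - 1 := fun j hj => by
    rw [Finset.card_erase_of_mem (Finset.mem_range.2 hj), Finset.card_range]
  -- Two nonpositive apex angles would leave only n - 2 areas that can be positive, each below π.
  have htwo : ∀ i j, i < n → j < n → i ≠ j → θ i ≤ 0 → θ j ≤ 0 → False := by
    intro i j hi hj hij h1 h2
    have hmem : j ∈ (Finset.range n).erase i := Finset.mem_erase.2 ⟨hij.symm, Finset.mem_range.2 hj⟩
    rw [← Finset.add_sum_erase _ _ (Finset.mem_range.2 hi), ← Finset.add_sum_erase _ _ hmem] at hA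
    have hc : (((Finset.range n).erase i).erase j).card = n - 2 := by
      rw [Finset.card_erase_of_mem hmem, hcard i hi]; omega
    have hne : (((Finset.range n).erase i).erase j).Nonempty := by
      rw [← Finset.card_pos, hc]; omega
    have := Finset.sum_lt_sum_of_nonempty hne (fun k _ => hAlt k)
    rw [Finset.sum_const, hc, nsmul_eq_mul, Nat.cast_sub (by omega)] at this
    push_cast at this
    linarith [hA0 i h1, hA0 j h2]
  -- A vertex at 0 makes the apex angles of both adjacent sides vanish. For w 0 these are sides 0
  -- and n - 1, since w n = -w 0.
  have hne : ∀ i, i ≤ n → w i ≠ 0 := by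
    intro i hi h0
    have hz : ∀ j, w j = 0 → θ j ≤ 0 := fun j hj => by simp [hθ, hj]
    have hz' : ∀ j, w (j + 1) = 0 → θ j ≤ 0 := fun j hj => by simp [hθ, hj]
    have hzn : w 0 = 0 → False := fun h => by
      refine htwo 0 (n - 1) (by omega) (by omega) (by omega) (hz 0 h) (hz' _ ?_)
      rw [Nat.sub_add_cancel (by omega), hwn, h, neg_zero]
    rcases Nat.eq_zero_or_pos i with rfl | hi0
    · exact hzn h0
    · rcases hi.lt_or_eq with hlt | rfl
      · exact htwo (i - 1) i (by omega) hlt (by omega)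
          (hz' _ (by rwa [Nat.sub_add_cancel hi0])) (hz i h0)
      · exact hzn (by rwa [hwn, neg_eq_zero] at h0)
  -- The product of the conj(wᵢ)wᵢ₊₁ is -∏|wᵢ|², a negative real.
  have hangle : ((∑ i ∈ Finset.range n, θ i : ℝ) : Real.Angle) = (Real.pi : ℝ) := by
    rw [← arg_prod_coe_angle (fun i => conj (w i) * w (i + 1)) n (fun i hi =>
      mul_ne_zero ((map_ne_zero _).2 (hne i hi.le)) (hne _ hi))]
    congr 1
    rw [Finset.prod_mul_distrib]
    have h1 : ∏ i ∈ Finset.range n, w (i + 1) = -∏ i ∈ Finset.range n, w i := by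
      have := Finset.prod_range_succ w n
      rw [Finset.prod_range_succ', hwn] at this
      apply mul_right_cancel₀ (hne 0 (Nat.zero_le _))
      rw [this]; ring
    rw [h1, ← map_prod, mul_neg, mul_comm, Complex.mul_conj, ← Complex.ofReal_neg]
    apply Complex.arg_ofReal_of_neg
    rw [neg_lt_zero, Complex.normSq_pos, Finset.prod_ne_zero_iff]
    exact fun i hi => hne i (Finset.mem_range.1 hi).le
  -- If θ j ≤ 0, the area bound limits the other angles to a sum of at most π. The total then lies
  -- in (-π, π], so it is π and the others sum to exactly π; now each of them is below π and the
  -- area bound is strict, a contradiction.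
  have hpos : ∀ i, i < n → 0 < θ i := by
    by_contra! hcon
    obtain ⟨j, hj, hjθ⟩ := hcon
    have hpos' : ∀ i ∈ (Finset.range n).erase j, 0 < θ i := by
      intro i hi
      rw [Finset.mem_erase, Finset.mem_range] at hi
      by_contra! h
      exact htwo i j hi.2 hj hi.1 h hjθ
    have hle : ∑ i ∈ (Finset.range n).erase j, A i ≤
        ∑ i ∈ (Finset.range n).erase j, (Real.pi - θ i) :=
      Finset.sum_le_sum fun i hi => hA1 i (hpos' i hi)
    have hlt : (∀ i ∈ (Finset.range n).erase j, θ i < Real.pi) →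
        ∑ i ∈ (Finset.range n).erase j, A i <
        ∑ i ∈ (Finset.range n).erase j, (Real.pi - θ i) := fun h =>
      Finset.sum_lt_sum_of_nonempty (by rw [← Finset.card_pos, hcard j hj]; omega)
        fun i hi => hA2 i (hpos' i hi) (h i hi)
    rw [Finset.sum_sub_distrib, Finset.sum_const, hcard j hj, nsmul_eq_mul,
      Nat.cast_sub (by omega), Nat.cast_one] at hle hlt
    rw [← Finset.add_sum_erase _ _ (Finset.mem_range.2 hj)] at hA hangle
    have hAj := hA0 j hjθ
    have hsum0 := Finset.sum_nonneg fun i hi => (hpos' i hi).le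
    have hjlow := Complex.neg_pi_lt_arg (conj (w j) * w (j + 1))
    change -Real.pi < θ j at hjlow
    have heq := eq_of_angle_eq hangle (by linarith) (by linarith)
    have hsum : ∑ i ∈ (Finset.range n).erase j, θ i = Real.pi := by linarith
    have hlt' := hlt fun i hi => by
      have hc1 : 0 < (((Finset.range n).erase j).erase i).card := by
        rw [Finset.card_erase_of_mem hi, hcard j hj]; omega
      have := Finset.sum_pos (f := θ) (s := ((Finset.range n).erase j).erase i)
        (fun k hk => hpos' k (Finset.mem_of_mem_erase hk)) (Finset.card_pos.1 hc1)
      rw [← Finset.add_sum_erase _ _ hi] at hsum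
      linarith
    linarith
  have hsum : ∑ i ∈ Finset.range n, θ i = Real.pi := by
    have hle : ∑ i ∈ Finset.range n, A i ≤ ∑ i ∈ Finset.range n, (Real.pi - θ i) :=
      Finset.sum_le_sum fun i hi => hA1 i (hpos i (Finset.mem_range.1 hi))
    rw [Finset.sum_sub_distrib, Finset.sum_const, Finset.card_range, nsmul_eq_mul] at hle
    have := Finset.sum_pos (f := θ) (s := Finset.range n)
      (fun k hk => hpos k (Finset.mem_range.1 hk)) ⟨0, Finset.mem_range.2 (by omega)⟩
    exact eq_of_angle_eq hangle (by linarith) (by linarith)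
  refine ⟨hpos, fun i hi => ?_, hne, hsum⟩
  have hc1 : 0 < ((Finset.range n).erase i).card := by rw [hcard i hi]; omega
  have := Finset.sum_pos (f := θ) (s := (Finset.range n).erase i)
    (fun k hk => hpos k (Finset.mem_range.1 (Finset.mem_of_mem_erase hk))) (Finset.card_pos.1 hc1)
  rw [← Finset.add_sum_erase _ _ (Finset.mem_range.2 hi)] at hsum
  change θ i < Real.pi
  linarith

/-- After rotating the bisector of the angle at 0 onto the real axis, the real part of `SideRel` is
Re K · (1 + |p||q|) = cos τ · (|p| + |q|), and Re K ≤ |K|. -/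
lemma one_sub_norm_le_sideDefect {K p q : ℂ} (h : SideRel K p q) (hp0 : p ≠ 0) (hq0 : q ≠ 0) :
    1 - ‖K‖ ≤ sideDefect (radial p) (radial q) ((conj p * q).arg / 2) := by
  set τ := (conj p * q).arg / 2 with hτ
  have hT := norm_pos_iff.2 hp0
  have hU := norm_pos_iff.2 hq0
  unfold sideDefect
  rw [sideH_radial]
  suffices Real.cos τ * ((‖p‖ + ‖q‖) / (1 + ‖p‖ * ‖q‖)) ≤ ‖K‖ by linarith
  rw [← mul_div_assoc, div_le_iff₀ (by positivity)]
  set e := Complex.exp (τ * Complex.I) with he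
  have hee : e * conj e = 1 := by
    rw [Complex.mul_conj, Complex.normSq_eq_norm_sq, he, Complex.norm_exp_ofReal_mul_I]; simp
  set f : ℂ := p / ‖p‖ with hf
  have hTc : (‖p‖ : ℂ) ≠ 0 := by exact_mod_cast hT.ne'
  have hpf : p = ‖p‖ * f := by rw [hf]; field_simp
  have hnf : ‖f‖ = 1 := by rw [hf, norm_div, Complex.norm_real, norm_norm, div_self hT.ne']
  have hff : f * conj f = 1 := by
    rw [Complex.mul_conj, Complex.normSq_eq_norm_sq, hnf]; simp
  have hz : conj p * q = ‖p‖ * ‖q‖ * e ^ 2 := by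
    rw [← Complex.norm_mul_exp_arg_mul_I (conj p * q), norm_mul, Complex.norm_conj, he, ← Complex.exp_nat_mul]
    rw [show (conj p * q).arg = 2 * τ by rw [hτ]; ring]
    push_cast; ring_nf
  have hq : q = ‖q‖ * f * e ^ 2 := by
    apply mul_left_cancel₀ ((map_ne_zero (starRingEnd ℂ)).2 hp0)
    rw [hz]
    have hcp : conj p = ‖p‖ * conj f := by
      conv_lhs => rw [hpf]
      rw [map_mul, Complex.conj_ofReal]
    rw [hcp]
    linear_combination (-(‖p‖ * ‖q‖ * e ^ 2) : ℂ) * hff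
  have hK : K * conj (f * e) + ‖p‖ * ‖q‖ * conj (K * conj (f * e)) = ‖p‖ * conj e + ‖q‖ * e := by
    have h' : K + p * q * conj K = p + q := h
    have h2 : K + (‖p‖ * f) * (‖q‖ * f * e ^ 2) * conj K = ‖p‖ * f + ‖q‖ * f * e ^ 2 := by
      rw [← hpf, ← hq]; exact h'
    simp only [map_mul, Complex.conj_conj]
    have hee' : conj e * e = 1 := by rw [mul_comm]; exact hee
    linear_combination conj f * conj e * h2 + (-(‖p‖ * ‖q‖ * f * e * conj K) * (f * conj f)
      + ‖q‖ * e * f * conj f) * hee + (-(‖p‖ * ‖q‖ * f * e * conj K) +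
      ‖p‖ * conj e + ‖q‖ * e) * hff
  have hre := congrArg Complex.re hK
  set κ := K * conj (f * e) with hκ
  have hκn : ‖κ‖ = ‖K‖ := by
    rw [hκ, norm_mul, Complex.norm_conj, norm_mul, hnf, he, Complex.norm_exp_ofReal_mul_I]; simp
  have here : e.re = Real.cos τ := by rw [he, Complex.exp_ofReal_mul_I_re]
  have h3 : κ.re * (1 + ‖p‖ * ‖q‖) = Real.cos τ * (‖p‖ + ‖q‖) := by
    rw [← Complex.ofReal_mul] at hre
    simp only [Complex.add_re, Complex.re_ofReal_mul, Complex.conj_re, here] at hre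
    linarith
  rw [← h3, ← hκn]
  gcongr
  exact Complex.re_le_norm κ

/-- The main estimate for antisymmetric chains of large skew. -/
theorem sum_one_sub_norm_add_lt_one {n : ℕ} (hn : 3 ≤ n) {w K : ℕ → ℂ} {μ : ℝ}
    (hw : ∀ i, ‖w i‖ < 1) (hwn : w n = -w 0) (hK : ∀ i, i < n → SideRel (K i) (w i) (w (i + 1)))
    (hA : ((n : ℝ) - 2) * Real.pi ≤ ∑ i ∈ Finset.range n, skew (w i) (w (i + 1)))
    (hμ : ∀ i, i < n → μ ≤ 1 - ‖K i‖) :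
    ∑ i ∈ Finset.range n, (1 - ‖K i‖) + μ < 1 := by
  obtain ⟨h0, h1, hne, hs⟩ := star_of_skew_sum hn hw hwn hA
  set θ : ℕ → ℝ := fun i => (conj (w i) * w (i + 1)).arg with hθ
  -- Indices are truncated at n because w is known to be nonzero only up to there.
  have hmin : ∀ i, i < n → min i n = i ∧ min (i + 1) n = i + 1 := fun i hi =>
    ⟨min_eq_left hi.le, min_eq_left hi⟩
  have hdef : ∀ i, i < n → 1 - ‖K i‖ ≤
      sideDefect (radial (w (min i n))) (radial (w (min (i + 1) n))) (θ i / 2) := fun i hi => by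
    rw [(hmin i hi).1, (hmin i hi).2]
    exact one_sub_norm_le_sideDefect (hK i hi) (hne i hi.le) (hne (i + 1) hi)
  have key := sum_sideDefect_add_lt_one (μ := μ) hn (x := fun i => radial (w (min i n)))
    (τ := fun i => θ i / 2) (fun i => radial_pos (hw _))
    (fun i => radial_lt_one (hne _ (min_le_right _ _)))
    (by simp [radial, hwn]) (fun i hi => half_pos (h0 i hi))
    (by rw [← Finset.sum_div, hs]) (by
      -- The β's sum to (nπ - π - ∑ skew)/2, at most π/2 by the area bound.
      have e : ∑ i ∈ Finset.range n, sideBeta (radial (w (min i n))) (radial (w (min (i + 1) n)))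
          (θ i / 2) = ∑ i ∈ Finset.range n, (Real.pi / 2 - θ i / 2 -
          skew (w i) (w (i + 1)) / 2) := Finset.sum_congr rfl fun i hi => by
        have hi := Finset.mem_range.1 hi
        rw [(hmin i hi).1, (hmin i hi).2, skew_eq (hw _) (hw _) (h0 i hi) (h1 i hi)]
        ring
      rw [e, Finset.sum_sub_distrib, Finset.sum_sub_distrib, ← Finset.sum_div, ← Finset.sum_div,
        ← Finset.sum_div, hs, Finset.sum_const, Finset.card_range, nsmul_eq_mul]
      linarith) (fun i hi => (hμ i hi).trans (hdef i hi))
  have := Finset.sum_le_sum fun i (hi : i ∈ Finset.range n) => hdef i (Finset.mem_range.1 hi)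
  linarith

end HyperbolicPlane

/-! ### Transport by half-turns and the bound for half a polygon -/

namespace HyperbolicPlane

open ComplexConjugate

lemma one_sub_conj_mul_ne_zero {p q : ℂ} (hp : ‖p‖ < 1) (hq : ‖q‖ < 1) : 1 - conj p * q ≠ 0 := by
  intro h
  have := re_one_sub_pos (norm_conj_mul_lt_one hp hq)
  rw [h] at this; simp at this

lemma SideRel.eq_div {K p q : ℂ} (h : SideRel K p q) (hK : ‖K‖ < 1) (hp : ‖p‖ < 1) :
    q = (K - p) / (1 - conj K * p) := by
  rw [eq_div_iff (one_sub_conj_mul_ne_zero hK hp)]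
  unfold SideRel at h
  linear_combination -h

lemma sideRel_div {K p : ℂ} (hK : ‖K‖ < 1) (hp : ‖p‖ < 1) :
    SideRel K p ((K - p) / (1 - conj K * p)) := by
  have h := div_mul_cancel₀ (K - p) (one_sub_conj_mul_ne_zero hK hp)
  unfold SideRel
  linear_combination -h

lemma one_sub_sq_pos {z : ℂ} (hz : ‖z‖ < 1) : 0 < 1 - ‖z‖ ^ 2 := by
  nlinarith [norm_nonneg z]

/-- The pseudo-hyperbolic identity. -/
lemma normSq_one_sub_conj_mul (p q : ℂ) :
    ‖1 - conj p * q‖ ^ 2 - ‖p - q‖ ^ 2 = (1 - ‖p‖ ^ 2) * (1 - ‖q‖ ^ 2) := by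
  simp only [← Complex.normSq_eq_norm_sq, Complex.normSq_apply, Complex.sub_re, Complex.sub_im,
    Complex.mul_re, Complex.mul_im, Complex.conj_re, Complex.conj_im, Complex.one_re,
    Complex.one_im]
  ring

lemma norm_div_one_sub_lt_one {p q : ℂ} (hp : ‖p‖ < 1) (hq : ‖q‖ < 1) :
    ‖(p - q) / (1 - conj p * q)‖ < 1 := by
  have h0 := norm_pos_iff.2 (one_sub_conj_mul_ne_zero hp hq)
  rw [norm_div, div_lt_one h0]
  have := normSq_one_sub_conj_mul p q
  have := mul_pos (one_sub_sq_pos hp) (one_sub_sq_pos hq)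
  exact lt_of_pow_lt_pow_left₀ 2 h0.le (by linarith)

lemma skew_neg_neg (p q : ℂ) : skew (-p) (-q) = skew p q := by
  unfold skew; simp

/-- The midpoint datum of the antipodal pair is the antipode. -/
lemma SideRel.neg_unique {K K' p q : ℂ} (h : SideRel K p q) (h' : SideRel K' (-p) (-q))
    (hp : ‖p‖ < 1) (hq : ‖q‖ < 1) : K' = -K := by
  unfold SideRel at h h'
  have e : K + K' = -(p * q) * conj (K + K') := by
    rw [map_add]; linear_combination h + h'
  have e2 := congrArg norm e
  rw [norm_mul, Complex.norm_conj, norm_neg, norm_mul] at e2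
  have : ‖p‖ * ‖q‖ < 1 := by nlinarith [norm_nonneg p, norm_nonneg q]
  have h0 : ‖K + K'‖ = 0 := by nlinarith [norm_nonneg (K + K')]
  rw [norm_eq_zero] at h0
  linear_combination h0

lemma sum_range_shift_of_periodic (f : ℕ → ℝ) {m : ℕ} (hf : ∀ i, f (i + m) = f i) (j : ℕ) :
    ∑ i ∈ Finset.range m, f (i + j) = ∑ i ∈ Finset.range m, f i := by
  induction j with
  | zero => simp
  | succ j ih =>
    rw [← ih]
    have h := Finset.sum_range_succ (fun i => f (i + j)) m
    rw [Finset.sum_range_succ'] at h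
    have e : f (m + j) = f (0 + j) := by rw [add_comm m j, hf, zero_add]
    have e2 : ∀ i, f (i + (j + 1)) = f (i + 1 + j) := fun i => by congr 1; ring
    simp only [e2]
    linarith

/-- The function `tan` of half the total skew of a centrally symmetric quadrilateral. -/
lemma skew_add_skew_neg {p q : ℂ} (hp : ‖p‖ < 1) (hq : ‖q‖ < 1) :
    skew p q + skew q (-p) =
      2 * Real.arctan (2 * (conj p * q).im / (1 - ‖conj p * q‖ ^ 2)) := by
  have hz := norm_conj_mul_lt_one hp hq
  have e1 : conj q * -p = -conj (conj p * q) := by simp [mul_comm]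
  have e0 : (1 : ℂ) - conj q * -p = conj (1 + conj p * q) := by rw [e1]; simp
  set z := conj p * q with hzdef
  have h1 := abs_arg_one_sub_lt hz
  have h2 := abs_arg_one_sub_lt (z := -z) (by rwa [norm_neg])
  rw [sub_neg_eq_add] at h2
  have hr1 := re_one_sub_pos hz
  have hr2 := re_one_sub_pos (z := -z) (by rwa [norm_neg])
  rw [sub_neg_eq_add] at hr2
  have hn1 : (1 - z) ≠ 0 := fun h => by rw [h] at hr1; simp at hr1
  have hn2 : (1 + z) ≠ 0 := fun h => by rw [h] at hr2; simp at hr2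
  have ha1 : (conj (1 - z)).arg = -(1 - z).arg := by
    rw [Complex.arg_conj, if_neg]
    intro h; rw [h, abs_of_pos Real.pi_pos] at h1; linarith [Real.pi_pos]
  have ha2 : (conj (1 + z)).arg = -(1 + z).arg := by
    rw [Complex.arg_conj, if_neg]
    intro h; rw [h, abs_of_pos Real.pi_pos] at h2; linarith [Real.pi_pos]
  have hprod : (1 + z) * conj (1 - z) = ⟨1 - ‖z‖ ^ 2, 2 * z.im⟩ := by
    rw [← Complex.normSq_eq_norm_sq, Complex.normSq_apply]
    apply Complex.ext <;> simp <;> ring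
  have hmul : ((1 + z) * conj (1 - z)).arg = (1 + z).arg - (1 - z).arg := by
    have hr : (1 + z).arg + (conj (1 - z)).arg ∈ Set.Ioc (-Real.pi) Real.pi := by
      rw [ha1]
      rw [abs_lt] at h1 h2
      constructor <;> linarith
    rw [Complex.arg_mul hn2 ((map_ne_zero _).2 hn1) hr, ha1]; ring
  rw [hprod, arg_eq_arctan (one_sub_sq_pos hz)] at hmul
  unfold skew
  rw [e0, ← hzdef, ha2, hmul]; ring

/-- The half apex angles are τ and π/2 - τ and both sides have the same H, so |K| + |L| ≥ (cos τ +
sin τ)H. With s = |p||q| and H² ≥ 4s/(1+s)², it remains to see (1-s)² < 4s sin 2τ. The area bound is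
1 - s² ≤ 2√3 s sin 2τ, and 2/√3 > 1. -/
lemma quadrilateral_bound {p q K L : ℂ} (hp : ‖p‖ < 1) (hq : ‖q‖ < 1) (hK : SideRel K p q)
    (hL : SideRel L q (-p)) (hA : Real.pi / 3 ≤ skew p q + skew q (-p)) :
    1 < ‖K‖ + ‖L‖ := by
  have hpi := Real.pi_pos
  rw [skew_add_skew_neg hp hq] at hA
  have hz := norm_conj_mul_lt_one hp hq
  have e1 : conj q * -p = -conj (conj p * q) := by simp [mul_comm]
  have hzn : ‖conj p * q‖ = ‖p‖ * ‖q‖ := by rw [norm_mul, Complex.norm_conj]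
  have h1 : 1 / √3 ≤ 2 * (conj p * q).im / (1 - ‖conj p * q‖ ^ 2) := by
    rw [← Real.arctan_le_arctan_iff, one_div, Real.arctan_inv_sqrt_three]; linarith
  have hden := one_sub_sq_pos hz
  have h3 : 0 < √(3 : ℝ) := by positivity
  have h33 : √(3 : ℝ) ^ 2 = 3 := Real.sq_sqrt (by norm_num)
  rw [div_le_div_iff₀ h3 hden, one_mul] at h1
  have him : 0 < (conj p * q).im := by
    by_contra! hc
    nlinarith
  have hz0 : conj p * q ≠ 0 := fun h => by rw [h] at him; simp at him
  have hp0 : p ≠ 0 := fun h => by simp [h] at hz0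
  have hq0 : q ≠ 0 := fun h => by simp [h] at hz0
  have b1 := one_sub_norm_le_sideDefect hK hp0 hq0
  have b2 := one_sub_norm_le_sideDefect hL hq0 (neg_ne_zero.2 hp0)
  have hθ0 : 0 < (conj p * q).arg := by
    rcases (Complex.arg_nonneg_iff.2 him.le).lt_or_eq with h | h
    · exact h
    · exact absurd (Complex.arg_eq_zero_iff.1 h.symm).2 him.ne'
  have hθ1 : (conj p * q).arg < Real.pi := by
    rcases (Complex.arg_le_pi (conj p * q)).lt_or_eq with h | h
    · exact h
    · exact absurd (Complex.arg_eq_pi_iff.1 h).2 him.ne'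
  have hsin : (conj p * q).im = ‖p‖ * ‖q‖ * Real.sin (conj p * q).arg := by
    rw [← hzn, Complex.norm_mul_sin_arg]
  have harg2 : (conj q * -p).arg = Real.pi - (conj p * q).arg := by
    rw [e1, Complex.arg_neg_eq_arg_add_pi_of_im_neg, Complex.arg_conj, if_neg hθ1.ne]
    · ring
    · rw [Complex.conj_im]; linarith
  have hrad : radial (-p) = radial p := by simp [radial]
  rw [harg2, hrad, sideDefect, sideH_radial, sub_div, Real.cos_pi_div_two_sub] at b2
  rw [sideDefect, sideH_radial] at b1
  rw [add_comm ‖q‖, mul_comm ‖q‖] at b2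
  rw [hzn] at h1 hz
  rw [hsin] at h1
  set τ := (conj p * q).arg / 2 with hτ
  rw [show (conj p * q).arg = 2 * τ by rw [hτ]; ring, Real.sin_two_mul] at h1
  have hs : 0 < Real.sin τ := Real.sin_pos_of_pos_of_lt_pi (by linarith) (by linarith)
  have hc : 0 < Real.cos τ := Real.cos_pos_of_mem_Ioo ⟨by linarith, by linarith⟩
  have hT := norm_pos_iff.2 hp0
  have hU := norm_pos_iff.2 hq0
  have hsc := Real.sin_sq_add_cos_sq τ
  set s := ‖p‖ * ‖q‖ with hsdef
  have hs0 : 0 < s := mul_pos hT hU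
  set H := (‖p‖ + ‖q‖) / (1 + s) with hH
  have hH0 : 0 < H := by positivity
  suffices 1 < (Real.cos τ + Real.sin τ) * H by linarith
  have hHsq : H ^ 2 * (1 + s) ^ 2 = (‖p‖ + ‖q‖) ^ 2 := by
    rw [← mul_pow, hH, div_mul_cancel₀ _ (by positivity)]
  have hH4 : 4 * s ≤ H ^ 2 * (1 + s) ^ 2 := by
    rw [hHsq, hsdef]; nlinarith [sq_nonneg (‖p‖ - ‖q‖)]
  have hkey : (1 + s) ^ 2 < (1 + 2 * Real.sin τ * Real.cos τ) * (4 * s) := by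
    have h3lt : √(3 : ℝ) < 1.8 := by
      rw [Real.sqrt_lt' (by norm_num)]; norm_num
    have h4 : √3 * (1 - s ^ 2) ≤ 6 * (s * (2 * Real.sin τ * Real.cos τ)) := by
      nlinarith
    have h5 : 1.7 < √(3 : ℝ) := by
      rw [Real.lt_sqrt (by norm_num)]; norm_num
    nlinarith [mul_pos (sub_pos.2 hz) hs0]
  have hsq : 1 < ((Real.cos τ + Real.sin τ) * H) ^ 2 := by
    have e : ((Real.cos τ + Real.sin τ) * H) ^ 2 = (1 + 2 * Real.sin τ * Real.cos τ) * H ^ 2 := by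
      rw [mul_pow]; linear_combination H ^ 2 * hsc
    rw [e]
    have hp2 : 0 < (1 + s) ^ 2 := by positivity
    by_contra! hcon
    have h6 := mul_le_mul_of_nonneg_right hcon hp2.le
    have h7 := mul_le_mul_of_nonneg_left hH4
      (by positivity : 0 ≤ 1 + 2 * Real.sin τ * Real.cos τ)
    linarith
  have := (one_lt_sq_iff₀ (by positivity)).1 hsq
  exact this

lemma div_div_mul_div_cancel {κ M N N' F c δ : ℂ} (hκ : κ ≠ 0) (hM : M ≠ 0) (hN : N ≠ 0)
    (hN' : N' ≠ 0) (hF : F ≠ 0) :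
    (-κ * δ / (M * N)) / (κ * F / (M * N')) * (c / N') = -(c / N * (δ / F)) := by
  field_simp

/-- Transport of a second orbit `w` along a chain `p`. -/
lemma chain_step {K p w p' w' : ℂ} (hK : ‖K‖ < 1) (hp : ‖p‖ < 1) (hw : ‖w‖ < 1)
    (hp' : SideRel K p p') (hw' : SideRel K w w') :
    (w' - p') / (1 - conj p' * w') * conj (1 - conj p * p') =
      -((1 - conj p * p') * ((w - p) / (1 - conj p * w))) ∧
    (1 - conj w * w').arg - (1 - conj p * p').arg =
      (1 - conj p' * w').arg - (1 - conj p * w).arg := by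
  have hN := one_sub_conj_mul_ne_zero hK hp
  have hM := one_sub_conj_mul_ne_zero hK hw
  have hF := one_sub_conj_mul_ne_zero hp hw
  have ep := hp'.eq_div hK hp
  have ew := hw'.eq_div hK hw
  have eP : p' * (1 - conj K * p) = K - p := by
    unfold SideRel at hp'; linear_combination -hp'
  have eW : w' * (1 - conj K * w) = K - w := by
    unfold SideRel at hw'; linear_combination -hw'
  have np' : ‖p'‖ < 1 := ep ▸ norm_div_one_sub_lt_one hK hp
  have nw' : ‖w'‖ < 1 := ew ▸ norm_div_one_sub_lt_one hK hw
  have hF' := one_sub_conj_mul_ne_zero np' nw'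
  have ha := one_sub_conj_mul_ne_zero hw nw'
  have hb := one_sub_conj_mul_ne_zero hp np'
  have hNc : 1 - K * conj p ≠ 0 := by
    have := (map_ne_zero (starRingEnd ℂ)).2 hN
    simpa using this
  -- This product is real, and positive by `cpos`; so its two factors have opposite arguments.
  have rel : ∀ z z' : ℂ, SideRel K z z' → 1 - conj K * z ≠ 0 →
      (1 - conj z * z') * (1 - conj K * z) = ((1 + ‖z‖ ^ 2 - 2 * (conj K * z).re : ℝ) : ℂ) := by
    intro z z' h _
    unfold SideRel at h
    have e : ((1 + ‖z‖ ^ 2 - 2 * (conj K * z).re : ℝ) : ℂ) =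
        1 + conj z * z - (conj K * z + K * conj z) := by
      rw [← Complex.normSq_eq_norm_sq]
      push_cast
      rw [Complex.normSq_eq_conj_mul_self]
      have := Complex.add_conj (conj K * z)
      rw [map_mul, Complex.conj_conj] at this
      rw [this]
      push_cast; ring
    rw [e]
    linear_combination conj z * h
  have cpos : ∀ z : ℂ, ‖z‖ < 1 → 0 < 1 + ‖z‖ ^ 2 - 2 * (conj K * z).re := by
    intro z hz
    have h1 := Complex.re_le_norm (conj K * z)
    rw [norm_mul, Complex.norm_conj] at h1
    nlinarith [norm_nonneg z, norm_nonneg K]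
  have relp := rel p p' hp' hN
  have relw := rel w w' hw' hM
  have cp := cpos p hp
  have cw := cpos w hw
  set c := 1 + ‖p‖ ^ 2 - 2 * (conj K * p).re
  set d := 1 + ‖w‖ ^ 2 - 2 * (conj K * w).re
  have hc0 : (c : ℂ) ≠ 0 := by exact_mod_cast cp.ne'
  have hconjp : conj (1 - conj p * p') * (1 - K * conj p) = c := by
    have := congrArg (starRingEnd ℂ) relp
    simpa using this
  have hK1 := one_sub_sq_pos hK
  have hKn : ((1 - ‖K‖ ^ 2 : ℝ) : ℂ) = 1 - conj K * K := by
    rw [← Complex.normSq_eq_norm_sq]; push_cast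
    rw [Complex.normSq_eq_conj_mul_self]
  have hdiff : (w' - p') * ((1 - conj K * w) * (1 - conj K * p)) =
      -((1 - ‖K‖ ^ 2 : ℝ) : ℂ) * (w - p) := by
    rw [hKn]; linear_combination (1 - conj K * p) * eW - (1 - conj K * w) * eP
  have hden : (1 - conj p' * w') * ((1 - conj K * w) * (1 - K * conj p)) =
      ((1 - ‖K‖ ^ 2 : ℝ) : ℂ) * (1 - conj p * w) := by
    have ePc := congrArg (starRingEnd ℂ) eP
    simp only [map_sub, map_mul, map_one, Complex.conj_conj] at ePc
    rw [hKn]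
    linear_combination -(w' * (1 - conj K * w)) * ePc - (conj K - conj p) * eW
  have hKne : ((1 - ‖K‖ ^ 2 : ℝ) : ℂ) ≠ 0 := by exact_mod_cast hK1.ne'
  -- The half-turn carries p, w to p', w', so the coordinate of w seen from p changes only by a
  -- factor of modulus one, -e^{-i·skew}. For the second claim, the half-turn reverses the cycle w,
  -- w', p', p, so the signed area of that cycle vanishes.
  constructor
  · have e1 : w' - p' = -((1 - ‖K‖ ^ 2 : ℝ) : ℂ) * (w - p) /
        ((1 - conj K * w) * (1 - conj K * p)) := by
      rw [eq_div_iff (mul_ne_zero hM hN)]; exact hdiff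
    have e2 : 1 - conj p' * w' = ((1 - ‖K‖ ^ 2 : ℝ) : ℂ) * (1 - conj p * w) /
        ((1 - conj K * w) * (1 - K * conj p)) := by
      rw [eq_div_iff (mul_ne_zero hM hNc)]; exact hden
    have e3 : 1 - conj p * p' = c / (1 - conj K * p) := by
      rw [eq_div_iff hN]; exact relp
    have e4 : conj (1 - conj p * p') = c / (1 - K * conj p) := by
      rw [eq_div_iff hNc]; exact hconjp
    rw [e4, e3, e1, e2]
    exact div_div_mul_div_cancel hKne hM hN hNc hF
  · have hprod : ((c * (1 - ‖K‖ ^ 2) : ℝ) : ℂ) * ((1 - conj w * w') * (1 - conj p * w)) =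
        ((d * ‖1 - conj K * p‖ ^ 2 : ℝ) : ℂ) * ((1 - conj p' * w') * (1 - conj p * p')) := by
      have en : ((‖1 - conj K * p‖ ^ 2 : ℝ) : ℂ) = (1 - conj K * p) * (1 - K * conj p) := by
        rw [← Complex.normSq_eq_norm_sq, ← Complex.mul_conj]; simp
      rw [Complex.ofReal_mul, Complex.ofReal_mul d, en]
      apply mul_right_cancel₀ hM
      linear_combination (c : ℂ) * ((1 - ‖K‖ ^ 2 : ℝ) : ℂ) * (1 - conj p * w) * relw -
        (d : ℂ) * (1 - conj K * p) * (1 - conj p * p') * hden -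
        (d : ℂ) * ((1 - ‖K‖ ^ 2 : ℝ) : ℂ) * (1 - conj p * w) * relp
    have harg := congrArg Complex.arg hprod
    have hnN : 0 < ‖1 - conj K * p‖ := norm_pos_iff.2 hN
    rw [Complex.arg_real_mul _ (mul_pos cp hK1),
      Complex.arg_real_mul _ (mul_pos cw (by positivity))] at harg
    have hang := congrArg (fun x : ℝ => (x : Real.Angle)) harg
    simp only [Complex.arg_mul_coe_angle ha hF, Complex.arg_mul_coe_angle hF' hb] at hang
    have b1 := abs_lt.1 (abs_arg_one_sub_lt (norm_conj_mul_lt_one hw nw'))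
    have b2 := abs_lt.1 (abs_arg_one_sub_lt (norm_conj_mul_lt_one hp np'))
    have b3 := abs_lt.1 (abs_arg_one_sub_lt (norm_conj_mul_lt_one np' nw'))
    have b4 := abs_lt.1 (abs_arg_one_sub_lt (norm_conj_mul_lt_one hp hw))
    rw [← Real.Angle.coe_add, ← Real.Angle.coe_add] at hang
    linarith [eq_of_angle_eq hang (by linarith) (by linarith)]

lemma fixed_midpoint {K : ℂ} (hK : ‖K‖ < 1) : ∃ w : ℂ, ‖w‖ < 1 ∧ SideRel K w w := by
  have h1 := one_sub_sq_pos hK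
  set r := 1 + √(1 - ‖K‖ ^ 2) with hr
  have hr1 : 1 ≤ r := by rw [hr]; linarith [Real.sqrt_nonneg (1 - ‖K‖ ^ 2)]
  have hrr : r ^ 2 + ‖K‖ ^ 2 = 2 * r := by
    have := Real.sq_sqrt h1.le
    rw [hr]; linear_combination this
  have hrc : (r : ℂ) ≠ 0 := by exact_mod_cast (by linarith : r ≠ 0)
  -- K/(1 + √(1 - |K|²)) is the hyperbolic midpoint of 0 and K.
  refine ⟨K / r, ?_, ?_⟩
  · rw [norm_div, Complex.norm_real, Real.norm_of_nonneg (by linarith), div_lt_one (by linarith)]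
    linarith
  · unfold SideRel
    have hrr' : (r : ℂ) ^ 2 + K * conj K = 2 * r := by
      rw [Complex.mul_conj, Complex.normSq_eq_norm_sq]; exact_mod_cast hrr
    field_simp
    linear_combination K * hrr'

/-- The orbit w starts at the midpoint of side 0, so w 1 = w 0 and the remaining m - 1 sides carry
the whole area (m-3)π = ((m-1)-2)π. The term of side 0 is the least one and serves as μ. -/
lemma chain_bound_of_max {m : ℕ} (hm : 4 ≤ m) {p K : ℕ → ℂ} (hp : ∀ i, ‖p i‖ < 1)
    (hpm : p m = -p 0) (hK1 : ∀ i, ‖K i‖ < 1) (hrel : ∀ i, SideRel (K i) (p i) (p (i + 1)))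
    (hmax : ∀ i, ‖K i‖ ≤ ‖K 0‖)
    (hA : ∑ i ∈ Finset.range m, skew (p i) (p (i + 1)) = ((m : ℝ) - 3) * Real.pi) :
    ∑ i ∈ Finset.range m, (1 - ‖K i‖) < 1 := by
  obtain ⟨w₀, hw₀, hrel₀⟩ := fixed_midpoint (hK1 0)
  obtain ⟨w, hw0, hws⟩ : ∃ w : ℕ → ℂ, w 0 = w₀ ∧
      ∀ i, w (i + 1) = (K i - w i) / (1 - conj (K i) * w i) :=
    ⟨fun n => Nat.rec w₀ (fun i z => (K i - z) / (1 - conj (K i) * z)) n, rfl, fun i => rfl⟩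
  have hw : ∀ i, ‖w i‖ < 1 := by
    intro i
    induction i with
    | zero => rw [hw0]; exact hw₀
    | succ i ih => rw [hws]; exact norm_div_one_sub_lt_one (hK1 i) ih
  have hwrel : ∀ i, SideRel (K i) (w i) (w (i + 1)) := fun i => by
    rw [hws]; exact sideRel_div (hK1 i) (hw i)
  have hw1 : w 1 = w 0 := by
    rw [show (1 : ℕ) = 0 + 1 from rfl, hws, hw0]
    exact (hrel₀.eq_div (hK1 0) hw₀).symm
  have step := fun i => chain_step (hK1 i) (hp i) (hw i) (hrel i) (hwrel i)
  have hφ : ∀ n, (w n - p n) / (1 - conj (p n) * w n) =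
      (-1) ^ n * Complex.exp ((-∑ i ∈ Finset.range n, skew (p i) (p (i + 1)) : ℝ) * Complex.I) *
      ((w 0 - p 0) / (1 - conj (p 0) * w 0)) := by
    intro n
    induction n with
    | zero => simp
    | succ n ih =>
      have hb := one_sub_conj_mul_ne_zero (hp n) (hp (n + 1))
      have h1 := (step n).1
      rw [ih] at h1
      have hexp : Complex.exp ((-skew (p n) (p (n + 1)) : ℝ) * Complex.I) *
          conj (1 - conj (p n) * p (n + 1)) = 1 - conj (p n) * p (n + 1) := by
        have e := Complex.norm_mul_exp_arg_mul_I (1 - conj (p n) * p (n + 1))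
        have e2 := congrArg (starRingEnd ℂ) e
        rw [map_mul, ← Complex.exp_conj, map_mul, Complex.conj_ofReal, Complex.conj_ofReal,
          Complex.conj_I] at e2
        rw [← e2]
        conv_rhs => rw [← e]
        rw [mul_left_comm, ← Complex.exp_add]
        unfold skew
        push_cast
        ring_nf
      apply mul_right_cancel₀ ((map_ne_zero (starRingEnd ℂ)).2 hb)
      rw [h1, Finset.sum_range_succ, neg_add, Complex.ofReal_add, add_mul, Complex.exp_add,
        pow_succ]
      linear_combination ((-1) ^ n * Complex.exp ((-∑ i ∈ Finset.range n,
        skew (p i) (p (i + 1)) : ℝ) * Complex.I) *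
        ((w 0 - p 0) / (1 - conj (p 0) * w 0))) * hexp
  -- The exact area, that is the angle sum 2π, enters here: it makes w m the antipode of w 0.
  have hsign : (-1 : ℂ) ^ m * Complex.exp ((-(((m : ℝ) - 3) * Real.pi) : ℝ) * Complex.I) = -1 := by
    have e : ((-(((m : ℝ) - 3) * Real.pi) : ℝ) : ℂ) * Complex.I =
        -((m - 3 : ℕ) * (Real.pi * Complex.I)) := by
      push_cast [Nat.cast_sub (by omega : 3 ≤ m)]; ring
    rw [e, Complex.exp_neg, Complex.exp_nat_mul, Complex.exp_pi_mul_I]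
    obtain ⟨r, rfl⟩ : ∃ r, m = r + 3 := ⟨m - 3, by omega⟩
    rw [Nat.add_sub_cancel, pow_add, ← inv_pow]
    norm_num
    rw [← mul_pow]; norm_num
  have hwm : w m = -w 0 := by
    have h1 := hφ m
    rw [hA, hsign, hpm] at h1
    have d1 : 1 - conj (-p 0) * w m ≠ 0 :=
      one_sub_conj_mul_ne_zero (by rw [norm_neg]; exact hp 0) (hw m)
    have d2 := one_sub_conj_mul_ne_zero (hp 0) (hw 0)
    rw [mul_div_assoc', div_eq_div_iff d1 d2, map_neg] at h1
    have h2 := one_sub_conj_mul_ne_zero (hp 0) (hp 0)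
    apply mul_right_cancel₀ h2
    linear_combination h1
  have htel : ∀ n, ∑ i ∈ Finset.range n, (skew (w i) (w (i + 1)) - skew (p i) (p (i + 1))) =
      -2 * ((1 - conj (p n) * w n).arg - (1 - conj (p 0) * w 0).arg) := by
    intro n
    induction n with
    | zero => simp
    | succ n ih =>
      rw [Finset.sum_range_succ, ih]
      have := (step n).2
      unfold skew
      linarith
  -- The telescoped boundary terms cancel because p m and w m are the antipodes of p 0 and w 0.
  have hskew : ∑ i ∈ Finset.range m, skew (w i) (w (i + 1)) = ((m : ℝ) - 3) * Real.pi := by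
    have := htel m
    rw [hwm, hpm, Finset.sum_sub_distrib, hA] at this
    simp only [map_neg, neg_mul_neg, sub_self, mul_zero] at this
    linarith
  have hskew0 : skew (w 0) (w 1) = 0 := by
    rw [hw1]; unfold skew
    rw [← Complex.normSq_eq_conj_mul_self, ← Complex.ofReal_one, ← Complex.ofReal_sub,
      Complex.arg_ofReal_of_nonneg]
    · simp
    · rw [Complex.normSq_eq_norm_sq]; exact (one_sub_sq_pos (hw 0)).le
  obtain ⟨n, rfl⟩ : ∃ n, m = n + 1 := ⟨m - 1, by omega⟩
  rw [Finset.sum_range_succ'] at hskew ⊢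
  rw [zero_add, hskew0] at hskew
  refine sum_one_sub_norm_add_lt_one (n := n) (by omega) (w := fun i => w (i + 1))
    (K := fun i => K (i + 1)) (fun i => hw _) (by simp only [zero_add]; rw [hwm, hw1])
    (fun i _ => hwrel _) ?_ (fun i _ => by linarith [hmax (i + 1)])
  push_cast at hskew
  linarith

/-- The bound for the midpoint data of half of a centrally symmetric polygon. -/
theorem chain_bound {m : ℕ} (hm : 2 ≤ m) {p K : ℕ → ℂ} (hp : ∀ i, ‖p i‖ < 1)
    (hpm : ∀ i, p (i + m) = -p i) (hK1 : ∀ i, ‖K i‖ < 1)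
    (hrel : ∀ i, SideRel (K i) (p i) (p (i + 1))) {k : ℕ} (hk : 1 ≤ k)
    (hA : ∑ i ∈ Finset.range m, skew (p i) (p (i + 1)) =
      ((m : ℝ) - 1) * Real.pi - 2 * Real.pi / k)
    (hpos : 0 < ∑ i ∈ Finset.range m, skew (p i) (p (i + 1))) :
    ∑ i ∈ Finset.range m, (1 - ‖K i‖) < 1 := by
  have hpi := Real.pi_pos
  have hk0 : (0 : ℝ) < k := by exact_mod_cast hk
  have hpm0 : p m = -p 0 := by simpa using hpm 0
  have hKm : ∀ i, K (i + m) = -K i := fun i => by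
    have h := hrel (i + m)
    rw [hpm, show i + m + 1 = i + 1 + m by ring, hpm] at h
    exact (hrel i).neg_unique h (hp _) (hp _)
  have h2k : 2 * Real.pi / k < ((m : ℝ) - 1) * Real.pi := by linarith
  rw [div_lt_iff₀ hk0] at h2k
  -- Positive area excludes small cases: k = 1 needs m ≥ 4, and m = 2 needs k ≥ 3.
  have h2k' : 2 < ((m : ℝ) - 1) * k := by nlinarith
  rcases hm.lt_or_eq with hm3 | rfl
  · rcases hk.lt_or_eq with hk2 | rfl
    · have := sum_one_sub_norm_add_lt_one (μ := 0) hm3 hp hpm0 (fun i _ => hrel i) (by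
        rw [hA]
        have : 2 * Real.pi / k ≤ Real.pi := by
          rw [div_le_iff₀ hk0]
          have : (2 : ℝ) ≤ k := by exact_mod_cast hk2
          nlinarith
        linarith) (fun i _ => by linarith [hK1 i])
      linarith
    · have hm4 : 4 ≤ m := by
        have : (3 : ℝ) < m := by push_cast at h2k'; linarith
        exact_mod_cast this
      obtain ⟨j, -, hj⟩ := Finset.exists_max_image (Finset.range m) (fun i => ‖K i‖)
        ⟨0, Finset.mem_range.2 (by omega)⟩
      have hper : ∀ i, ‖K (i + m)‖ = ‖K i‖ := fun i => by rw [hKm, norm_neg]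
      have hmod : ∀ i, ‖K i‖ = ‖K (i % m)‖ := by
        intro i
        induction i using Nat.strong_induction_on with
        | _ i ih =>
          rcases lt_or_ge i m with h | h
          · rw [Nat.mod_eq_of_lt h]
          · obtain ⟨r, rfl⟩ : ∃ r, i = r + m := ⟨i - m, by omega⟩
            rw [hper, Nat.add_mod_right]
            exact ih r (by omega)
      have key := chain_bound_of_max hm4 (p := fun i => p (i + j)) (K := fun i => K (i + j))
        (fun i => hp _) (by simp only [zero_add]; rw [add_comm m j, hpm]) (fun i => hK1 _)
        (fun i => by
          have := hrel (i + j)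
          rwa [show i + j + 1 = i + 1 + j by ring] at this)
        (fun i => by
          simp only [zero_add]
          rw [hmod (i + j)]
          exact hj _ (Finset.mem_range.2 (Nat.mod_lt _ (by omega))))
        (by
          have e : ∀ i, skew (p (i + j)) (p (i + 1 + j)) =
            (fun i => skew (p i) (p (i + 1))) (i + j) := fun i => by
              simp only; rw [show i + 1 + j = i + j + 1 by ring]
          simp only [e]
          rw [sum_range_shift_of_periodic (fun i => skew (p i) (p (i + 1)))]
          · rw [hA]; push_cast; ring
          · intro i
            rw [show i + m + 1 = i + 1 + m by ring, hpm, hpm, skew_neg_neg])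
      rwa [sum_range_shift_of_periodic (fun i => 1 - ‖K i‖) (fun i => by rw [hper])] at key
  · have hk3 : 3 ≤ k := by
      have : (2 : ℝ) < k := by push_cast at h2k'; linarith
      exact_mod_cast this
    have hpi3 : 2 * Real.pi / k ≤ 2 * Real.pi / 3 := by
      gcongr; exact_mod_cast hk3
    simp only [Finset.sum_range_succ, Finset.sum_range_zero, zero_add] at hA ⊢
    rw [show 1 + 1 = 2 from rfl, hpm0] at hA
    have h1 := hrel 1
    rw [show 1 + 1 = 2 from rfl, hpm0] at h1
    have := quadrilateral_bound (hp 0) (hp 1) (hrel 0) h1 (by push_cast at hA; linarith)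
    linarith

end HyperbolicPlane

/-! ### Disc charts, hyperboloid coordinates, segments and extreme points -/

namespace HyperbolicPlane

open UpperHalfPlane ComplexConjugate

lemma sub_conj_ne_zero (a b : ℍ) : (b : ℂ) - conj (a : ℂ) ≠ 0 := by
  intro h
  have := congrArg Complex.im h
  simp at this
  linarith [a.im_pos, b.im_pos]

lemma discChart_eq_zero_iff {a b : ℍ} : discChart a b = 0 ↔ b = a := by
  unfold discChart
  rw [div_eq_zero_iff, or_iff_left (sub_conj_ne_zero a b), sub_eq_zero]
  exact ⟨fun h => UpperHalfPlane.ext h, fun h => by rw [h]⟩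

lemma norm_discChart_lt_one (a b : ℍ) : ‖discChart a b‖ < 1 := by
  unfold discChart
  have h := norm_pos_iff.2 (sub_conj_ne_zero a b)
  rw [norm_div, div_lt_one h]
  apply lt_of_pow_lt_pow_left₀ 2 h.le
  rw [← Complex.normSq_eq_norm_sq, ← Complex.normSq_eq_norm_sq, Complex.normSq_apply,
    Complex.normSq_apply]
  simp
  nlinarith [mul_pos a.im_pos b.im_pos]

/-- Change of base point of the disc chart. -/
lemma exists_discChart_eq (o a : ℍ) : ∃ u : ℂ, ‖u‖ = 1 ∧ ∀ b : ℍ, discChart a b =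
    u * ((discChart o b - discChart o a) / (1 - conj (discChart o a) * discChart o b)) := by
  have h1 := sub_conj_ne_zero o a
  have h2 : conj (a : ℂ) - (o : ℂ) ≠ 0 := by
    have := (map_ne_zero (starRingEnd ℂ)).2 h1
    simpa using this
  refine ⟨-((a : ℂ) - conj (o : ℂ)) / (conj (a : ℂ) - (o : ℂ)), ?_, fun b => ?_⟩
  · rw [norm_div, norm_neg, ← Complex.norm_conj, map_sub, Complex.conj_conj,
      div_self (norm_ne_zero_iff.2 h2)]
  · have h3 := sub_conj_ne_zero o b
    have h4 := sub_conj_ne_zero a b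
    have h5 : (o : ℂ) - conj (o : ℂ) ≠ 0 := sub_conj_ne_zero o o
    have h6 : conj (a : ℂ) - b ≠ 0 := by rw [← neg_sub]; exact neg_ne_zero.2 h4
    unfold discChart
    have e1 : ((b : ℂ) - o) / (b - conj (o : ℂ)) - (a - o) / (a - conj (o : ℂ)) =
        (b - a) * (o - conj (o : ℂ)) / ((b - conj (o : ℂ)) * (a - conj (o : ℂ))) := by
      rw [div_sub_div _ _ h3 h1]; ring
    have e2 : 1 - conj (((a : ℂ) - o) / (a - conj (o : ℂ))) * ((b - o) / (b - conj (o : ℂ))) =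
        (o - conj (o : ℂ)) * (conj (a : ℂ) - b) / ((conj (a : ℂ) - o) * (b - conj (o : ℂ))) := by
      rw [map_div₀, map_sub, map_sub, Complex.conj_conj, div_mul_div_comm, one_sub_div
        (mul_ne_zero h2 h3)]
      ring
    rw [e1, e2]
    generalize (a : ℂ) = a at *
    generalize (b : ℂ) = b at *
    generalize conj (o : ℂ) = o' at *
    generalize (o : ℂ) = o at *
    generalize conj (a : ℂ) = a' at *
    have : b - a' = -(a' - b) := by ring
    rw [this]
    field_simp

/-- Linear coordinates on the hyperboloid. -/
noncomputable def coordA (z : ℍ) : ℝ := 1 / z.im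

/-- Linear coordinates on the hyperboloid. -/
noncomputable def coordB (z : ℍ) : ℝ := z.re / z.im

/-- Linear coordinates on the hyperboloid. -/
noncomputable def coordC (z : ℍ) : ℝ := (z.re ^ 2 + z.im ^ 2) / z.im

lemma coordA_pos (z : ℍ) : 0 < coordA z := by
  unfold coordA; have := z.im_pos; positivity

lemma coord_quadric (z : ℍ) : coordA z * coordC z - coordB z ^ 2 = 1 := by
  unfold coordA coordB coordC
  have := z.im_ne_zero
  field_simp; ring

/-- The right side polarises the quadratic form of `coord_quadric`. -/
lemma cosh_dist_coord (z w : ℍ) : Real.cosh (dist z w) =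
    (coordA z * coordC w + coordC z * coordA w) / 2 - coordB z * coordB w := by
  rw [UpperHalfPlane.cosh_dist, Complex.dist_eq, ← Complex.normSq_eq_norm_sq, Complex.normSq_apply]
  unfold coordA coordB coordC
  have h1 := z.im_ne_zero
  have h2 := w.im_ne_zero
  simp
  field_simp; ring

/-- The orientation determinant of three points. -/
noncomputable def orient (a b c : ℍ) : ℝ :=
  coordA a * (coordB b * coordC c - coordC b * coordB c) -
  coordB a * (coordA b * coordC c - coordC b * coordA c) +
  coordC a * (coordA b * coordB c - coordB b * coordA c)

lemma orient_cyclic (a b c : ℍ) : orient b c a = orient a b c := by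
  unfold orient; ring

lemma orient_swap (a b c : ℍ) : orient a c b = -orient a b c := by
  unfold orient; ring

lemma orient_self_right (a b : ℍ) : orient a b b = 0 := by
  unfold orient; ring

lemma orient_self_left (a b : ℍ) : orient a b a = 0 := by
  unfold orient; ring

/-- Up to a positive factor, being to the left is the sign of a determinant: alternating, cyclic,
and linear in the hyperboloid coordinates of each point. -/
lemma im_conj_discChart_mul (a b c : ℍ) : (conj (discChart a b) * discChart a c).im =
    2 * a.im ^ 2 * b.im * c.im / (Complex.normSq (b - conj (a : ℂ)) *
      Complex.normSq (c - conj (a : ℂ))) * orient a b c := by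
  have h1 := sub_conj_ne_zero a b
  have h2 := sub_conj_ne_zero a c
  have h3 : conj ((b : ℂ) - conj (a : ℂ)) ≠ 0 := (map_ne_zero _).2 h1
  have h4 : conj ((c : ℂ) - conj (a : ℂ)) ≠ 0 := (map_ne_zero _).2 h2
  have e : conj (discChart a b) * discChart a c =
      (conj ((b : ℂ) - a) * (c - a) * (b - conj (a : ℂ)) * conj (c - conj (a : ℂ))) /
      ((Complex.normSq (b - conj (a : ℂ)) * Complex.normSq (c - conj (a : ℂ)) : ℝ) : ℂ) := by
    rw [Complex.ofReal_mul, ← Complex.mul_conj, ← Complex.mul_conj]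
    unfold discChart
    rw [map_div₀, div_mul_div_comm, div_eq_div_iff (mul_ne_zero h3 h2) (mul_ne_zero
      (mul_ne_zero h1 h3) (mul_ne_zero h2 h4))]
    ring
  rw [e, Complex.div_ofReal_im, div_mul_eq_mul_div]
  congr 1
  unfold orient coordA coordB coordC
  have i1 := a.im_ne_zero
  have i2 := b.im_ne_zero
  have i3 := c.im_ne_zero
  simp only [Complex.mul_im, Complex.mul_re, Complex.sub_re, Complex.sub_im, Complex.conj_re,
    Complex.conj_im, UpperHalfPlane.coe_re, UpperHalfPlane.coe_im, map_sub, Complex.conj_conj]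
  field_simp
  ring

lemma im_conj_discChart_mul_factor_pos (a b c : ℍ) :
    0 < 2 * a.im ^ 2 * b.im * c.im / (Complex.normSq (b - conj (a : ℂ)) *
      Complex.normSq (c - conj (a : ℂ))) := by
  have h1 := Complex.normSq_pos.2 (sub_conj_ne_zero a b)
  have h2 := Complex.normSq_pos.2 (sub_conj_ne_zero a c)
  have := a.im_pos
  have := b.im_pos
  have := c.im_pos
  positivity

lemma strictlyLeft_iff (a b c : ℍ) : StrictlyLeft a b c ↔ 0 < orient a b c := by
  unfold StrictlyLeft
  rw [im_conj_discChart_mul, mul_pos_iff_of_pos_left (im_conj_discChart_mul_factor_pos a b c)]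

lemma StrictlyLeft.cyclic {a b c : ℍ} (h : StrictlyLeft a b c) : StrictlyLeft b c a := by
  rw [strictlyLeft_iff] at *
  rwa [orient_cyclic]

lemma StrictlyLeft.not_swap {a b c : ℍ} (h : StrictlyLeft a b c) : ¬ StrictlyLeft a c b := by
  rw [strictlyLeft_iff] at *
  rw [orient_swap]; linarith

/-- Two distinct geodesics through `a` meet only in `a`. -/
lemma eq_of_orient_eq_zero {a b c z : ℍ} (h : StrictlyLeft a b c) (hb : orient a b z = 0)
    (hc : orient a c z = 0) : z = a := by
  rw [← discChart_eq_zero_iff]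
  have h1 := im_conj_discChart_mul a b z
  have h2 := im_conj_discChart_mul a c z
  rw [hb, mul_zero] at h1
  rw [hc, mul_zero] at h2
  unfold StrictlyLeft at h
  generalize discChart a b = B at *
  generalize discChart a c = C at *
  generalize discChart a z = Z at *
  simp only [Complex.mul_im, Complex.conj_re, Complex.conj_im] at h h1 h2
  have e1 : Z.re * (B.re * C.im + -B.im * C.re) = 0 := by linear_combination C.re * h1 - B.re * h2
  have e2 : Z.im * (B.re * C.im + -B.im * C.re) = 0 := by linear_combination C.im * h1 - B.im * h2
  apply Complex.ext
  · exact (mul_eq_zero.1 e1).resolve_right h.ne'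
  · exact (mul_eq_zero.1 e2).resolve_right h.ne'

/-- Points of a segment are positive combinations of its endpoints on the hyperboloid. -/
lemma coord_of_mem_segment {x y z : ℍ} (h : z ∈ segment x y) :
    Real.sinh (dist x y) * coordA z = Real.sinh (dist z y) * coordA x + Real.sinh (dist x z) * coordA y ∧
    Real.sinh (dist x y) * coordB z = Real.sinh (dist z y) * coordB x + Real.sinh (dist x z) * coordB y ∧
    Real.sinh (dist x y) * coordC z = Real.sinh (dist z y) * coordC x + Real.sinh (dist x z) * coordC y := by
  have hd : dist x z + dist z y = dist x y := h
  have cxy := cosh_dist_coord x y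
  have cxz := cosh_dist_coord x z
  have czy := cosh_dist_coord z y
  have qx := coord_quadric x
  have qy := coord_quadric y
  have qz := coord_quadric z
  have hxA := coordA_pos x
  rw [← hd] at cxy ⊢
  rw [Real.cosh_add] at cxy
  rw [Real.sinh_add]
  have iu := Real.cosh_sq (dist x z)
  have iv := Real.cosh_sq (dist z y)
  generalize Real.cosh (dist x z) = cu at *
  generalize Real.sinh (dist x z) = su at *
  generalize Real.cosh (dist z y) = cv at *
  generalize Real.sinh (dist z y) = sv at *
  generalize coordA x = x0 at *
  generalize coordB x = x1 at *
  generalize coordC x = x2 at *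
  generalize coordA y = y0 at *
  generalize coordB y = y1 at *
  generalize coordC y = y2 at *
  generalize coordA z = z0 at *
  generalize coordB z = z1 at *
  generalize coordC z = z2 at *
  -- The vector f is the difference of the two sides. It is orthogonal to x, y and z, hence null,
  -- being a combination of them; a null vector orthogonal to the timelike x is zero.
  obtain ⟨f0, hf0⟩ : ∃ f, f = (su * cv + cu * sv) * z0 - sv * x0 - su * y0 := ⟨_, rfl⟩
  obtain ⟨f1, hf1⟩ : ∃ f, f = (su * cv + cu * sv) * z1 - sv * x1 - su * y1 := ⟨_, rfl⟩
  obtain ⟨f2, hf2⟩ : ∃ f, f = (su * cv + cu * sv) * z2 - sv * x2 - su * y2 := ⟨_, rfl⟩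
  have ox : f0 * x2 + f2 * x0 - 2 * f1 * x1 = 0 := by
    rw [hf0, hf1, hf2]
    linear_combination (-2 * (su * cv + cu * sv)) * cxz - 2 * sv * qx + 2 * su * cxy +
      2 * sv * iu
  have oy : f0 * y2 + f2 * y0 - 2 * f1 * y1 = 0 := by
    rw [hf0, hf1, hf2]
    linear_combination (-2 * (su * cv + cu * sv)) * czy - 2 * su * qy + 2 * sv * cxy +
      2 * su * iv
  have oz : f0 * z2 + f2 * z0 - 2 * f1 * z1 = 0 := by
    rw [hf0, hf1, hf2]
    linear_combination (2 * (su * cv + cu * sv)) * qz + 2 * sv * cxz + 2 * su * czy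
  have off : f0 * f2 - f1 ^ 2 = 0 := by
    have : 2 * (f0 * f2 - f1 ^ 2) = 0 := by
      linear_combination (f2 * hf0 + f0 * hf2 - 2 * f1 * hf1) + (su * cv + cu * sv) * oz -
        sv * ox - su * oy
    linarith
  have hsq : (x0 * f1 - f0 * x1) ^ 2 + f0 ^ 2 = 0 := by
    linear_combination (-x0 ^ 2) * off + f0 * x0 * ox - f0 ^ 2 * qx
  have h0 : f0 = 0 := by
    have : f0 ^ 2 = 0 := by nlinarith [sq_nonneg (x0 * f1 - f0 * x1), sq_nonneg f0]
    simpa using this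
  have h1 : f1 = 0 := by
    rw [h0] at hsq
    have : (x0 * f1) ^ 2 = 0 := by linarith
    have := pow_eq_zero_iff two_ne_zero |>.1 this
    exact (mul_eq_zero.1 this).resolve_left hxA.ne'
  have h2 : f2 = 0 := by
    rw [h0, h1] at ox
    have : f2 * x0 = 0 := by linarith
    exact (mul_eq_zero.1 this).resolve_right hxA.ne'
  rw [h0] at hf0
  rw [h1] at hf1
  rw [h2] at hf2
  refine ⟨?_, ?_, ?_⟩ <;> linarith

lemma orient_of_mem_segment {x y z : ℍ} (h : z ∈ segment x y) (a b : ℍ) :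
    Real.sinh (dist x y) * orient a b z =
      Real.sinh (dist z y) * orient a b x + Real.sinh (dist x z) * orient a b y := by
  obtain ⟨h0, h1, h2⟩ := coord_of_mem_segment h
  unfold orient
  linear_combination (coordB a * coordC b - coordC a * coordB b) * h0 +
    (coordC a * coordA b - coordA a * coordC b) * h1 +
    (coordA a * coordB b - coordB a * coordA b) * h2

lemma segment_self {x z : ℍ} (h : z ∈ segment x x) : z = x := by
  have hd : dist x z + dist z x = dist x x := h
  rw [dist_self, dist_comm z x] at hd
  have : dist x z = 0 := by linarith [dist_nonneg (x := x) (y := z)]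
  exact (dist_eq_zero.1 this).symm

lemma geodConvex_halfPlane (a b : ℍ) : GeodConvex {z | 0 ≤ orient a b z} := by
  intro x hx y hy z hz
  rcases eq_or_ne x y with rfl | hxy
  · rw [segment_self hz]; exact hx
  · have h := orient_of_mem_segment hz a b
    have hs : 0 < Real.sinh (dist x y) := Real.sinh_pos_iff.2 (dist_pos.2 hxy)
    have h1 : 0 ≤ Real.sinh (dist z y) := Real.sinh_nonneg_iff.2 dist_nonneg
    have h2 : 0 ≤ Real.sinh (dist x z) := Real.sinh_nonneg_iff.2 dist_nonneg
    have h3 := add_nonneg (mul_nonneg h1 hx) (mul_nonneg h2 hy)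
    rw [← h] at h3
    exact nonneg_of_mul_nonneg_right h3 hs

/-- Distances along a segment. -/
lemma cosh_dist_of_mem_segment {x y z w : ℍ} (hxy : x ≠ y) (hz : z ∈ segment x y)
    (hw : w ∈ segment x y) : Real.cosh (dist z w) = Real.cosh (dist x z - dist x w) := by
  have hdz : dist x z + dist z y = dist x y := hz
  obtain ⟨a0, a1, a2⟩ := coord_of_mem_segment hz
  have cw := cosh_dist_coord x w
  have cwy := cosh_dist_coord y w
  have czw := cosh_dist_coord z w
  have hdw : dist x w + dist w y = dist x y := hw
  have hs : 0 < Real.sinh (dist x y) := Real.sinh_pos_iff.2 (dist_pos.2 hxy)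
  apply mul_left_cancel₀ hs.ne'
  rw [show dist z y = dist x y - dist x z by linarith] at a0 a1 a2
  rw [show dist y w = dist x y - dist x w by rw [dist_comm]; linarith] at cwy
  rw [Real.cosh_sub] at cwy ⊢
  rw [Real.sinh_sub] at a0 a1 a2
  have iD := Real.cosh_sq (dist x y)
  linear_combination Real.sinh (dist x y) * czw + a0 * (coordC w / 2) + a2 * (coordA w / 2) -
    a1 * coordB w - (Real.sinh (dist x y) * Real.cosh (dist x z) -
      Real.cosh (dist x y) * Real.sinh (dist x z)) * cw - Real.sinh (dist x z) * cwy

lemma left_mem_segment (x y : ℍ) : x ∈ segment x y := by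
  change dist x x + dist x y = dist x y; simp

lemma right_mem_segment (x y : ℍ) : y ∈ segment x y := by
  change dist x y + dist y y = dist x y; simp

/-- A segment determines its endpoints. -/
lemma endpoints_of_segment_eq {a b c d : ℍ} (hcd : c ≠ d) (h : segment a b = segment c d) :
    (a = c ∧ b = d) ∨ (a = d ∧ b = c) := by
  have ha : a ∈ segment c d := h ▸ left_mem_segment a b
  have hb : b ∈ segment c d := h ▸ right_mem_segment a b
  have hc : c ∈ segment a b := h ▸ left_mem_segment c d
  have hd : d ∈ segment a b := h ▸ right_mem_segment c d
  have e1 : dist c a + dist a d = dist c d := ha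
  have e2 : dist c b + dist b d = dist c d := hb
  have e3 : dist a c + dist c b = dist a b := hc
  have e4 : dist a d + dist d b = dist a b := hd
  have hcosh := cosh_dist_of_mem_segment hcd ha hb
  replace hcosh : |dist a b| = |dist c a - dist c b| :=
    le_antisymm (Real.cosh_le_cosh.1 hcosh.le) (Real.cosh_le_cosh.1 hcosh.ge)
  rw [dist_comm a c] at e3
  rw [dist_comm d b] at e4
  rw [abs_of_nonneg dist_nonneg] at hcosh
  rcases abs_choice (dist c a - dist c b) with h' | h'
  · right
    rw [h'] at hcosh
    have hb0 : dist c b = 0 := by linarith [dist_nonneg (x := c) (y := b)]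
    have ha0 : dist a d = 0 := by linarith
    exact ⟨dist_eq_zero.1 ha0, (dist_eq_zero.1 hb0).symm⟩
  · left
    rw [h'] at hcosh
    have ha0 : dist c a = 0 := by linarith [dist_nonneg (x := c) (y := a)]
    have hb0 : dist b d = 0 := by linarith
    exact ⟨(dist_eq_zero.1 ha0).symm, dist_eq_zero.1 hb0⟩

lemma subset_convHull (s : Set ℍ) : s ⊆ convHull s := Set.subset_sInter fun _ ht => ht.1

lemma convHull_subset {s t : Set ℍ} (h : s ⊆ t) (ht : GeodConvex t) : convHull s ⊆ t :=
  Set.sInter_subset_of_mem ⟨h, ht⟩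

lemma geodConvex_convHull (s : Set ℍ) : GeodConvex (convHull s) := by
  intro x hx y hy z hz t ht
  exact ht.2 x (Set.mem_sInter.1 hx t ht) y (Set.mem_sInter.1 hy t ht) hz

/-- A point which can be removed from the convex hull is one of the generators. -/
lemma mem_of_geodConvex_diff {s : Set ℍ} {e : ℍ} (he : e ∈ convHull s)
    (h : GeodConvex (convHull s \ {e})) : e ∈ s := by
  by_contra hes
  have : convHull s ⊆ convHull s \ {e} :=
    convHull_subset (fun x hx => ⟨subset_convHull s hx, fun h' => hes (h' ▸ hx)⟩) h
  exact (this he).2 rfl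

namespace ConvexPolygon

variable {n : ℕ}

lemma sub_one_ne (P : ConvexPolygon n) (i : ZMod n) : i - 1 ≠ i ∧ i - 1 ≠ i + 1 := by
  have h3 := P.three_le
  have : Fact (1 < n) := ⟨by omega⟩
  constructor
  · intro h
    have : (1 : ZMod n) = 0 := by linear_combination -h
    exact one_ne_zero this
  · intro h
    have h2 : ((2 : ℕ) : ZMod n) = 0 := by push_cast; linear_combination -h
    rw [ZMod.natCast_eq_zero_iff] at h2
    exact absurd (Nat.le_of_dvd (by norm_num) h2) (by omega)

lemma left_pred (P : ConvexPolygon n) (i : ZMod n) :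
    StrictlyLeft (P.vertex i) (P.vertex (i + 1)) (P.vertex (i - 1)) :=
  P.left_of_side i (i - 1) (P.sub_one_ne i).1 (P.sub_one_ne i).2

lemma orient_nonneg (P : ConvexPolygon n) (i j : ZMod n) :
    0 ≤ orient (P.vertex i) (P.vertex (i + 1)) (P.vertex j) := by
  by_cases h1 : j = i
  · rw [h1, orient_self_left]
  · by_cases h2 : j = i + 1
    · rw [h2, orient_self_right]
    · exact ((strictlyLeft_iff _ _ _).1 (P.left_of_side i j h1 h2)).le

lemma region_subset (P : ConvexPolygon n) (i : ZMod n) :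
    P.region ⊆ {z | 0 ≤ orient (P.vertex i) (P.vertex (i + 1)) z} :=
  convHull_subset (by rintro _ ⟨j, rfl⟩; exact P.orient_nonneg i j) (geodConvex_halfPlane _ _)

lemma vertex_mem_region (P : ConvexPolygon n) (i : ZMod n) : P.vertex i ∈ P.region :=
  subset_convHull _ ⟨i, rfl⟩

/-- A vertex is an extreme point: if it lies on a segment of the region with other endpoints, these
lie on both side lines through the vertex, since the region is on one side of each; but the two
lines meet only there. -/
lemma geodConvex_region_diff_vertex (P : ConvexPolygon n) (i : ZMod n) : GeodConvex (P.region \ {P.vertex i}) := by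
  rintro x ⟨hx, hxi⟩ y ⟨hy, hyi⟩ z hz
  refine ⟨geodConvex_convHull _ x hx y hy hz, fun hzi => ?_⟩
  rw [Set.mem_singleton_iff] at hzi
  subst hzi
  have hxi' : x ≠ P.vertex i := hxi
  have hyi' : y ≠ P.vertex i := hyi
  have hx1 : 0 < Real.sinh (dist x (P.vertex i)) := Real.sinh_pos_iff.2 (dist_pos.2 hxi')
  have hy1 : 0 < Real.sinh (dist (P.vertex i) y) := Real.sinh_pos_iff.2 (dist_pos.2 hyi'.symm)
  have key : ∀ j, orient (P.vertex j) (P.vertex (j + 1)) (P.vertex i) = 0 →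
      orient (P.vertex j) (P.vertex (j + 1)) x = 0 := by
    intro j hj
    have h := orient_of_mem_segment hz (P.vertex j) (P.vertex (j + 1))
    rw [hj, mul_zero] at h
    have h1 : 0 ≤ orient (P.vertex j) (P.vertex (j + 1)) x := P.region_subset j hx
    have h2 : 0 ≤ orient (P.vertex j) (P.vertex (j + 1)) y := P.region_subset j hy
    nlinarith [mul_nonneg hx1.le h2]
  have h1 := key i (orient_self_left _ _)
  have h2 := key (i - 1) (by rw [sub_add_cancel, orient_self_right])
  rw [sub_add_cancel, ← orient_cyclic, orient_swap, neg_eq_zero] at h2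
  exact hxi' (eq_of_orient_eq_zero (P.left_pred i) h1 h2)

lemma vertex_injective (P : ConvexPolygon n) : Function.Injective P.vertex := by
  intro i j hij
  by_contra hne
  by_cases h : j = i + 1
  · have := (strictlyLeft_iff _ _ _).1 (P.left_pred i)
    rw [← h, ← hij] at this
    have e : orient (P.vertex i) (P.vertex i) (P.vertex (i - 1)) = 0 := by unfold orient; ring
    linarith
  · have := (strictlyLeft_iff _ _ _).1 (P.left_of_side i j (Ne.symm hne) h)
    rw [← hij, orient_self_left] at this
    exact lt_irrefl _ this

end ConvexPolygon

end HyperbolicPlane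

/-! ### Oriented angles and Gauss–Bonnet -/

namespace HyperbolicPlane

open UpperHalfPlane ComplexConjugate

/-- The oriented angle at `a` from the ray through `b` to the ray through `c`. -/
noncomputable def ang (a b c : ℍ) : ℝ := (conj (discChart a b) * discChart a c).arg

lemma arg_pos_of_im_pos {z : ℂ} (hz : 0 < z.im) : 0 < z.arg := by
  rcases (Complex.arg_nonneg_iff.2 hz.le).lt_or_eq with h | h
  · exact h
  · exact absurd (Complex.arg_eq_zero_iff.1 h.symm).2 hz.ne'

lemma arg_lt_pi_of_im_pos {z : ℂ} (hz : 0 < z.im) : z.arg < Real.pi := by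
  rcases (Complex.arg_le_pi z).lt_or_eq with h | h
  · exact h
  · exact absurd (Complex.arg_eq_pi_iff.1 h).2 hz.ne'

lemma StrictlyLeft.ang_pos {a b c : ℍ} (h : StrictlyLeft a b c) : 0 < ang a b c :=
  arg_pos_of_im_pos h

lemma StrictlyLeft.ang_lt_pi {a b c : ℍ} (h : StrictlyLeft a b c) : ang a b c < Real.pi :=
  arg_lt_pi_of_im_pos h

lemma StrictlyLeft.discChart_ne_zero {a b c : ℍ} (h : StrictlyLeft a b c) :
    discChart a b ≠ 0 ∧ discChart a c ≠ 0 := by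
  unfold StrictlyLeft at h
  constructor <;> intro h0 <;> simp [h0] at h

lemma StrictlyLeft.angleAt_eq {a b c : ℍ} (h : StrictlyLeft a b c) : angleAt a c b = ang a b c := by
  obtain ⟨hb, hc⟩ := h.discChart_ne_zero
  have hpos := h.ang_pos
  unfold angleAt ang at *
  rw [Complex.angle_eq_abs_arg hc hb]
  have e : conj (discChart a b) * discChart a c =
      (Complex.normSq (discChart a b) : ℝ) * (discChart a c / discChart a b) := by
    rw [← Complex.mul_conj]; field_simp
  rw [e, Complex.arg_real_mul _ (Complex.normSq_pos.2 hb)] at hpos ⊢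
  exact abs_of_pos hpos

lemma ang_add {a b c d : ℍ} (h₁ : StrictlyLeft a b c) (h₂ : StrictlyLeft a c d)
    (h₃ : StrictlyLeft a b d) : ang a b c + ang a c d = ang a b d := by
  have p1 := h₁.ang_pos
  have p2 := h₂.ang_pos
  have p3 := h₃.ang_pos
  have l1 := h₁.ang_lt_pi
  have l2 := h₂.ang_lt_pi
  have l3 := h₃.ang_lt_pi
  refine eq_of_angle_eq ?_ (by linarith) (by linarith)
  obtain ⟨hb, hc⟩ := h₁.discChart_ne_zero
  obtain ⟨-, hd⟩ := h₃.discChart_ne_zero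
  have hb' := (map_ne_zero (starRingEnd ℂ)).2 hb
  have hc' := (map_ne_zero (starRingEnd ℂ)).2 hc
  unfold ang
  rw [Real.Angle.coe_add, ← Complex.arg_mul_coe_angle (mul_ne_zero hb' hc) (mul_ne_zero hc' hd)]
  rw [← Complex.arg_real_mul (conj (discChart a b) * discChart a d) (Complex.normSq_pos.2 hc)]
  congr 2
  rw [← Complex.mul_conj]; ring

lemma skew_swap {p q : ℂ} (hp : ‖p‖ < 1) (hq : ‖q‖ < 1) : skew q p = -skew p q := by
  have h := abs_arg_one_sub_lt (norm_conj_mul_lt_one hp hq)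
  have e : 1 - conj q * p = conj (1 - conj p * q) := by simp [mul_comm]
  unfold skew
  rw [e, Complex.arg_conj, if_neg]
  · ring
  · intro h'
    rw [h', abs_of_pos Real.pi_pos] at h
    linarith [Real.pi_pos]

/-- The skew of a triangle does not depend on the base point of the chart. -/
lemma skew_discChart (o a b c : ℍ) : skew (discChart a b) (discChart a c) =
    skew (discChart o a) (discChart o b) + skew (discChart o b) (discChart o c) +
      skew (discChart o c) (discChart o a) := by
  obtain ⟨u, hu, hchart⟩ := exists_discChart_eq o a
  have nb := norm_discChart_lt_one a b
  have nc := norm_discChart_lt_one a c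
  have nP := norm_discChart_lt_one o a
  have nQ := norm_discChart_lt_one o b
  have nR := norm_discChart_lt_one o c
  have hb := hchart b
  have hc := hchart c
  generalize discChart a b = B at *
  generalize discChart a c = C at *
  generalize discChart o a = P at *
  generalize discChart o b = Q at *
  generalize discChart o c = R at *
  have hPQ := one_sub_conj_mul_ne_zero nP nQ
  have hQP := one_sub_conj_mul_ne_zero nQ nP
  have hPR := one_sub_conj_mul_ne_zero nP nR
  have hQR := one_sub_conj_mul_ne_zero nQ nR
  have hBC := one_sub_conj_mul_ne_zero nb nc
  have huu : conj u * u = 1 := by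
    rw [← Complex.normSq_eq_conj_mul_self, Complex.normSq_eq_norm_sq, hu]; simp
  have hB : B * (1 - conj P * Q) = u * (Q - P) := by
    rw [hb, mul_assoc, div_mul_cancel₀ _ hPQ]
  have hC : C * (1 - conj P * R) = u * (R - P) := by
    rw [hc, mul_assoc, div_mul_cancel₀ _ hPR]
  have hBc := congrArg (starRingEnd ℂ) hB
  simp only [map_mul, map_sub, map_one, Complex.conj_conj] at hBc
  have key : (1 - conj B * C) * ((1 - conj Q * P) * (1 - conj P * R)) =
      ((1 - ‖P‖ ^ 2 : ℝ) : ℂ) * (1 - conj Q * R) := by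
    have hn : ((1 - ‖P‖ ^ 2 : ℝ) : ℂ) = 1 - conj P * P := by
      rw [← Complex.normSq_eq_norm_sq]; push_cast
      rw [Complex.normSq_eq_conj_mul_self]
    rw [hn]
    linear_combination -(C * (1 - conj P * R)) * hBc - (conj u * (conj Q - conj P)) * hC -
      (conj Q - conj P) * (R - P) * huu
  have harg := congrArg (fun z => (Complex.arg z : Real.Angle)) key
  rw [Complex.arg_real_mul _ (one_sub_sq_pos nP), Complex.arg_mul_coe_angle hBC
    (mul_ne_zero hQP hPR), Complex.arg_mul_coe_angle hQP hPR, ← Real.Angle.coe_add,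
    ← Real.Angle.coe_add] at harg
  have b1 := abs_lt.1 (abs_arg_one_sub_lt (norm_conj_mul_lt_one nb nc))
  have b2 := abs_lt.1 (abs_arg_one_sub_lt (norm_conj_mul_lt_one nQ nP))
  have b3 := abs_lt.1 (abs_arg_one_sub_lt (norm_conj_mul_lt_one nP nR))
  have b4 := abs_lt.1 (abs_arg_one_sub_lt (norm_conj_mul_lt_one nQ nR))
  have heq := eq_of_angle_eq harg (by linarith) (by linarith)
  have s1 := skew_swap nQ nP
  have s2 := skew_swap nP nR
  unfold skew at *
  linarith

lemma skew_pos_of_strictlyLeft {a b c : ℍ} (h : StrictlyLeft a b c) :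
    0 < skew (discChart a b) (discChart a c) := by
  have : (1 - conj (discChart a b) * discChart a c).arg < 0 := by
    rw [Complex.arg_neg_iff, Complex.sub_im, Complex.one_im]
    have : 0 < (conj (discChart a b) * discChart a c).im := h
    linarith
  unfold skew; linarith

/-- Gauss–Bonnet for a triangle, in the chart at one of its vertices. -/
lemma triangle_angle_sum_apex {a b c : ℍ} (h : StrictlyLeft a b c) :
    ang a b c + ang b c a + ang c a b = Real.pi - skew (discChart a b) (discChart a c) := by
  have hpi := Real.pi_pos
  have h2 := h.cyclic
  have h3 := h2.cyclic
  have p1 := h.ang_pos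
  have p2 := h2.ang_pos
  have p3 := h3.ang_pos
  have l1 := h.ang_lt_pi
  have l2 := h2.ang_lt_pi
  have l3 := h3.ang_lt_pi
  have nB := norm_discChart_lt_one a b
  have nC := norm_discChart_lt_one a c
  have hsk := skew_eq nB nC p1 l1
  obtain ⟨hB0, hC0⟩ := h.discChart_ne_zero
  obtain ⟨hbc0, hba0⟩ := h2.discChart_ne_zero
  obtain ⟨hca0, hcb0⟩ := h3.discChart_ne_zero
  have hβ0 : 0 < sideBeta (radial (discChart a b)) (radial (discChart a c)) (ang a b c / 2) :=
    sideBeta_pos (radial_pos nB) (radial_pos nC) (by linarith) (by linarith)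
  have hβ1 : sideBeta (radial (discChart a b)) (radial (discChart a c)) (ang a b c / 2) <
      Real.pi / 2 := Real.arctan_lt_pi_div_two _
  change skew _ _ = Real.pi - ang a b c - 2 * sideBeta _ _ (ang a b c / 2) at hsk
  obtain ⟨u, hu, hub⟩ := exists_discChart_eq a b
  obtain ⟨v, hv, hvc⟩ := exists_discChart_eq a c
  have haa : discChart a a = 0 := discChart_eq_zero_iff.2 rfl
  have e1 := hub c
  have e2 := hub a
  have e3 := hvc a
  have e4 := hvc b
  rw [haa, mul_zero, sub_zero, div_one, zero_sub] at e2 e3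
  have huu : conj u * u = 1 := by
    rw [← Complex.normSq_eq_conj_mul_self, Complex.normSq_eq_norm_sq, hu]; simp
  have hvv : conj v * v = 1 := by
    rw [← Complex.normSq_eq_conj_mul_self, Complex.normSq_eq_norm_sq, hv]; simp
  have hM := one_sub_conj_mul_ne_zero nB nC
  have hMc := one_sub_conj_mul_ne_zero nC nB
  have hne : discChart a c - discChart a b ≠ 0 := fun h0 => by
    rw [h0, zero_div, mul_zero] at e1
    exact hbc0 e1
  have e1' : discChart b c * (1 - conj (discChart a b) * discChart a c) =
      u * (discChart a c - discChart a b) := by rw [e1, mul_assoc, div_mul_cancel₀ _ hM]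
  have e4' : discChart c b * (1 - conj (discChart a c) * discChart a b) =
      v * (discChart a b - discChart a c) := by rw [e4, mul_assoc, div_mul_cancel₀ _ hMc]
  have e1c := congrArg (starRingEnd ℂ) e1'
  simp only [map_mul, map_sub, map_one, Complex.conj_conj] at e1c
  -- Taking arguments gives the angle sum modulo 2π: the two base angles and the skew on the left, π
  -- minus the apex angle on the right.
  have key : (conj (discChart b c) * discChart b a) * (conj (discChart c a) * discChart c b) *
      ((1 - conj (discChart a c) * discChart a b) * (1 - conj (discChart a c) * discChart a b)) =
      ((Complex.normSq (discChart a c - discChart a b) : ℝ) : ℂ) *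
        (-1 * conj (conj (discChart a b) * discChart a c)) := by
    rw [← Complex.mul_conj, e2, e3]
    simp only [map_mul, map_sub, map_neg, Complex.conj_conj]
    generalize discChart a b = B at *
    generalize discChart a c = C at *
    generalize discChart b c = D at *
    generalize discChart c b = F at *
    linear_combination (u * B * conj v * conj C * F * (1 - conj C * B)) * e1c +
      (u * B * conj v * conj C * conj u * (conj C - conj B)) * e4' +
      (B * conj C * (conj C - conj B) * (B - C)) * (huu * (conj v * v) + hvv)
  have harg := congrArg (fun z => (Complex.arg z : Real.Angle)) key
  have hX1 := mul_ne_zero ((map_ne_zero (starRingEnd ℂ)).2 hbc0) hba0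
  have hX2 := mul_ne_zero ((map_ne_zero (starRingEnd ℂ)).2 hca0) hcb0
  have hz := mul_ne_zero ((map_ne_zero (starRingEnd ℂ)).2 hB0) hC0
  rw [Complex.arg_mul_coe_angle (mul_ne_zero hX1 hX2) (mul_ne_zero hMc hMc),
    Complex.arg_mul_coe_angle hX1 hX2, Complex.arg_mul_coe_angle hMc hMc,
    Complex.arg_real_mul _ (Complex.normSq_pos.2 hne), Complex.arg_mul_coe_angle (by norm_num)
    ((map_ne_zero (starRingEnd ℂ)).2 hz), Complex.arg_conj_coe_angle, Complex.arg_neg_one,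
    ← Real.Angle.coe_add, ← Real.Angle.coe_add, ← Real.Angle.coe_add, ← Real.Angle.coe_neg,
    ← Real.Angle.coe_add] at harg
  change ((ang b c a + ang c a b + _ : ℝ) : Real.Angle) = ((Real.pi + -ang a b c : ℝ) : Real.Angle)
    at harg
  have hs := skew_swap nB nC
  have hs' : (1 - conj (discChart a c) * discChart a b).arg =
      skew (discChart a b) (discChart a c) / 2 := by
    unfold skew at hs ⊢; linarith
  rw [hs'] at harg
  linarith [eq_of_angle_eq harg (by linarith) (by linarith)]

/-- Gauss–Bonnet for a triangle. -/
lemma triangle_angle_sum (o : ℍ) {a b c : ℍ} (h : StrictlyLeft a b c) :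
    ang a b c + ang b c a + ang c a b = Real.pi - (skew (discChart o a) (discChart o b) +
      skew (discChart o b) (discChart o c) + skew (discChart o c) (discChart o a)) := by
  rw [triangle_angle_sum_apex h, skew_discChart o]

/-- Gauss–Bonnet for a fan of triangles with apex `v 0`. -/
lemma fan_angle_sum (o : ℍ) {v : ℕ → ℍ} {N : ℕ}
    (h₀ : ∀ i, 1 ≤ i → i + 1 < N → StrictlyLeft (v i) (v (i + 1)) (v 0))
    (h₁ : ∀ i, 2 ≤ i → i < N → StrictlyLeft (v 0) (v 1) (v i))
    (h₂ : ∀ i, i + 2 < N → StrictlyLeft (v (i + 1)) (v (i + 2)) (v i)) (t : ℕ) (ht : t + 2 < N) :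
    ang (v 0) (v 1) (v (t + 2)) + ∑ i ∈ Finset.range (t + 1), ang (v (i + 1)) (v (i + 2)) (v i) +
      ang (v (t + 2)) (v 0) (v (t + 1)) = (t + 1) * Real.pi -
      (∑ i ∈ Finset.range (t + 2), skew (discChart o (v i)) (discChart o (v (i + 1))) +
        skew (discChart o (v (t + 2))) (discChart o (v 0))) ∧
    0 < ∑ i ∈ Finset.range (t + 2), skew (discChart o (v i)) (discChart o (v (i + 1))) +
        skew (discChart o (v (t + 2))) (discChart o (v 0)) := by
  induction t with
  | zero =>
    have h := h₁ 2 le_rfl ht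
    have h1 := triangle_angle_sum o h
    have h2 := skew_discChart o (v 0) (v 1) (v 2)
    have h3 := skew_pos_of_strictlyLeft h
    simp only [Finset.sum_range_succ, Finset.sum_range_zero, zero_add, Nat.cast_zero, one_mul,
      Nat.reduceAdd]
    constructor <;> linarith
  | succ t ih =>
    obtain ⟨ih1, ih2⟩ := ih (by omega)
    -- The fan gains the triangle v 0, v (t+2), v (t+3). Its angles add to the old ones at v 0
    -- (`g4`) and v (t+2) (`g5`), and the skews along the shared diagonal cancel (`g6`).
    have hT := (h₀ (t + 2) (by omega) (by omega)).cyclic.cyclic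
    have g1 := triangle_angle_sum o hT
    have g2 := skew_discChart o (v 0) (v (t + 2)) (v (t + 2 + 1))
    have g3 := skew_pos_of_strictlyLeft hT
    have g4 := ang_add (h₁ (t + 2) (by omega) (by omega)) hT (h₁ (t + 2 + 1) (by omega) (by omega))
    have g5 := ang_add hT.cyclic (h₀ (t + 1) (by omega) (by omega)).cyclic (h₂ (t + 1) (by omega))
    have g6 := skew_swap (norm_discChart_lt_one o (v (t + 2))) (norm_discChart_lt_one o (v 0))
    rw [Finset.sum_range_succ _ (t + 1), Finset.sum_range_succ _ (t + 2)]
    rw [show t + 1 + 2 = t + 2 + 1 from rfl, show t + 1 + 1 = t + 2 from rfl] at *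
    push_cast
    constructor <;> linarith

namespace ConvexPolygon

variable {n : ℕ}

lemma angle_eq_ang (P : ConvexPolygon n) (i : ZMod n) :
    P.angle i = ang (P.vertex i) (P.vertex (i + 1)) (P.vertex (i - 1)) :=
  (P.left_pred i).angleAt_eq

lemma natCast_ne {i j : ℕ} (hi : i < n) (hj : j < n) (h : i ≠ j) : (i : ZMod n) ≠ (j : ZMod n) := by
  intro h'
  rw [ZMod.natCast_eq_natCast_iff', Nat.mod_eq_of_lt hi, Nat.mod_eq_of_lt hj] at h'
  exact h h'

/-- Gauss–Bonnet for a convex polygon. -/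
theorem sum_angle_eq (P : ConvexPolygon n) (o : ℍ) :
    ∑ i ∈ Finset.range n, P.angle (i : ZMod n) = ((n : ℝ) - 2) * Real.pi -
      ∑ i ∈ Finset.range n, skew (discChart o (P.vertex (i : ZMod n)))
        (discChart o (P.vertex ((i + 1 : ℕ) : ZMod n))) ∧
    0 < ∑ i ∈ Finset.range n, skew (discChart o (P.vertex (i : ZMod n)))
        (discChart o (P.vertex ((i + 1 : ℕ) : ZMod n))) := by
  obtain ⟨t, rfl⟩ : ∃ t, n = t + 3 := ⟨n - 3, by have := P.three_le; omega⟩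
  have hleft : ∀ i j : ℕ, i + 1 < t + 3 → j < t + 3 → j ≠ i → j ≠ i + 1 →
      StrictlyLeft (P.vertex (i : ZMod (t + 3))) (P.vertex ((i + 1 : ℕ) : ZMod (t + 3)))
        (P.vertex (j : ZMod (t + 3))) := fun i j hi hj h1 h2 => by
    have h3 := natCast_ne hj (by omega : i < t + 3) h1
    have h4 := natCast_ne hj hi h2
    push_cast at h4 ⊢
    exact P.left_of_side i j h3 h4
  obtain ⟨k1, k2⟩ := fan_angle_sum o (v := fun i => P.vertex (i : ZMod (t + 3))) (N := t + 3)
    (fun i h1 h2 => hleft i 0 h2 (by omega) (by omega) (by omega))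
    (fun i h1 h2 => hleft 0 i (by omega) h2 (by omega) (by omega))
    (fun i h => hleft (i + 1) i (by omega) (by omega) (by omega) (by omega)) t (by omega)
  have hzero : ((t + 2 + 1 : ℕ) : ZMod (t + 3)) = ((0 : ℕ) : ZMod (t + 3)) := by
    rw [Nat.cast_zero]; exact ZMod.natCast_self (t + 3)
  have hs : ∑ i ∈ Finset.range (t + 3), skew (discChart o (P.vertex (i : ZMod (t + 3))))
        (discChart o (P.vertex ((i + 1 : ℕ) : ZMod (t + 3)))) =
      ∑ i ∈ Finset.range (t + 2), skew (discChart o (P.vertex (i : ZMod (t + 3))))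
        (discChart o (P.vertex ((i + 1 : ℕ) : ZMod (t + 3)))) +
      skew (discChart o (P.vertex ((t + 2 : ℕ) : ZMod (t + 3))))
        (discChart o (P.vertex ((0 : ℕ) : ZMod (t + 3)))) := by
    rw [Finset.sum_range_succ _ (t + 2), hzero]
  rw [hs]
  refine ⟨?_, k2⟩
  have ha : ∑ i ∈ Finset.range (t + 3), P.angle (i : ZMod (t + 3)) =
      ang (P.vertex ((0 : ℕ) : ZMod (t + 3))) (P.vertex ((1 : ℕ) : ZMod (t + 3)))
        (P.vertex ((t + 2 : ℕ) : ZMod (t + 3))) +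
      ∑ i ∈ Finset.range (t + 1), ang (P.vertex ((i + 1 : ℕ) : ZMod (t + 3)))
        (P.vertex ((i + 2 : ℕ) : ZMod (t + 3))) (P.vertex (i : ZMod (t + 3))) +
      ang (P.vertex ((t + 2 : ℕ) : ZMod (t + 3))) (P.vertex ((0 : ℕ) : ZMod (t + 3)))
        (P.vertex ((t + 1 : ℕ) : ZMod (t + 3))) := by
    rw [Finset.sum_range_succ _ (t + 2), Finset.sum_range_succ' _ (t + 1)]
    simp only [angle_eq_ang]
    rw [add_comm (∑ i ∈ Finset.range (t + 1), _) (ang _ _ _)]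
    congr 1
    · congr 1
      refine Finset.sum_congr rfl fun i _ => ?_
      congr 2 <;> push_cast <;> ring
    · congr 2
      · rw [← hzero]; push_cast; ring
      · push_cast; ring
  rw [ha, k1]
  push_cast; ring

end ConvexPolygon

end HyperbolicPlane

/-! ### Half-turns, side-pairing translations and their lengths -/

namespace HyperbolicPlane

open UpperHalfPlane ComplexConjugate

lemma coe_smul_mul (g : Matrix.SpecialLinearGroup (Fin 2) ℝ) (z : ℍ) :
    ((g • z : ℍ) : ℂ) * ((g 1 0 : ℝ) * z + (g 1 1 : ℝ)) = (g 0 0 : ℝ) * z + (g 0 1 : ℝ) ∧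
      ((g 1 0 : ℝ) : ℂ) * z + (g 1 1 : ℝ) ≠ 0 := by
  have hdet := Matrix.SpecialLinearGroup.det_coe g
  rw [Matrix.det_fin_two] at hdet
  have hne : ((g 1 0 : ℝ) : ℂ) * z + (g 1 1 : ℝ) ≠ 0 := by
    intro h
    have h1 := congrArg Complex.im h
    have h2 := congrArg Complex.re h
    simp at h1 h2
    rcases h1 with h1 | h1
    · rw [h1, zero_mul, zero_add] at h2
      rw [h1, h2] at hdet
      simp at hdet
    · exact z.im_ne_zero h1
  refine ⟨?_, hne⟩
  rw [coe_specialLinearGroup_apply]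
  exact div_mul_cancel₀ _ hne

lemma discChart_injective (o : ℍ) : Function.Injective (discChart o) := by
  intro z w h
  unfold discChart at h
  rw [div_eq_div_iff (sub_conj_ne_zero o z) (sub_conj_ne_zero o w)] at h
  have h5 : (o : ℂ) - conj (o : ℂ) ≠ 0 := sub_conj_ne_zero o o
  apply UpperHalfPlane.ext
  apply mul_right_cancel₀ h5
  linear_combination h

/-- The half-turn about `o`. -/
noncomputable def halfTurn (o : ℍ) : Matrix.SpecialLinearGroup (Fin 2) ℝ :=
  ⟨!![o.re / o.im, -(o.re ^ 2 + o.im ^ 2) / o.im; 1 / o.im, -o.re / o.im], by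
    have := o.im_ne_zero
    rw [Matrix.det_fin_two_of]; field_simp; ring⟩

lemma discChart_halfTurn (o z : ℍ) : discChart o (halfTurn o • z) = -discChart o z := by
  obtain ⟨h, hne⟩ := coe_smul_mul (halfTurn o) z
  have h1 := sub_conj_ne_zero o z
  have h2 := sub_conj_ne_zero o (halfTurn o • z)
  unfold discChart
  generalize ((halfTurn o • z : ℍ) : ℂ) = w at *
  rw [← neg_div, div_eq_div_iff h2 h1]
  simp only [halfTurn, Matrix.SpecialLinearGroup.coe_mk, Matrix.of_apply, Matrix.cons_val', Matrix.cons_val_zero,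
    Matrix.cons_val_one, Matrix.cons_val_fin_one] at h hne
  have hy : (o.im : ℂ) ≠ 0 := by exact_mod_cast o.im_ne_zero
  have ho : (o : ℂ) = o.re + o.im * Complex.I := (Complex.re_add_im (o : ℂ)).symm
  have hoc : conj (o : ℂ) = o.re - o.im * Complex.I := by
    conv_lhs => rw [ho]
    simp [sub_eq_add_neg]
  have h' : w * (z - o.re) = o.re * z - (o.re ^ 2 + o.im ^ 2) := by
    push_cast at h
    field_simp at h
    linear_combination h
  rw [hoc, ho]
  linear_combination 2 * h' - 2 * o.im ^ 2 * Complex.I_sq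

lemma halfTurn_smul_smul (o z : ℍ) : halfTurn o • (halfTurn o • z) = z :=
  discChart_injective o (by rw [discChart_halfTurn, discChart_halfTurn, neg_neg])

lemma StrictlyLeft.halfTurn {o a b c : ℍ} (h : StrictlyLeft a b c) :
    StrictlyLeft (halfTurn o • a) (halfTurn o • b) (halfTurn o • c) := by
  obtain ⟨u, hu, hua⟩ := exists_discChart_eq o a
  obtain ⟨v, hv, hva⟩ := exists_discChart_eq o (HyperbolicPlane.halfTurn o • a)
  unfold StrictlyLeft at *
  rw [hua, hua] at h
  rw [hva, hva]
  simp only [discChart_halfTurn, map_neg, neg_mul_neg]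
  have huu : conj u * u = 1 := by
    rw [← Complex.normSq_eq_conj_mul_self, Complex.normSq_eq_norm_sq, hu]; simp
  have hvv : conj v * v = 1 := by
    rw [← Complex.normSq_eq_conj_mul_self, Complex.normSq_eq_norm_sq, hv]; simp
  convert h using 2
  simp only [map_mul, map_div₀, map_sub, map_neg]
  rw [show ∀ x y : ℂ, conj v * x * (v * y) = (conj v * v) * (x * y) by intros; ring,
    show ∀ x y : ℂ, conj u * x * (u * y) = (conj u * u) * (x * y) by intros; ring, huu, hvv]
  ring

lemma smul_image_segment (g : Matrix.SpecialLinearGroup (Fin 2) ℝ) (x y : ℍ) :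
    (fun z : ℍ => g • z) '' segment x y = segment (g • x) (g • y) := by
  ext z
  constructor
  · rintro ⟨w, hw, rfl⟩
    change dist (g • x) (g • w) + dist (g • w) (g • y) = dist (g • x) (g • y)
    rw [dist_smul, dist_smul, dist_smul]
    exact hw
  · intro hz
    refine ⟨g⁻¹ • z, ?_, smul_inv_smul g z⟩
    change dist x (g⁻¹ • z) + dist (g⁻¹ • z) y = dist x y
    rw [← dist_smul g x, ← dist_smul g (g⁻¹ • z), ← dist_smul g x y, smul_inv_smul]
    exact hz

/-- The action of `SL(2, ℝ)` in the disc chart. -/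
lemma exists_disc_action (o : ℍ) (g : Matrix.SpecialLinearGroup (Fin 2) ℝ) :
    ∃ α β : ℂ, α * conj α - β * conj β = 1 ∧ α + conj α = ((g 0 0 + g 1 1 : ℝ) : ℂ) ∧
      ∀ z : ℍ, discChart o (g • z) * (conj β * discChart o z + conj α) =
        α * discChart o z + β := by
  have hy : (o : ℂ) - conj (o : ℂ) ≠ 0 := sub_conj_ne_zero o o
  have hy' : conj (o : ℂ) - (o : ℂ) ≠ 0 := by rw [← neg_sub]; exact neg_ne_zero.2 hy
  have hdet := Matrix.SpecialLinearGroup.det_coe g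
  rw [Matrix.det_fin_two] at hdet
  have hdet' : ((g 0 0 : ℝ) : ℂ) * (g 1 1 : ℝ) - (g 0 1 : ℝ) * (g 1 0 : ℝ) = 1 := by
    exact_mod_cast hdet
  have haction := coe_smul_mul g
  have hsub := fun z => sub_conj_ne_zero o z
  have hcda : conj ((g 0 0 : ℝ) : ℂ) = (g 0 0 : ℝ) := Complex.conj_ofReal _
  have hcdb : conj ((g 0 1 : ℝ) : ℂ) = (g 0 1 : ℝ) := Complex.conj_ofReal _
  have hcdc : conj ((g 1 0 : ℝ) : ℂ) = (g 1 0 : ℝ) := Complex.conj_ofReal _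
  have hcdd : conj ((g 1 1 : ℝ) : ℂ) = (g 1 1 : ℝ) := Complex.conj_ofReal _
  unfold discChart
  rw [Complex.ofReal_add]
  generalize ((g 0 0 : ℝ) : ℂ) = a at *
  generalize ((g 0 1 : ℝ) : ℂ) = b at *
  generalize ((g 1 0 : ℝ) : ℂ) = c at *
  generalize ((g 1 1 : ℝ) : ℂ) = d at *
  have hoo := Complex.conj_conj (o : ℂ)
  generalize conj (o : ℂ) = o' at *
  generalize (o : ℂ) = q at *
  -- The entries of g conjugated into SU(1,1) by the disc chart at o.
  obtain ⟨α, hα⟩ : ∃ α, α = (-a * o' + c * q * o' - b + q * d) / (q - o') := ⟨_, rfl⟩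
  obtain ⟨β, hβ⟩ : ∃ β, β = (a * q - c * q ^ 2 + b - q * d) / (q - o') := ⟨_, rfl⟩
  have ho' : conj q = o' := by
    rw [← hoo, Complex.conj_conj]
  have hαc : conj α = (a * q - c * q * o' + b - o' * d) / (q - o') := by
    rw [hα]
    simp only [map_div₀, map_add, map_sub, map_mul, map_neg, hcda, hcdb, hcdc, hcdd, ho', hoo]
    rw [div_eq_div_iff hy' hy]; ring
  have hβc : conj β = -(a * o' - c * o' ^ 2 + b - o' * d) / (q - o') := by
    rw [hβ]
    simp only [map_div₀, map_add, map_sub, map_mul, map_pow, hcda, hcdb, hcdc, hcdd, ho', hoo]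
    rw [div_eq_div_iff hy' hy]; ring
  refine ⟨α, β, ?_, ?_, fun z => ?_⟩
  · rw [hαc, hβc, hα, hβ, div_mul_div_comm, div_mul_div_comm, ← sub_div,
      div_eq_one_iff_eq (mul_ne_zero hy hy)]
    linear_combination (q - o') ^ 2 * hdet'
  · rw [hαc, hα, ← add_div, div_eq_iff hy]; ring
  · obtain ⟨h1, h2⟩ := haction z
    have h3 := hsub z
    have h4 := hsub (g • z)
    generalize ((g • z : ℍ) : ℂ) = w at *
    generalize (z : ℂ) = z at *
    have e1 : α * ((z - q) / (z - o')) + β = ((a * z + b) - q * (c * z + d)) / (z - o') := by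
      rw [hα, hβ]; field_simp; ring
    have e2 : conj β * ((z - q) / (z - o')) + conj α =
        ((a * z + b) - o' * (c * z + d)) / (z - o') := by
      rw [hαc, hβc]; field_simp; ring
    rw [e1, e2, ← h1, ← sub_mul, ← sub_mul]
    field_simp

/-- The midpoint datum of a hyperbolic element exchanging the side `p q` with its antipode. -/
lemma exists_sideRel_of_action {p q α β : ℂ} {t : ℝ} (hp : ‖p‖ < 1) (hq : ‖q‖ < 1) (hpq : p ≠ q)
    (hdet : α * conj α - β * conj β = 1) (htr : α + conj α = (t : ℂ)) (ht : 0 < t ^ 2 - 4)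
    (h : (-p * (conj β * p + conj α) = α * p + β ∧ -q * (conj β * q + conj α) = α * q + β) ∨
      (-q * (conj β * p + conj α) = α * p + β ∧ -p * (conj β * q + conj α) = α * q + β)) :
    ∃ K, ‖K‖ < 1 ∧ SideRel K p q ∧ t ^ 2 * (1 - ‖K‖ ^ 2) = 4 := by
  have hpq' : p - q ≠ 0 := sub_ne_zero.2 hpq
  rcases h with ⟨h1, h2⟩ | ⟨h1, h2⟩
  -- Here p ↦ -p and q ↦ -q: z ↦ -g z would fix two points of the disc, which forces β = 0 and trace
  -- 0, so g is not hyperbolic.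
  · exfalso
    have e1 : conj β * (p + q) + t = 0 := by
      apply mul_right_cancel₀ hpq'
      rw [← htr]; linear_combination h2 - h1
    have e2 : β = conj β * (p * q) := by
      linear_combination -h1 - p * e1 - p * htr
    have e3 := congrArg norm e2
    rw [norm_mul, Complex.norm_conj, norm_mul] at e3
    have : ‖p‖ * ‖q‖ < 1 := by nlinarith [norm_nonneg p, norm_nonneg q]
    have h0 : ‖β‖ = 0 := by nlinarith [norm_nonneg β]
    rw [norm_eq_zero] at h0
    rw [h0, map_zero, zero_mul, zero_add] at e1
    have : t = 0 := by exact_mod_cast e1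
    rw [this] at ht; norm_num at ht
  · have e1 : conj α = α := by
      apply mul_right_cancel₀ hpq'
      linear_combination h1 - h2
    obtain ⟨r, hr⟩ : ∃ r : ℝ, α = r := (Complex.conj_eq_iff_real).1 e1
    rw [hr, Complex.conj_ofReal, Complex.mul_conj, Complex.normSq_eq_norm_sq] at hdet
    have hdet' : r * r - ‖β‖ ^ 2 = 1 := by exact_mod_cast hdet
    rw [e1, hr] at htr
    have htr' : r + r = t := by exact_mod_cast htr
    have hr0 : r ≠ 0 := by rintro rfl; nlinarith [sq_nonneg ‖β‖]
    have hrc : (r : ℂ) ≠ 0 := by exact_mod_cast hr0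
    have hKn : ‖-β / r‖ ^ 2 = 1 - 1 / r ^ 2 := by
      rw [norm_div, norm_neg, Complex.norm_real, div_pow, Real.norm_eq_abs, sq_abs]
      field_simp; linarith
    have hr2 : 0 < 1 / r ^ 2 := by positivity
    -- The image of 0 under z ↦ -g z, α = r being real.
    refine ⟨-β / r, ?_, ?_, ?_⟩
    · exact (sq_lt_one_iff₀ (norm_nonneg _)).1 (by linarith)
    · unfold SideRel
      rw [map_div₀, map_neg, Complex.conj_ofReal]
      field_simp
      rw [e1, hr] at h1
      linear_combination h1
    · rw [hKn, ← htr']; field_simp; ring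

/-- The difference of the two sides is a positive multiple of the square of c|z|² + (d - a) Re z -
b, whose zero set is the axis when g is hyperbolic. -/
lemma cosh_dist_smul_ge (g : Matrix.SpecialLinearGroup (Fin 2) ℝ) (z : ℍ) :
    (g 0 0 + g 1 1) ^ 2 / 2 - 1 ≤ Real.cosh (dist z (g • z)) := by
  obtain ⟨h, hne⟩ := coe_smul_mul g z
  have hdet := Matrix.SpecialLinearGroup.det_coe g
  rw [Matrix.det_fin_two] at hdet
  rw [UpperHalfPlane.cosh_dist, Complex.dist_eq, ← Complex.normSq_eq_norm_sq, Complex.normSq_apply]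
  have hz := z.im_pos
  have hw := (g • z).im_pos
  have hn := Complex.normSq_pos.2 hne
  have h1 := congrArg Complex.re h
  have h2 := congrArg Complex.im h
  rw [Complex.normSq_apply] at hn
  simp only [Complex.add_re, Complex.mul_re, Complex.add_im, Complex.mul_im, Complex.ofReal_re,
    Complex.ofReal_im, Complex.sub_re, Complex.sub_im, UpperHalfPlane.coe_re,
    UpperHalfPlane.coe_im] at h1 h2 hn ⊢
  generalize (g • z).im = v at *
  generalize (g • z).re = u at *
  generalize z.im = y at *
  generalize z.re = x at *
  change (g 0 0) * (g 1 1) - (g 0 1) * (g 1 0) = 1 at hdet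
  generalize g 0 0 = a at *
  generalize g 0 1 = b at *
  generalize g 1 0 = c at *
  generalize g 1 1 = d at *
  suffices ((a + d) ^ 2 - 4) / 2 ≤
      ((x - u) * (x - u) + (y - v) * (y - v)) / (2 * y * v) by linarith
  rw [div_le_div_iff₀ two_pos (by positivity)]
  obtain ⟨D, hD⟩ : ∃ D, D = (c * x + d) ^ 2 + (c * y) ^ 2 := ⟨_, rfl⟩
  have hDp : 0 < D := by rw [hD]; linarith
  have hv : v * D = y := by
    rw [hD]; linear_combination (c * x + d) * h2 - (c * y) * h1 + y * hdet
  have hu : u * D = (a * x + b) * (c * x + d) + a * y * (c * y) := by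
    rw [hD]; linear_combination (c * x + d) * h1 + (c * y) * h2
  have hmod : ((x - u) * (x - u) + (y - v) * (y - v)) * D =
      (c * (x ^ 2 - y ^ 2) + (d - a) * x - b) ^ 2 + (2 * c * x * y + (d - a) * y) ^ 2 := by
    apply mul_right_cancel₀ hDp.ne'
    have : ((x - u) * (x - u) + (y - v) * (y - v)) * D * D =
        (x * D - u * D) ^ 2 + (y * D - v * D) ^ 2 := by ring
    rw [this, hu, hv, hD]
    linear_combination y ^ 2 * (2 * ((c * x + d) ^ 2 + (c * y) ^ 2) - 1 - (a * d - b * c)) * hdet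
  apply le_of_mul_le_mul_right _ hDp
  have hsq : 0 ≤ (c * x ^ 2 + (d - a) * x - b + c * y ^ 2) ^ 2 := sq_nonneg _
  have e : ((x - u) * (x - u) + (y - v) * (y - v)) * 2 * D - ((a + d) ^ 2 - 4) * (2 * y * v) * D =
      2 * (c * x ^ 2 + (d - a) * x - b + c * y ^ 2) ^ 2 := by
    linear_combination 2 * hmod - ((a + d) ^ 2 - 4) * 2 * y * hv - 8 * y ^ 2 * hdet
  linarith

/-- The trace is ±2cosh(ℓ/2), so k is tanh(ℓ/2) and log((1+k)/(1-k)) is ℓ; only the lower bound for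
the translation length is needed. -/
lemma one_div_one_add_exp_le {g : Matrix.SpecialLinearGroup (Fin 2) ℝ} {k : ℝ} (hk : 0 ≤ k)
    (hk1 : k < 1) (h : (g 0 0 + g 1 1) ^ 2 * (1 - k ^ 2) = 4) :
    1 / (1 + Real.exp (translationLength g)) ≤ (1 - k) / 2 := by
  have h1 : 0 < 1 - k := by linarith
  have h2 : 0 < 1 - k ^ 2 := by nlinarith
  have hx : 0 < (1 + k) / (1 - k) := by positivity
  have hL : Real.log ((1 + k) / (1 - k)) ≤ translationLength g := by
    unfold translationLength
    refine le_ciInf fun z => ?_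
    have hc := cosh_dist_smul_ge g z
    have e : Real.cosh (Real.log ((1 + k) / (1 - k))) = (g 0 0 + g 1 1) ^ 2 / 2 - 1 := by
      rw [Real.cosh_log hx, show (g 0 0 + g 1 1) ^ 2 = 4 / (1 - k ^ 2) by
        rw [eq_div_iff h2.ne']; exact h]
      rw [show 1 - k ^ 2 = (1 - k) * (1 + k) by ring]
      field_simp; ring
    rw [← e, Real.cosh_le_cosh, abs_of_nonneg dist_nonneg] at hc
    exact (le_abs_self _).trans hc
  have hexp := Real.exp_le_exp.2 hL
  rw [Real.exp_log hx, div_le_iff₀ h1] at hexp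
  rw [div_le_div_iff₀ (by positivity) two_pos]
  linarith

namespace ConvexPolygon

variable {n : ℕ}

/-- A half-turn preserving the polygon permutes its vertices. -/
lemma exists_halfTurn_vertex_eq (P : ConvexPolygon n) {o : ℍ}
    (h : ∀ z ∈ P.region, halfTurn o • z ∈ P.region) (i : ZMod n) :
    ∃ j, halfTurn o • P.vertex i = P.vertex j := by
  have hmem := h _ (P.vertex_mem_region i)
  have hconv : GeodConvex (P.region \ {halfTurn o • P.vertex i}) := by
    rintro x ⟨hx, hxi⟩ y ⟨hy, hyi⟩ z hz
    refine ⟨geodConvex_convHull _ x hx y hy hz, fun hzi => ?_⟩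
    rw [Set.mem_singleton_iff] at hzi hxi hyi
    have hne : ∀ w, w ≠ halfTurn o • P.vertex i → halfTurn o • w ≠ P.vertex i := by
      intro w hw hw'
      rw [← hw', halfTurn_smul_smul] at hw
      exact hw rfl
    have hseg : halfTurn o • z ∈ segment (halfTurn o • x) (halfTurn o • y) := by
      rw [← smul_image_segment]; exact ⟨z, hz, rfl⟩
    have := P.geodConvex_region_diff_vertex i _ ⟨h x hx, hne x hxi⟩ _ ⟨h y hy, hne y hyi⟩ hseg
    exact this.2 (by rw [hzi, halfTurn_smul_smul]; rfl)
  obtain ⟨j, hj⟩ := mem_of_geodConvex_diff hmem hconv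
  exact ⟨j, hj.symm⟩

/-- The centre of symmetry, in terms of vertices. -/
lemma CentrallySymmetric.exists_centre {m : ℕ} {P : ConvexPolygon (2 * m)}
    (hP : P.CentrallySymmetric) : ∃ o : ℍ, ∀ i : ZMod (2 * m),
      discChart o (P.vertex (i + (m : ZMod (2 * m)))) = -discChart o (P.vertex i) := by
  obtain ⟨o, ho⟩ := hP
  have h3 := P.three_le
  have hreg : ∀ z ∈ P.region, halfTurn o • z ∈ P.region := fun z hz =>
    ho z _ (discChart_halfTurn o z) hz
  choose σ hσ using P.exists_halfTurn_vertex_eq hreg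
  have hσσ : ∀ i, σ (σ i) = i := fun i => P.vertex_injective (by
    rw [← hσ, ← hσ, halfTurn_smul_smul])
  -- Half-turns preserve orientation. If σ (i + 1) and σ i + 1 differed, each of these two vertices
  -- would lie to the left of the line from vertex σ i through the other.
  have hsucc : ∀ i, σ (i + 1) = σ i + 1 := by
    intro i
    by_contra hne
    have hii : i + 1 ≠ i := by
      have := (P.sub_one_ne (i + 1)).1
      rw [add_sub_cancel_right] at this
      exact this.symm
    have hk : σ (i + 1) ≠ σ i := fun h => hii (by rw [← hσσ (i + 1), h, hσσ])
    have hl1 : σ (σ i + 1) ≠ i + 1 := fun h => hne (by rw [← h, hσσ])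
    have hl2 : σ (σ i + 1) ≠ i := fun h => by
      have h' : σ i + 1 = σ i := by rw [← hσσ (σ i + 1), h]
      have := (P.sub_one_ne (σ i + 1)).1
      rw [add_sub_cancel_right] at this
      exact this h'.symm
    have h1 := (P.left_of_side i (σ (σ i + 1)) hl2 hl1).halfTurn (o := o)
    rw [hσ, hσ, hσ, hσσ] at h1
    exact h1.not_swap (P.left_of_side (σ i) (σ (i + 1)) hk hne)
  have hadd : ∀ j : ℕ, σ (j : ZMod (2 * m)) = σ 0 + j := by
    intro j
    induction j with
    | zero => simp
    | succ j ih => push_cast; rw [hsucc, ih]; ring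
  have : NeZero (2 * m) := ⟨by omega⟩
  have hadd' : ∀ i : ZMod (2 * m), σ i = σ 0 + i := fun i => by
    have := hadd i.val
    rwa [ZMod.natCast_zmod_val] at this
  -- The shift c = σ 0 has 2c = 0, and c ≠ 0 because otherwise every vertex would be o; only c = m
  -- is left.
  have hc2 : σ 0 + σ 0 = 0 := by rw [← hadd' (σ 0), hσσ]
  have hp : ∀ i, discChart o (P.vertex (σ i)) = -discChart o (P.vertex i) := fun i => by
    rw [← hσ, discChart_halfTurn]
  have hc0 : σ 0 ≠ 0 := by
    intro h0
    have hz : ∀ i, P.vertex i = o := fun i => by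
      have := hp i
      rw [hadd', h0, zero_add] at this
      exact discChart_eq_zero_iff.1 (self_eq_neg.1 this)
    have h01 : (0 : ZMod (2 * m)) - 1 = 0 := P.vertex_injective (by rw [hz, hz])
    exact (P.sub_one_ne 0).1 h01
  have hc : σ 0 = (m : ZMod (2 * m)) := by
    have hval : ((σ 0).val : ZMod (2 * m)) = σ 0 := ZMod.natCast_zmod_val _
    have hlt := (σ 0).val_lt
    have hv0 : (σ 0).val ≠ 0 := fun h => hc0 ((ZMod.val_eq_zero _).1 h)
    rw [← hval, ← Nat.cast_add, ZMod.natCast_eq_zero_iff] at hc2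
    obtain ⟨r, hr⟩ := hc2
    have hr1 : r = 1 := by
      have : 0 < r := Nat.pos_of_ne_zero fun h => by subst h; omega
      have : r < 2 := by
        by_contra! h
        have := Nat.mul_le_mul_left (2 * m) h
        omega
      omega
    subst hr1
    rw [← hval]
    congr 1; omega
  refine ⟨o, fun i => ?_⟩
  rw [← hp, hadd', hc, add_comm]

lemma sum_range_two_mul (f : ℕ → ℝ) (m : ℕ) : ∑ i ∈ Finset.range (2 * m), f i =
    ∑ i ∈ Finset.range m, f (2 * i) + ∑ i ∈ Finset.range m, f (2 * i + 1) := by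
  induction m with
  | zero => simp
  | succ m ih =>
    rw [show 2 * (m + 1) = 2 * m + 1 + 1 by ring, Finset.sum_range_succ, Finset.sum_range_succ, ih,
      Finset.sum_range_succ, Finset.sum_range_succ]
    ring

/-- The midpoint datum of a side attached to the translation onto the opposite side. -/
lemma IsOppositeSideTranslation.exists_sideRel {m : ℕ} {P : ConvexPolygon (2 * m)}
    {i : ZMod (2 * m)} {g : Matrix.SpecialLinearGroup (Fin 2) ℝ}
    (hg : P.IsOppositeSideTranslation i g) {o : ℍ} (ho : ∀ i : ZMod (2 * m),
      discChart o (P.vertex (i + (m : ZMod (2 * m)))) = -discChart o (P.vertex i)) :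
    ∃ K, ‖K‖ < 1 ∧ SideRel K (discChart o (P.vertex i)) (discChart o (P.vertex (i + 1))) ∧
      (g 0 0 + g 1 1) ^ 2 * (1 - ‖K‖ ^ 2) = 4 := by
  obtain ⟨hhyp, himg⟩ := hg
  have hne : ∀ j, P.vertex j ≠ P.vertex (j + 1) := fun j h => by
    have := (P.sub_one_ne (j + 1)).1
    rw [add_sub_cancel_right] at this
    exact this (P.vertex_injective h)
  unfold ConvexPolygon.side at himg
  rw [smul_image_segment] at himg
  obtain ⟨α, β, hdet, htr, hact⟩ := exists_disc_action o g
  have hend := endpoints_of_segment_eq (hne _) himg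
  have a1 := hact (P.vertex i)
  have a2 := hact (P.vertex (i + 1))
  have s1 := ho i
  have s2 := ho (i + 1)
  rw [show i + 1 + (m : ZMod (2 * m)) = i + m + 1 by ring] at s2
  refine exists_sideRel_of_action (norm_discChart_lt_one _ _) (norm_discChart_lt_one _ _)
    (fun h => hne i (discChart_injective o h)) hdet htr ?_ ?_
  · have h := hhyp
    unfold Matrix.IsHyperbolic at h
    rw [Matrix.discr_fin_two, Matrix.trace_fin_two, Matrix.SpecialLinearGroup.det_coe] at h
    linarith
  · rcases hend with ⟨h1, h2⟩ | ⟨h1, h2⟩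
    · left
      rw [h1, s1] at a1
      rw [h2, s2] at a2
      exact ⟨a1, a2⟩
    · right
      rw [h1, s2] at a1
      rw [h2, s1] at a2
      exact ⟨a1, a2⟩

end ConvexPolygon

end HyperbolicPlane

/-! ### Assembly of the theorem -/

theorem theorem3 (m : ℕ) (P : HyperbolicPlane.ConvexPolygon (2 * m))
    (hsymm : P.CentrallySymmetric) (hcycle : P.CycleCondition)
    (g : ZMod (2 * m) → Matrix.SpecialLinearGroup (Fin 2) ℝ)
    (hg : ∀ i : ZMod (2 * m), P.IsOppositeSideTranslation i (g i)) :
    ∑ i ∈ Finset.range (2 * m),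
      1 / (1 + Real.exp (HyperbolicPlane.translationLength (g (i : ZMod (2 * m))))) < 1 := by
  obtain ⟨o, ho⟩ := hsymm.exists_centre
  obtain ⟨k, hk, heven, hodd⟩ := hcycle
  have h3 := P.three_le
  set p : ℕ → ℂ := fun i => HyperbolicPlane.discChart o (P.vertex (i : ZMod (2 * m))) with hp
  have hp1 : ∀ i, ‖p i‖ < 1 := fun i => HyperbolicPlane.norm_discChart_lt_one _ _
  have hpm : ∀ i, p (i + m) = -p i := fun i => by
    simp only [hp]
    rw [← ho]; push_cast; rfl
  have hK : ∀ i : ℕ, ∃ K : ℂ, ‖K‖ < 1 ∧ HyperbolicPlane.SideRel K (p i) (p (i + 1)) ∧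
      (g (i : ZMod (2 * m)) 0 0 + g (i : ZMod (2 * m)) 1 1) ^ 2 * (1 - ‖K‖ ^ 2) = 4 := fun i => by
    have := (hg i).exists_sideRel ho
    simp only [hp]
    push_cast
    exact this
  choose K hK1 hrel hKtr using hK
  obtain ⟨hGB, hpos⟩ := P.sum_angle_eq o
  have hsplit : ∀ f : ℕ → ℝ, (∀ i, f (i + m) = f i) →
      ∑ i ∈ Finset.range (2 * m), f i = 2 * ∑ i ∈ Finset.range m, f i := fun f hf => by
    rw [two_mul m, Finset.sum_range_add, two_mul]
    congr 1
    exact Finset.sum_congr rfl fun i _ => by rw [add_comm, hf]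
  have hsk := hsplit (fun i => HyperbolicPlane.skew (p i) (p (i + 1))) fun i => by
    rw [show i + m + 1 = i + 1 + m by ring, hpm, hpm, HyperbolicPlane.skew_neg_neg]
  change 0 < ∑ i ∈ Finset.range (2 * m), HyperbolicPlane.skew (p i) (p (i + 1)) at hpos
  change _ = _ - ∑ i ∈ Finset.range (2 * m), HyperbolicPlane.skew (p i) (p (i + 1)) at hGB
  rw [HyperbolicPlane.ConvexPolygon.sum_range_two_mul (fun i => P.angle (i : ZMod (2 * m))), heven,
    hodd, hsk] at hGB
  rw [hsk] at hpos
  have hchain := HyperbolicPlane.chain_bound (by omega) hp1 hpm hK1 hrel hk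
    (by push_cast at hGB; linarith) (by linarith)
  have hKm := hsplit (fun i => 1 - ‖K i‖) fun i => by
    have h := hrel (i + m)
    rw [hpm, show i + m + 1 = i + 1 + m by ring, hpm] at h
    rw [(hrel i).neg_unique h (hp1 _) (hp1 _), norm_neg]
  calc ∑ i ∈ Finset.range (2 * m),
        1 / (1 + Real.exp (HyperbolicPlane.translationLength (g (i : ZMod (2 * m)))))
      ≤ ∑ i ∈ Finset.range (2 * m), (1 - ‖K i‖) / 2 := Finset.sum_le_sum fun i _ =>
        HyperbolicPlane.one_div_one_add_exp_le (norm_nonneg _) (hK1 i) (hKtr i)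
    _ = ∑ i ∈ Finset.range m, (1 - ‖K i‖) := by rw [← Finset.sum_div, hKm]; ring
    _ < 1 := hchain
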